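/- Let $\underline p=(p_k)_{k\ge 2}$ be a probability distribution on $\{2,3,\dots\}$ with $p_k=0$ for all $k>\Delta$, where $\Delta\in\mathbb N$; put $p_1:=0$ and $q_k:=\sum_{d\ge k}p_d$. **PWIT and RDCP.** The Poisson weighted infinite tree (PWIT) has as vertices all finite strings of positive integers, with root $\varnothing$; the children of $\mathbf i$ are $\mathbf i j$, $j\ge 1$. The labels $\tau^{\mathbf i1}<\tau^{\mathbf i2}<\dots$ of the edges $\{\mathbf i,\mathbf ij\}$ are the points of a unit intensity Poisson process on $[0,\infty)$, and every vertex has a degree constraint $d(\mathbf i)\sim\underline p$; all of these are independent. In the random degree constrained process (RDCP) on the PWIT an edge with label $x$ is added at time $x$ if and only if, right before time $x$, the degrees of both endpoints are strictly less than their degree constraints. For $\hat t\in[0,\infty]$ let $G^\infty_{\underline p}(\hat t)$ be the connected component of the root in the graph of the added edges with label at most $\hat t$. The phantom saturation time $T_{\mathbf i}$ of $\mathbf i$ is the time when the degree of $\mathbf i$ reaches $d(\mathbf i)$ in the RDCP on the subtree that consists of $\mathbf i$ and its descendants. **MTBP.** Let $\lambda:[0,\infty)\to\mathbb R$ solve $$\lambda'(t)=e^{-\lambda(t)}\sum_{k=0}^{\Delta-1}\frac{\lambda(t)^k}{k!}q_{k+1},\qquad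 \lambda(0)=0,$$ and let $f:=-\lambda''$, $z_k^t:=e^{-\lambda(t)}\frac{\lambda(t)^k}{k!}p_{k+1}$. The multi-type branching process (MTBP) is the following random rooted tree with types $T_{\mathbf i}>0$, degree constraints $d(\mathbf i)$ and edge labels $\tau^{\mathbf i}>0$. The type of the root has density $f$. Given that the type of a vertex is $t_0$, its degree constraint equals $k\ge2$ with probability $z_{k-1}^{t_0}/\sum_{l\ge 0} z_l^{t_0}$. Given that the type is $t_0$ and the degree constraint is $d$, a non-root vertex has $d-1$ children, whose (edge label, type) pairs are i.i.d. with joint density $$g_{t_0}(t,s)=\frac{f(s)}{\lambda(t_0)}\mathbf 1[0\le t\le t_0,\ t\le s],$$ listed in increasing order of the edge labels. The root has $d-1$ children of this kind and, independently of them, a $d$-th child with edge label $t_0$ whose type has density $\frac{f(s)}{\int_{t_0}^\infty f(u)\,du}\mathbf 1[s>t_0]$. Different vertices of one generation reproduce independently, and the offspring depends on the past only through the type and the degree constraint of the parent. Let $\mathcal M_{\underline p}(\hat t)$ be the connected component of the root in the graph formed by the edges with label less than $\hat t$. **Theorem.** 1. The initial value problem for $\lambda$ has exactly one solution on $[0,\infty)$.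 It is twice differentiable, $f=-\lambda''=\lambda'\sum_{k\ge0} z_k^{\,\cdot}\ge 0$, and $f$ and, for every $t_0>0$, the densities and the probability mass function displayed above have total mass $1$. 2. Almost surely, the RDCP is well defined on the PWIT and on the subtree rooted at any of its vertices (there is exactly one edge set that satisfies the rule for adding edges), and all phantom saturation times are finite. 3. For every $\hat t\in[0,\infty]$, the tree $G^\infty_{\underline p}(\hat t)$ decorated with the phantom saturation times $T_{\mathbf i}$, the degree constraints $d(\mathbf i)$ and the edge labels $\tau^{\mathbf i}$ has the same distribution, as a decorated rooted tree in which the children of every vertex are listed in increasing order of their edge labels, as $\mathcal M_{\underline p}(\hat t)$ decorated with the types $T_{\mathbf i}$, the degree constraints $d(\mathbf i)$ and the edge labels $\tau^{\mathbf i}$. 4. For a probability measure $\nu$ on $[0,\infty]$ let $T_1,T_2,\dots$ be i.i.d. with law $\nu$, let $\tau^1<\tau^2<\dots$ be the points of a unit intensity Poisson process on $[0,\infty)$, let $D\sim\underline p$, all independent, and let $N$ be the smallest $j$ such that exactly $D$ of the indices $k\le j$ satisfy $\tau^k<T_k$. We say that $\nu$ solves the recursive distributional equation if $\tau^N$ (defined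 as $\infty$ if there is no such $j$) has law $\nu$. Every phantom saturation time $T_{\mathbf i}$ of the RDCP on the PWIT has density $f$; its law solves the recursive distributional equation, and is the only solution. -/

import Mathlib

open MeasureTheory ProbabilityTheory Set
open scoped ENNReal

noncomputable section

/-- The disjoint-union σ-algebra on `Option α`: a set is measurable iff its trace on `α` is. -/
instance Option.instMeasurableSpaceDisjoint {α : Type*} [MeasurableSpace α] :
    MeasurableSpace (Option α) := MeasurableSpace.map some inferInstance

namespace RDCP

/-! ### Decorated rooted trees

Vertices are finite strings of natural numbers. The string `i₁ i₂ … iₙ` is stored as the list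
`[iₙ, …, i₁]` and indices start at `0`. So the root is `[]`, the children of `i` are the lists
`j :: i`, the parent of a vertex `e ≠ []` is `e.tail`, and the descendants of `i` are the lists
`l ++ i`. An edge is identified with its lower endpoint, a nonempty list. -/

/-- The decoration of a vertex: the label of the edge to its parent (by convention `0` for the
root), its type, and its degree constraint. -/
abbrev Mark : Type := ℝ × ℝ × ℕ

/-- A decorated rooted tree whose vertices form a subset of the finite strings; `none` marks the
strings which are not vertices. -/
abbrev DecoratedTree : Type := List ℕ → Option Mark

/-! ### The Poisson weighted infinite tree with degree constraints -/

/-- To every vertex `i` we attach the sequence of the labels of the edges from `i` to its children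
and the degree constraint of `i`. -/
abbrev Env : Type := List ℕ → (ℕ → ℝ) × ℕ

/-- The label of an edge, the edge being given by its lower endpoint. -/
def label (ω : Env) : List ℕ → ℝ
  | [] => 0
  | j :: i => (ω i).1 j

/-- The degree constraint of a vertex. -/
def constraint (ω : Env) (i : List ℕ) : ℕ := (ω i).2

/-- The environment rooted at `i`: only `i` and its descendants are kept. -/
def subtree (ω : Env) (i : List ℕ) : Env := fun l => ω (l ++ i)

instance isProbabilityMeasure_exp_one : IsProbabilityMeasure (expMeasure 1) :=
  isProbabilityMeasure_expMeasure one_pos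

/-- The law of the points, in increasing order, of a unit intensity Poisson point process
on `[0, ∞)`: the arrival times of the rate one Poisson process. -/
def pppLaw : Measure (ℕ → ℝ) :=
  (Measure.infinitePi fun _ : ℕ => expMeasure 1).map
    fun g j => ∑ k ∈ Finset.range (j + 1), g k

instance isProbabilityMeasure_pppLaw : IsProbabilityMeasure pppLaw :=
  Measure.isProbabilityMeasure_map (by fun_prop)

/-- The law of the PWIT decorated with i.i.d. degree constraints with distribution `p`. -/
def pwitLaw (p : PMF ℕ) : Measure Env :=
  Measure.infinitePi fun _ : List ℕ => pppLaw.prod p.toMeasure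

/-! ### The random degree constrained process -/

/-- The degree of the vertex `v` in the graph with edge set `G`, where only those edges are
counted whose label is in `S`. -/
def degree (ω : Env) (G : Set (List ℕ)) (S : Set ℝ) (v : List ℕ) : ℕ∞ :=
  {e | e ∈ G ∧ e ≠ [] ∧ (e = v ∨ e.tail = v) ∧ label ω e ∈ S}.encard

/-- `G` is the set of all edges that are ever added by the random degree constrained process:
an edge `e` is added iff right before time `label ω e` the degrees of both endpoints of `e` are
strictly less than their degree constraints. -/
def IsRDCP (ω : Env) (G : Set (List ℕ)) : Prop :=
  ∀ e, e ∈ G ↔ e ≠ [] ∧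
    degree ω G (Iio (label ω e)) e.tail < constraint ω e.tail ∧
    degree ω G (Iio (label ω e)) e < constraint ω e

open Classical in
/-- The edge set of the final graph of the process (to be used where `IsRDCP ω` has exactly one
solution). -/
def rdcp (ω : Env) : Set (List ℕ) :=
  if h : ∃ G, IsRDCP ω G then h.choose else ∅

/-- The time when the degree of `v` reaches its degree constraint (`∞` if this never happens). -/
def saturationTime (ω : Env) (v : List ℕ) : ℝ≥0∞ :=
  sInf {t : ℝ≥0∞ |
    (constraint ω v : ℕ∞) ≤ degree ω (rdcp ω) {x | ENNReal.ofReal x ≤ t} v}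

/-- The phantom saturation time of `i`: the saturation time of `i` in the process on the tree
rooted at `i`. -/
def phantomTime (ω : Env) (i : List ℕ) : ℝ≥0∞ := saturationTime (subtree ω i) []

/-- The vertices of the connected component of the root in the graph formed by those edges
added by the process whose label is at most `t`. -/
def InComponent (ω : Env) (t : ℝ≥0∞) : List ℕ → Prop
  | [] => True
  | j :: i => InComponent ω t i ∧ (j :: i) ∈ rdcp ω ∧ ENNReal.ofReal (label ω (j :: i)) ≤ t

open Classical in
/-- Relabelling of the vertices of the tree with vertex set `S` such that the children of every
vertex become child `0`, child `1`, … in the order of their indices. The result is the old name of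
the vertex whose new name is the given string, if there is one. -/
def oldName (S : List ℕ → Prop) : List ℕ → Option (List ℕ)
  | [] => some []
  | k :: i => (oldName S i).bind fun v =>
      if (k : ℕ∞) < {j | S (j :: v)}.encard then some (Nat.nth (fun j => S (j :: v)) k :: v)
      else none

/-- The component of the root at time `t` in the process on the PWIT, decorated with edge labels,
phantom saturation times and degree constraints. As the labels `(ω i).1 0 < (ω i).1 1 < …` are
increasing, the children of every vertex are listed in increasing order of their edge labels; thus
this is the canonical representative of the decorated rooted tree up to isomorphism. -/
def pwitTree (t : ℝ≥0∞) (ω : Env) : DecoratedTree := fun i =>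
  (oldName (InComponent ω t) i).map fun v =>
    (label ω v, (phantomTime ω v).toReal, constraint ω v)

/-! ### The function `λ` and the densities -/

/-- `q_k = ∑_{d ≥ k} p_d`. -/
def q (p : PMF ℕ) (k : ℕ) : ℝ := ∑' d, if k ≤ d then (p d).toReal else 0

/-- `lam` solves on `[0, ∞)` the initial value problem
`λ' = e^{-λ} ∑_{k < Δ} λ^k q_{k+1} / k!`, `λ(0) = 0`. -/
structure IsLambda (p : PMF ℕ) (Δ : ℕ) (lam : ℝ → ℝ) : Prop where
  zero : lam 0 = 0
  deriv : ∀ t, 0 ≤ t → HasDerivWithinAt lam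
    (Real.exp (-lam t) * ∑ k ∈ Finset.range Δ, lam t ^ k / k.factorial * q p (k + 1)) (Ici 0) t

/-- `z_k^t = e^{-λ(t)} λ(t)^k / k! · p_{k+1}`. -/
def z (p : PMF ℕ) (lam : ℝ → ℝ) (t : ℝ) (k : ℕ) : ℝ :=
  Real.exp (-lam t) * (lam t ^ k / k.factorial) * (p (k + 1)).toReal

/-- `λ'` on `[0, ∞)`. -/
def lamDeriv (lam : ℝ → ℝ) (t : ℝ) : ℝ := derivWithin lam (Ici 0) t

/-- `f = -λ''` on `[0, ∞)`. -/
def typeDensity (lam : ℝ → ℝ) (t : ℝ) : ℝ := -derivWithin (lamDeriv lam) (Ici 0) t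

/-- The region `A_{t₀} = {(t, s) : 0 ≤ t ≤ t₀, t ≤ s}`. -/
def region (t₀ : ℝ) : Set (ℝ × ℝ) := {x | 0 ≤ x.1 ∧ x.1 ≤ t₀ ∧ x.1 ≤ x.2}

/-- The law on `[0, ∞)` with density `f`. -/
def typeLaw (lam : ℝ → ℝ) : Measure ℝ :=
  (volume.restrict (Ici 0)).withDensity fun s => ENNReal.ofReal (typeDensity lam s)

/-- Given the type `t₀` of a vertex, its degree constraint is `k ≥ 2` with probability
`z_{k-1}^{t₀} / ∑_l z_l^{t₀}`. -/
def constraintKernel (p : PMF ℕ) (lam : ℝ → ℝ) : Kernel ℝ ℕ :=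
  Kernel.withDensity (Kernel.const ℝ Measure.count) fun t₀ k =>
    if 0 ≤ t₀ ∧ 2 ≤ k then ENNReal.ofReal (z p lam t₀ (k - 1) / ∑' l, z p lam t₀ l) else 0

open Classical in
/-- Given the type `t₀` of the parent, the (edge label, type) pair of a child has density
`f(s) / λ(t₀)` on `A_{t₀}`. -/
def pairKernel (lam : ℝ → ℝ) : Kernel ℝ (ℝ × ℝ) :=
  Kernel.withDensity (Kernel.const ℝ (volume : Measure (ℝ × ℝ))) fun t₀ x =>
    if x ∈ region t₀ then ENNReal.ofReal (typeDensity lam x.2 / lam t₀) else 0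

/-- Given the type `t₀` of the root, the type of its last child has density
`f(s) / ∫_{t₀}^∞ f` on `s > t₀`. -/
def lastTypeKernel (lam : ℝ → ℝ) : Kernel ℝ ℝ :=
  Kernel.withDensity (Kernel.const ℝ (volume : Measure ℝ)) fun t₀ s =>
    if t₀ < s then ENNReal.ofReal (typeDensity lam s / ∫ u in Ioi t₀, typeDensity lam u) else 0

/-! ### General constructions for kernels -/

section Kernels

variable {α β : Type*} [MeasurableSpace α] [MeasurableSpace β]

/-- Replace `κ a` by the Dirac mass at `b` for those (exceptional) `a` for which `κ a` is not a
probability measure. -/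
def completed (κ : Kernel α β) (b : β) : Kernel α β :=
  open Classical in
  Kernel.piecewise (s := {a | κ a univ = 1})
    (measurableSet_eq_fun (κ.measurable_coe MeasurableSet.univ) measurable_const)
    κ (Kernel.const α (Measure.dirac b))

instance isMarkovKernel_completed (κ : Kernel α β) (b : β) : IsMarkovKernel (completed κ b) := by
  refine ⟨fun a => ⟨?_⟩⟩
  classical
  rw [completed, Kernel.piecewise_apply]
  split_ifs with h
  · exact h
  · simp

/-- The product of countably many independent kernels. -/
def piKernel {ι : Type*} [Countable ι] {γ : ι → Type*} [∀ i, MeasurableSpace (γ i)]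
    (κ : ∀ i, Kernel α (γ i)) [∀ i, IsMarkovKernel (κ i)] : Kernel α (∀ i, γ i) where
  toFun a := Measure.infinitePi fun i => κ i a
  measurable' := by
    refine Measurable.measure_of_isPiSystem_of_isProbabilityMeasure
      (generateFrom_squareCylinders (α := γ)).symm (isPiSystem_squareCylinders
        (fun i => MeasurableSpace.isPiSystem_measurableSet) (fun _ => MeasurableSet.univ)) ?_
    rintro S ⟨s, t, ht, rfl⟩
    have h : ∀ a, Measure.infinitePi (fun i => κ i a) (Set.pi s t) = ∏ i ∈ s, κ i a (t i) :=
      fun a => Measure.infinitePi_pi _ fun i _ => by simpa using ht i (mem_univ i)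
    simp_rw [h]
    refine Finset.measurable_prod _ fun i _ => (κ i).measurable_coe ?_
    simpa using ht i (mem_univ i)

instance isMarkovKernel_piKernel {ι : Type*} [Countable ι] {γ : ι → Type*}
    [∀ i, MeasurableSpace (γ i)] (κ : ∀ i, Kernel α (γ i)) [∀ i, IsMarkovKernel (κ i)] :
    IsMarkovKernel (piKernel κ) :=
  ⟨fun a => inferInstanceAs (IsProbabilityMeasure (Measure.infinitePi fun i => κ i a))⟩

/-- Extension of a kernel to `Option α`, with the Dirac mass at `b` for `none`. -/
def optionKernel (κ : Kernel α β) (b : β) : Kernel (Option α) β where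
  toFun o := o.elim (Measure.dirac b) κ
  measurable' := fun _ hs => κ.measurable hs

instance isMarkovKernel_optionKernel (κ : Kernel α β) [IsMarkovKernel κ] (b : β) :
    IsMarkovKernel (optionKernel κ b) := by
  refine ⟨fun o => ?_⟩
  cases o with
  | none => exact inferInstanceAs (IsProbabilityMeasure (Measure.dirac b))
  | some a => exact inferInstanceAs (IsProbabilityMeasure (κ a))

end Kernels

/-! ### The multi-type branching process -/

variable (p : PMF ℕ) (lam : ℝ → ℝ)

/-- The mark of a (not last) child of a vertex of type `t₀`: the pair (edge label, type), and a
degree constraint given the type. -/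
def childKernel : Kernel ℝ Mark :=
  (completed (pairKernel lam) (0, 0) ⊗ₖ
    (completed (constraintKernel p lam) 0).comap (fun x : ℝ × ℝ × ℝ => x.2.2) (by fun_prop)).map
    (fun y : (ℝ × ℝ) × ℕ => (y.1.1, y.1.2, y.2))

instance isMarkovKernel_childKernel : IsMarkovKernel (childKernel p lam) :=
  Kernel.IsMarkovKernel.map _ (by fun_prop)

/-- The mark of the last child of the root, if the type of the root is `t₀`: the edge label is
`t₀`, the type is sampled from its density, the degree constraint is sampled given the type. -/
def lastChildKernel : Kernel ℝ Mark :=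
  Kernel.id ×ₖ (completed (lastTypeKernel lam) 0 ⊗ₖ
    (completed (constraintKernel p lam) 0).comap (fun x : ℝ × ℝ => x.2) (by fun_prop))

instance isMarkovKernel_lastChildKernel : IsMarkovKernel (lastChildKernel p lam) := by
  unfold lastChildKernel; infer_instance

/-- The first `n` terms of `x` in increasing order of their edge labels. -/
def sorted (n : ℕ) (x : ℕ → Mark) (k : ℕ) : Option Mark :=
  if h : k < n then some (x (Tuple.sort (fun j : Fin n => (x j).1) ⟨k, h⟩)) else none

theorem measurable_some {α : Type*} [MeasurableSpace α] :
    Measurable (some : α → Option α) := fun _ hs => hs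

theorem measurable_sorted (n : ℕ) : Measurable (sorted n) := by
  refine measurable_pi_lambda _ fun k => ?_
  unfold sorted
  split_ifs with h
  · refine measurable_some.comp ?_
    let _ : MeasurableSpace (Equiv.Perm (Fin n)) := ⊤
    have hsort : Measurable fun x : ℕ → Mark => Tuple.sort (fun j : Fin n => (x j).1) := by
      refine measurable_to_countable' fun σ => ?_
      have : (fun x : ℕ → Mark => Tuple.sort (fun j : Fin n => (x j).1)) ⁻¹' {σ} =
          (⋂ (i : Fin n) (j : Fin n) (_ : i ≤ j), {x | (x (σ i)).1 ≤ (x (σ j)).1}) ∩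
            ⋂ (i : Fin n) (j : Fin n) (_ : i < j),
              ({x | (x (σ i)).1 = (x (σ j)).1}ᶜ ∪ {_x | σ i < σ j}) := by
        ext x
        have h := Tuple.eq_sort_iff (f := fun j : Fin n => (x j).1) (σ := σ)
        simp only [mem_preimage, mem_singleton_iff, mem_inter_iff, mem_iInter, mem_union,
          mem_compl_iff, mem_ofPred_eq, ← imp_iff_not_or]
        rw [eq_comm, h]
        rfl
      rw [this]
      have hm : ∀ i, Measurable fun x : ℕ → Mark => (x i).1 := fun i => by fun_prop
      refine MeasurableSet.inter ?_ ?_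
      · exact MeasurableSet.iInter fun i => MeasurableSet.iInter fun j =>
          MeasurableSet.iInter fun _ => measurableSet_le (hm _) (hm _)
      · exact MeasurableSet.iInter fun i => MeasurableSet.iInter fun j =>
          MeasurableSet.iInter fun _ =>
            (measurableSet_eq_fun (hm _) (hm _)).compl.union (MeasurableSet.const _)
    have hidx : Measurable fun x : ℕ → Mark =>
        ((Tuple.sort (fun j : Fin n => (x j).1) ⟨k, h⟩ : Fin n) : ℕ) :=
      (measurable_of_countable fun σ : Equiv.Perm (Fin n) => ((σ ⟨k, h⟩ : Fin n) : ℕ)).comp hsort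
    have hev : Measurable fun y : (ℕ → Mark) × ℕ => y.1 y.2 :=
      measurable_from_prod_countable_left fun m => measurable_pi_apply m
    exact hev.comp (measurable_id.prodMk hidx)
  · exact measurable_const

/-- The marks of the children of a non-root vertex with mark `m`, of type `m.2.1` and degree
constraint `m.2.2`: there are `m.2.2 - 1` children, which are sampled independently and listed in
increasing order of their edge labels. -/
def offspring : Kernel Mark (ℕ → Option Mark) :=
  (Kernel.id ×ₖ (piKernel fun _ : ℕ => childKernel p lam).comap (fun m : Mark => m.2.1)
    (by fun_prop)).map fun y : Mark × (ℕ → Mark) => sorted (y.1.2.2 - 1) y.2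

theorem measurable_sorted_uncurry {α : Type*} [MeasurableSpace α] {d : α → ℕ}
    {x : α → ℕ → Mark} (hd : Measurable d) (hx : Measurable x) :
    Measurable fun a => sorted (d a) (x a) :=
  (measurable_from_prod_countable_left (f := fun y : (ℕ → Mark) × ℕ => sorted y.2 y.1)
    fun n => measurable_sorted n).comp (hx.prodMk hd)

instance isMarkovKernel_offspring : IsMarkovKernel (offspring p lam) :=
  Kernel.IsMarkovKernel.map _ (measurable_sorted_uncurry (by fun_prop) (by fun_prop))

/-- The marks of the children of the root with mark `m`: in addition to the `m.2.2 - 1` children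
as for the other vertices, there is an independent last child. -/
def rootOffspring : Kernel Mark (ℕ → Option Mark) :=
  (Kernel.id ×ₖ (offspring p lam ×ₖ
    (lastChildKernel p lam).comap (fun m : Mark => m.2.1) (by fun_prop))).map
    fun y : Mark × (ℕ → Option Mark) × Mark =>
      fun k => if k = y.1.2.2 - 1 then some y.2.2 else y.2.1 k

instance isMarkovKernel_rootOffspring : IsMarkovKernel (rootOffspring p lam) := by
  refine Kernel.IsMarkovKernel.map _ (measurable_pi_lambda _ fun k => ?_)
  refine Measurable.ite ?_ (measurable_some.comp (by fun_prop)) (by fun_prop)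
  exact measurableSet_eq_fun measurable_const
    ((measurable_of_countable fun d : ℕ => d - 1).comp (by fun_prop))

/-- The marks of the children of the string `i`, given its mark; there are no children if `i` is
not a vertex. For `i = []` the vertex is the root. -/
def reproduction (i : List ℕ) : Kernel (Option Mark) (ℕ → Option Mark) :=
  optionKernel (if i = [] then rootOffspring p lam else offspring p lam) fun _ => none

instance isMarkovKernel_reproduction (i : List ℕ) : IsMarkovKernel (reproduction p lam i) := by
  unfold reproduction
  split_ifs <;> infer_instance

/-- The next generation, built from the offspring `y i` of all strings `i`. -/
def nextGeneration (y : List ℕ → ℕ → Option Mark) : DecoratedTree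
  | [] => none
  | j :: i => y i j

/-- One step of the branching process: all vertices of the current generation reproduce
independently of each other. -/
def stepKernel : Kernel DecoratedTree DecoratedTree :=
  (piKernel fun i => (reproduction p lam i).comap (fun x : DecoratedTree => x i)
    (measurable_pi_apply i)).map nextGeneration

instance isMarkovKernel_stepKernel : IsMarkovKernel (stepKernel p lam) := by
  refine Kernel.IsMarkovKernel.map _ (measurable_pi_lambda _ fun l => ?_)
  cases l with
  | nil => exact measurable_const
  | cons j i => exact (measurable_pi_apply j).comp (measurable_pi_apply i)

/-- The law of generation `0`: only the root, whose type has density `f`, and whose degree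
constraint is sampled given the type. -/
def rootLaw : Measure DecoratedTree :=
  (typeLaw lam ⊗ₘ completed (constraintKernel p lam) 0).map
    fun y l => if l = [] then some (0, y.1, y.2) else none

/-- The law of the sequence of the generations: a Markov chain which starts from `rootLaw` and
evolves according to `stepKernel`. -/
def generationsLaw : Measure (ℕ → DecoratedTree) :=
  Kernel.trajMeasure (X := fun _ => DecoratedTree) (rootLaw p lam) fun n =>
    (stepKernel p lam).comap
      (fun x : (_ : Finset.Iic n) → DecoratedTree => x ⟨n, Finset.mem_Iic.2 le_rfl⟩)
      (measurable_pi_apply _)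

/-- The law of the family tree of the branching process: the vertices of the `n`-th generation are
strings of length `n`. -/
def mtbpLaw : Measure DecoratedTree :=
  (generationsLaw p lam).map fun g l => g l.length l

/-- The component of the root in the graph formed by the edges with label less than `t`. -/
def cut (t : ℝ≥0∞) (x : DecoratedTree) : DecoratedTree
  | [] => x []
  | j :: i => (cut t x i).bind fun _ => (x (j :: i)).bind fun m =>
      open Classical in if ENNReal.ofReal m.1 < t then some m else none

/-! ### The recursive distributional equation -/

open Classical in
/-- `τ^N`, where `N` is the smallest `j` such that exactly `D` indices `k ≤ j` satisfy `τ^k < T_k`,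
and `∞` if there is no such `j`. -/
def chi (τ : ℕ → ℝ) (D : ℕ) (T : ℕ → ℝ≥0∞) : ℝ≥0∞ :=
  if h : ∃ j, ((Finset.range (j + 1)).filter fun k => ENNReal.ofReal (τ k) < T k).card = D
  then ENNReal.ofReal (τ (Nat.find h)) else ∞

/-- The probability measure `ν` on `[0, ∞]` solves the recursive distributional equation: if
`T, T_1, T_2, …` are i.i.d. with law `ν`, `τ` is a unit intensity Poisson process, `D` has
law `p`, and all of these are independent, then `chi τ D (T_1, T_2, …)` has law `ν`. -/
def SolvesRDE (ν : Measure ℝ≥0∞) : Prop :=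
  IsProbabilityMeasure ν ∧
    ((pppLaw.prod p.toMeasure).prod (Measure.infinitePi fun _ : ℕ => ν)).map
      (fun x : ((ℕ → ℝ) × ℕ) × (ℕ → ℝ≥0∞) => chi x.1.1 x.1.2 x.2) = ν

end RDCP

end

noncomputable section

namespace RDCP

/-! ### Sequences of independent marked exponential waiting times -/

/-! Everything rests on one computation with Poisson points. Give the points of a unit rate Poisson
process i.i.d. marks, accept those in a set `A`, and let `r(u)` be the acceptance rate and `Λ` its
primitive. Summing over the number of rejected points shows that the first `n + 1` accepted points
have density `exp (-Λ(t))`, `t` being the last label, with respect to the product of the intensities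
on increasing labels (`lintegral_first_points`). So, given that the last one is at `t`, the `n`
earlier ones are an ordered i.i.d. sample of the intensity before `t`, and `t` has density `exp (-Λ)
Λ^n / n! · r` (`lintegral_first_points_sort`).

On a fixed environment the process is given by well-founded recursion, as soon as paths with
decreasing labels below any bound `x` have bounded length. The expected number of such paths of
length `n` is at most `x^n / n!`, which gives this almost surely (`ae_exists_decreasingPathsShort`,
`Regular.wellFounded`). Before the label of the edge above a vertex `v`, only descendants matter to
`v`; hence the condition at the lower endpoint says that the label is smaller than the phantom time
of `v` (`Regular.degree_lt_constraint_iff`). Thus the root is joined to its first `d` available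
children, and any vertex whose parent edge is added to its first `d - 1` ones
(`Regular.mem_rdcp_root_iff`, `Regular.mem_rdcp_child_iff`), and the phantom times obey the
recursion `chi` with i.i.d. inputs (`Regular.phantomTime_eq`).

Let `G` be the tail of a solution `ν` of the recursive distributional equation and `Λ` its
primitive. The Poisson computation gives `-G' = closeRate(Λ) Λ'`, and `closeRate` is minus the
derivative of `openProb`, so `G = openProb(Λ)`, that is, `Λ' = openProb(Λ)`
(`HasEarlyLaw.rate_eq_openProb`). Hence `Λ` is the unique `λ` and `ν` is the law with density `f`
(`IsLambda.map_typeLaw`). This also shows that phantom times are finite, and existence of `λ`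
follows from that of the phantom times, without an existence theorem for differential equations.

For the tree, let the root have phantom time `t₀` and constraint `d`. Its first `d - 1` available
children are an ordered i.i.d. sample of (label, subtree) pairs with label before `t₀` and phantom
time beyond the label, and the `d`-th one sits at `t₀` with phantom time conditioned to exceed `t₀`.
These are exactly the offspring kernels; the factors `λ(t₀)` and `λ'(t₀)` in the density of `(t₀,
d)` are their normalisations. A vertex with a parent edge loses its last child, since one unit of
its constraint is spent on that edge. Induction over generations (`branchLaw`,
`BranchLaw.lintegral_measTree_succ`) identifies the laws, once the chain of generations has been
rewritten as a recursion over subtrees (`lintegral_trunc_mtbpLaw`). Finite times follow by cutting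
both trees (`Regular.pwitTree_eq_cut`). -/

theorem lintegral_expMeasure_one_add (s : ℝ) {φ : ℝ → ℝ≥0∞} (hφ : Measurable φ) :
    ∫⁻ g, φ (s + g) ∂expMeasure 1 =
      ∫⁻ t in Ioi s, ENNReal.ofReal (Real.exp (-(t - s))) * φ t := by
  have h1 : expMeasure 1 = (volume : Measure ℝ).withDensity (gammaPDF 1 1) := rfl
  have hm : Measurable (gammaPDF 1 1) := (measurable_gammaPDFReal 1 1).ennreal_ofReal
  rw [h1, lintegral_withDensity_eq_lintegral_mul _ hm (by fun_prop)]
  rw [← lintegral_add_left_eq_self (μ := volume)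
    (fun t => (Ioi s).indicator (fun t => ENNReal.ofReal (Real.exp (-(t - s))) * φ t) t) s |>.trans
    (lintegral_indicator measurableSet_Ioi _)]
  -- At `x = 0` the exponential density is `1` whereas `s` is not in `Ioi s`; this null set is
  -- discarded.
  refine lintegral_congr_ae ?_
  filter_upwards [compl_mem_ae_iff.2 (measure_singleton (0 : ℝ))] with x hx
  rcases lt_trichotomy x 0 with h | h | h
  · have : s + x ∉ Ioi s := by simp [h.le]
    rw [indicator_of_notMem this]
    simp [gammaPDF_of_neg h]
  · exact absurd h hx
  · have : s + x ∈ Ioi s := by simp [h]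
    rw [indicator_of_mem this]
    simp [gammaPDF_of_nonneg h.le, Real.Gamma_one]

/-- The sequence with first term `a`, followed by `ξ`. -/
def consSeq {X : Type*} (a : X) (ξ : ℕ → X) : ℕ → X
  | 0 => a
  | n + 1 => ξ n

theorem measurable_consSeq {X : Type*} [MeasurableSpace X] :
    Measurable fun y : X × (ℕ → X) => consSeq y.1 y.2 := by
  refine measurable_pi_lambda _ fun n => ?_
  cases n with
  | zero => exact measurable_fst
  | succ n => exact (measurable_pi_apply n).comp measurable_snd

/-- The regeneration property of an i.i.d. sequence, checked on boxes: a box splits into a condition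
on coordinate `0` and a shifted box for the rest. -/
theorem map_consSeq {X : Type*} [MeasurableSpace X] (Q : Measure X) [IsProbabilityMeasure Q] :
    (Q.prod (Measure.infinitePi fun _ : ℕ => Q)).map (fun y => consSeq y.1 y.2) =
      Measure.infinitePi fun _ : ℕ => Q := by
  refine Measure.eq_infinitePi _ fun s t ht => ?_
  rw [Measure.map_apply measurable_consSeq
    (MeasurableSet.pi s.countable_toSet fun i _ => ht i)]
  have : (fun y : X × (ℕ → X) => consSeq y.1 y.2) ⁻¹' (Set.pi s t) =
      (if 0 ∈ s then t 0 else univ) ×ˢ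
        (Set.pi ((s.erase 0).image Nat.pred) fun i => t (i + 1)) := by
    ext ⟨a, ξ⟩
    simp only [mem_preimage, Set.mem_pi, Finset.mem_coe, mem_prod, Finset.mem_image,
      Finset.mem_erase]
    constructor
    · intro h
      refine ⟨?_, ?_⟩
      · split_ifs with h0
        · exact h 0 h0
        · trivial
      · rintro i ⟨j, ⟨hj0, hj⟩, rfl⟩
        obtain ⟨k, rfl⟩ := Nat.exists_eq_succ_of_ne_zero hj0
        exact h _ hj
    · rintro ⟨h0, h⟩ i hi
      cases i with
      | zero => rw [if_pos hi] at h0; exact h0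
      | succ i => exact h i ⟨i + 1, ⟨by simp, hi⟩, rfl⟩
  rw [this, Measure.prod_prod, Measure.infinitePi_pi _ (fun i _ => ht _), Finset.prod_image]
  · have h2 : ∏ x ∈ s.erase 0, Q (t (x.pred + 1)) = ∏ x ∈ s.erase 0, Q (t x) := by
      refine Finset.prod_congr rfl fun x hx => ?_
      rw [Nat.pred_eq_sub_one, Nat.sub_add_cancel]
      exact Nat.one_le_iff_ne_zero.2 (Finset.mem_erase.1 hx).1
    rw [h2]
    split_ifs with h0
    · exact Finset.mul_prod_erase s (fun x => Q (t x)) h0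
    · rw [measure_univ, one_mul, Finset.erase_eq_of_notMem h0]
  · intro x hx y hy hxy
    have := Nat.one_le_iff_ne_zero.2 (Finset.mem_erase.1 hx).1
    have := Nat.one_le_iff_ne_zero.2 (Finset.mem_erase.1 hy).1
    simp only [Nat.pred_eq_sub_one] at hxy
    omega

theorem lintegral_infinitePi_consSeq {X : Type*} [MeasurableSpace X] (Q : Measure X)
    [IsProbabilityMeasure Q] {F : (ℕ → X) → ℝ≥0∞} (hF : Measurable F) :
    ∫⁻ ξ, F ξ ∂(Measure.infinitePi fun _ : ℕ => Q) =
      ∫⁻ a, ∫⁻ ξ, F (consSeq a ξ) ∂(Measure.infinitePi fun _ : ℕ => Q) ∂Q := by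
  conv_lhs => rw [← map_consSeq Q]
  rw [lintegral_map hF measurable_consSeq]
  exact lintegral_prod _ (hF.comp measurable_consSeq).aemeasurable

/-! ### Powers of a primitive -/

/-- Up to sign the integrand is the derivative, in the lower limit `u`, of the right-hand side with
`s` replaced by `u`. Monotonicity serves as a regularity assumption: `b` is integrable and
continuous off a countable set, which suffices for the fundamental theorem of calculus. -/
theorem integral_mul_pow_primitive {b : ℝ → ℝ} (hb : Monotone b) (n : ℕ) (s t : ℝ) :
    ∫ u in s..t, b u * ((∫ x in u..t, b x) ^ n / n.factorial) =
      (∫ x in s..t, b x) ^ (n + 1) / (n + 1).factorial := by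
  have hi : ∀ u v, IntervalIntegrable b volume u v := fun u v => hb.intervalIntegrable
  have hc : Continuous fun u => ∫ x in u..t, b x := by
    have : (fun u => ∫ x in u..t, b x) = fun u => -∫ x in t..u, b x := by
      ext u; exact intervalIntegral.integral_symm _ _
    rw [this]
    exact (intervalIntegral.continuous_primitive hi t).neg
  have key := integral_eq_of_hasDerivAt_off_countable
    (fun u => -((∫ x in u..t, b x) ^ (n + 1) / (n + 1).factorial))
    (fun u => b u * ((∫ x in u..t, b x) ^ n / n.factorial)) (a := s) (b := t)
    hb.countable_not_continuousAt (by fun_prop) ?_ ?_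
  · rw [key]; simp
  · intro x hx
    have hx' : ContinuousAt b x := by
      by_contra h
      exact hx.2 h
    have h1 : HasDerivAt (fun u => ∫ x in u..t, b x) (-b x) x :=
      intervalIntegral.integral_hasDerivAt_left (hi x t)
        (hb.measurable.stronglyMeasurable.stronglyMeasurableAtFilter) hx'
    have h2 := ((h1.pow (n + 1)).div_const ((n + 1).factorial : ℝ)).neg
    have h5 : b x * ((∫ x in x..t, b x) ^ n / n.factorial) =
        -(((n + 1 : ℕ) : ℝ) * (∫ x in x..t, b x) ^ (n + 1 - 1) * -b x / (n + 1).factorial) := by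
      have : ((n + 1).factorial : ℝ) = (n + 1) * n.factorial := by
        rw [Nat.factorial_succ]; push_cast; ring
      have h3 : (n.factorial : ℝ) ≠ 0 := by positivity
      have h4 : (n + 1 : ℝ) ≠ 0 := by positivity
      rw [this, Nat.add_sub_cancel]
      push_cast
      field_simp
    rw [h5]
    exact h2
  · exact (hi s t).mul_continuousOn (by fun_prop)

theorem lintegral_mul_pow_primitive {b : ℝ → ℝ} (hb : Monotone b) (hb0 : ∀ u, 0 ≤ b u) (n : ℕ)
    {s t : ℝ} (hst : s ≤ t) :
    ∫⁻ u in Ioo s t, ENNReal.ofReal (b u) *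
        ENNReal.ofReal ((∫ x in u..t, b x) ^ n / n.factorial) =
      ENNReal.ofReal ((∫ x in s..t, b x) ^ (n + 1) / (n + 1).factorial) := by
  have hi : ∀ u v, IntervalIntegrable b volume u v := fun u v => hb.intervalIntegrable
  have hc : Continuous fun u => ∫ x in u..t, b x := by
    have : (fun u => ∫ x in u..t, b x) = fun u => -∫ x in t..u, b x := by
      ext u; exact intervalIntegral.integral_symm _ _
    rw [this]
    exact (intervalIntegral.continuous_primitive hi t).neg
  have hI : IntervalIntegrable (fun u => b u * ((∫ x in u..t, b x) ^ n / n.factorial))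
      volume s t := (hi s t).mul_continuousOn (by fun_prop)
  rw [← integral_mul_pow_primitive hb, intervalIntegral.integral_of_le hst,
    ofReal_integral_eq_lintegral_ofReal hI.1, setLIntegral_congr Ioo_ae_eq_Ioc]
  · exact lintegral_congr fun u => (ENNReal.ofReal_mul (hb0 u)).symm
  · filter_upwards [ae_restrict_mem measurableSet_Ioc] with u hu
    have : 0 ≤ ∫ x in u..t, b x := intervalIntegral.integral_nonneg hu.2 fun x _ => hb0 x
    have := hb0 u
    simp only [Pi.zero_apply]
    positivity

/-! ### Points with marks -/

section Points

variable {E : Type*}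

/-- The points with marks whose waiting times and marks are given by `ξ`, started at time `s`. -/
def points (s : ℝ) (ξ : ℕ → ℝ × E) (n : ℕ) : ℝ × E :=
  (s + ∑ k ∈ Finset.range (n + 1), (ξ k).1, (ξ n).2)

theorem points_consSeq_zero (s : ℝ) (a : ℝ × E) (ξ : ℕ → ℝ × E) :
    points s (consSeq a ξ) 0 = (s + a.1, a.2) := by
  simp [points, consSeq]

theorem points_consSeq_succ (s : ℝ) (a : ℝ × E) (ξ : ℕ → ℝ × E) (n : ℕ) :
    points s (consSeq a ξ) (n + 1) = points (s + a.1) ξ n := by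
  simp only [points]
  rw [Finset.sum_range_succ' _ (n + 1)]
  congr 1
  simp only [consSeq]
  ring

theorem consSeq_head_tail {X : Type*} (ξ : ℕ → X) : consSeq (ξ 0) (fun k => ξ (k + 1)) = ξ := by
  funext k; cases k <;> rfl

theorem points_tail (s : ℝ) (ξ : ℕ → ℝ × E) (i : ℕ) :
    points (points s ξ 0).1 (fun k => ξ (k + 1)) i = points s ξ (i + 1) := by
  have h := points_consSeq_succ s (ξ 0) (fun k => ξ (k + 1)) i
  rw [consSeq_head_tail] at h
  rw [h]
  simp [points]

variable [MeasurableSpace E]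

theorem measurable_points (n : ℕ) :
    Measurable fun y : ℝ × (ℕ → ℝ × E) => points y.1 y.2 n := by
  unfold points; fun_prop

@[fun_prop]
theorem measurable_points' (s : ℝ) (n : ℕ) :
    Measurable fun ξ : ℕ → ℝ × E => points s ξ n := by
  unfold points; fun_prop

variable (P : Measure E) [IsProbabilityMeasure P]

/-- The law of the waiting times and the marks. -/
def waitLaw : Measure (ℕ → ℝ × E) := Measure.infinitePi fun _ : ℕ => (expMeasure 1).prod P

instance : IsProbabilityMeasure (waitLaw P) := by unfold waitLaw; infer_instance

/-- The Markov property at the first point: its label is `s` plus an exponential time, its mark is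
independent of it, and the later waiting times are a fresh copy of the whole sequence. -/
theorem lintegral_waitLaw (s : ℝ) {F : ℝ × E → (ℕ → ℝ × E) → ℝ≥0∞}
    (hF : Measurable (Function.uncurry F)) :
    ∫⁻ ξ, F (points s ξ 0) (fun k => ξ (k + 1)) ∂waitLaw P =
      ∫⁻ t in Ioi s, ENNReal.ofReal (Real.exp (-(t - s))) *
        ∫⁻ e, ∫⁻ ξ, F (t, e) ξ ∂waitLaw P ∂P := by
  have h1 : Measurable fun x : ℝ × E => ∫⁻ ξ, F x ξ ∂waitLaw P :=
    Measurable.lintegral_prod_right hF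
  have hsh : Measurable fun (ξ : ℕ → ℝ × E) (k : ℕ) => ξ (k + 1) :=
    measurable_pi_lambda _ fun k => measurable_pi_apply _
  rw [waitLaw, lintegral_infinitePi_consSeq]
  · simp_rw [points_consSeq_zero, consSeq]
    rw [← waitLaw, lintegral_prod _ (by fun_prop)]
    refine lintegral_expMeasure_one_add s (φ := fun t => ∫⁻ e, ∫⁻ ξ, F (t, e) ξ ∂waitLaw P ∂P) ?_
    exact h1.lintegral_prod_right'
  · exact hF.comp ((measurable_points' s 0).prodMk hsh)

open Classical in
/-- The first `n` points are in `B`; the law of the next point and of the future. -/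
theorem lintegral_forall_lt_mem {B : Set (ℝ × E)} (hB : MeasurableSet B)
    (hb : Monotone fun u => P.real {e | (u, e) ∈ B})
    {Φ : ℝ × E → (ℕ → ℝ × E) → ℝ≥0∞} (hΦ : Measurable (Function.uncurry Φ)) (n : ℕ) (s : ℝ) :
    ∫⁻ ξ, (if ∀ i < n, points s ξ i ∈ B then
        Φ (points s ξ n) fun k => ξ (k + (n + 1)) else 0) ∂waitLaw P =
      ∫⁻ t in Ioi s, ENNReal.ofReal (Real.exp (-(t - s))) *
        (ENNReal.ofReal ((∫ u in s..t, P.real {e | (u, e) ∈ B}) ^ n / n.factorial) *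
          ∫⁻ e, ∫⁻ ξ, Φ (t, e) ξ ∂waitLaw P ∂P) := by
  have hb0 : ∀ u, 0 ≤ P.real {e | (u, e) ∈ B} := fun u => measureReal_nonneg
  have hbm : ∀ u, MeasurableSet {e | (u, e) ∈ B} := fun u => measurable_prodMk_left hB
  have hΨ : Measurable fun t => ∫⁻ e, ∫⁻ ξ, Φ (t, e) ξ ∂waitLaw P ∂P :=
    (Measurable.lintegral_prod_right hΦ).lintegral_prod_right'
  have hi : ∀ u v, IntervalIntegrable (fun u => P.real {e | (u, e) ∈ B}) volume u v :=
    fun u v => hb.intervalIntegrable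
  have hc : Measurable fun y : ℝ × ℝ => ∫ u in y.1..y.2, P.real {e | (u, e) ∈ B} := by
    have : ∀ y : ℝ × ℝ, ∫ u in y.1..y.2, P.real {e | (u, e) ∈ B} =
        (∫ u in 0..y.2, P.real {e | (u, e) ∈ B}) - ∫ u in 0..y.1, P.real {e | (u, e) ∈ B} :=
      fun y => (intervalIntegral.integral_interval_sub_left (hi _ _) (hi _ _)).symm
    simp_rw [this]
    have := (intervalIntegral.continuous_primitive hi 0).measurable
    fun_prop
  induction n generalizing s with
  | zero =>
    simp only [Nat.not_lt_zero, false_imp_iff, implies_true, if_true, pow_zero,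
      Nat.factorial_zero, Nat.cast_one, div_one, ENNReal.ofReal_one, one_mul, zero_add]
    exact lintegral_waitLaw P s hΦ
  | succ n ih =>
    have hsh : Measurable fun (ξ : ℕ → ℝ × E) (k : ℕ) => ξ (k + (n + 1)) :=
      measurable_pi_lambda _ fun k => measurable_pi_apply _
    -- Once the first point `x` is known to lie in `B`, what remains is the case `n` restarted at
    -- time `x.1`.
    let G : ℝ × E → (ℕ → ℝ × E) → ℝ≥0∞ := fun x ξ =>
      if x ∈ B ∧ ∀ i < n, points x.1 ξ i ∈ B then
        Φ (points x.1 ξ n) fun k => ξ (k + (n + 1)) else 0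
    have hG : Measurable (Function.uncurry G) := by
      have h0 : ∀ i, Measurable fun y : (ℝ × E) × (ℕ → ℝ × E) => points y.1.1 y.2 i := fun i =>
        (measurable_points i).comp (f := fun y : (ℝ × E) × (ℕ → ℝ × E) => (y.1.1, y.2))
          (by fun_prop)
      refine Measurable.ite ?_ (hΦ.comp (Measurable.prodMk (h0 n) (hsh.comp measurable_snd)))
        measurable_const
      refine (measurable_fst hB).inter ?_
      have : {y : (ℝ × E) × (ℕ → ℝ × E) | ∀ i < n, points y.1.1 y.2 i ∈ B} =
          ⋂ i, ⋂ _ : i < n, {y | points y.1.1 y.2 i ∈ B} := by ext; simp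
      have hms : MeasurableSet {y : (ℝ × E) × (ℕ → ℝ × E) | ∀ i < n, points y.1.1 y.2 i ∈ B} := by
        rw [this]
        exact MeasurableSet.iInter fun i => MeasurableSet.iInter fun _ => h0 i hB
      exact hms
    have key := lintegral_waitLaw P s hG
    have hL : ∀ ξ : ℕ → ℝ × E, G (points s ξ 0) (fun k => ξ (k + 1)) =
        if ∀ i < n + 1, points s ξ i ∈ B then
          Φ (points s ξ (n + 1)) fun k => ξ (k + (n + 1 + 1)) else 0 := by
      intro ξ
      simp only [G, points_tail, Nat.forall_lt_succ_left, add_assoc]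
    simp_rw [hL] at key
    rw [key]
    have h3 : ∀ t, ∫⁻ e, ∫⁻ ξ, G (t, e) ξ ∂waitLaw P ∂P =
        ENNReal.ofReal (P.real {e | (t, e) ∈ B}) *
          ∫⁻ u in Ioi t, ENNReal.ofReal (Real.exp (-(u - t))) *
        (ENNReal.ofReal ((∫ x in t..u, P.real {e | (x, e) ∈ B}) ^ n / n.factorial) *
          ∫⁻ e, ∫⁻ ξ, Φ (u, e) ξ ∂waitLaw P ∂P) := by
      intro t
      have : ∀ e, ∫⁻ ξ, G (t, e) ξ ∂waitLaw P = {e | (t, e) ∈ B}.indicator (fun _ =>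
          ∫⁻ u in Ioi t, ENNReal.ofReal (Real.exp (-(u - t))) *
        (ENNReal.ofReal ((∫ x in t..u, P.real {e | (x, e) ∈ B}) ^ n / n.factorial) *
          ∫⁻ e, ∫⁻ ξ, Φ (u, e) ξ ∂waitLaw P ∂P)) e := by
        intro e
        by_cases he : (t, e) ∈ B
        · rw [indicator_of_mem (by exact he)]
          simp only [G, he, true_and]
          exact ih t
        · rw [indicator_of_notMem (by exact he)]
          simp only [G, he, false_and, if_false, lintegral_zero]
      simp_rw [this]
      rw [lintegral_indicator_const (hbm t), ofReal_measureReal, mul_comm]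
    simp_rw [h3]
    set b : ℝ → ℝ := fun u => P.real {e | (u, e) ∈ B} with hbdef
    set Ψ : ℝ → ℝ≥0∞ := fun t => ∫⁻ e, ∫⁻ ξ, Φ (t, e) ξ ∂waitLaw P ∂P with hΨdef
    have hbm' : Measurable b := hb.measurable
    -- The two exponentials multiply to `exp (-(u - s))`, which is free of `t`; after Tonelli the
    -- integral over `t` is the one in `lintegral_mul_pow_primitive`.
    have hswap : ∫⁻ t in Ioi s, ENNReal.ofReal (Real.exp (-(t - s))) *
        (ENNReal.ofReal (b t) * ∫⁻ u in Ioi t, ENNReal.ofReal (Real.exp (-(u - t))) *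
          (ENNReal.ofReal ((∫ x in t..u, b x) ^ n / n.factorial) * Ψ u)) =
        ∫⁻ t in Ioi s, ∫⁻ u in Ioi s, (if t < u then
          ENNReal.ofReal (b t) * ENNReal.ofReal ((∫ x in t..u, b x) ^ n / n.factorial) *
            (ENNReal.ofReal (Real.exp (-(u - s))) * Ψ u) else 0) := by
      refine setLIntegral_congr_fun measurableSet_Ioi fun t ht => ?_
      have hst : Ioi t ⊆ Ioi s := Ioi_subset_Ioi (le_of_lt ht)
      rw [← mul_assoc, ← lintegral_const_mul _ (by fun_prop), ← lintegral_indicator measurableSet_Ioi,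
        ← lintegral_indicator measurableSet_Ioi]
      refine lintegral_congr fun u => ?_
      by_cases hu : t < u
      · rw [indicator_of_mem (by exact hu), indicator_of_mem (hst hu), if_pos hu]
        have : Real.exp (-(u - s)) = Real.exp (-(t - s)) * Real.exp (-(u - t)) := by
          rw [← Real.exp_add]; congr 1; ring
        rw [this, ENNReal.ofReal_mul (Real.exp_nonneg _)]
        ring
      · rw [indicator_of_notMem (by exact hu)]
        simp [indicator, hu]
    rw [hswap, lintegral_lintegral_swap]
    · refine setLIntegral_congr_fun measurableSet_Ioi fun u hu => ?_
      have h4 : ∀ t, (if t < u then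
          ENNReal.ofReal (b t) * ENNReal.ofReal ((∫ x in t..u, b x) ^ n / n.factorial) *
            (ENNReal.ofReal (Real.exp (-(u - s))) * Ψ u) else 0) = (Iio u).indicator (fun t =>
          ENNReal.ofReal (b t) * ENNReal.ofReal ((∫ x in t..u, b x) ^ n / n.factorial) *
            (ENNReal.ofReal (Real.exp (-(u - s))) * Ψ u)) t := fun t => by
        simp [indicator]
      simp_rw [h4]
      rw [lintegral_indicator measurableSet_Iio, Measure.restrict_restrict measurableSet_Iio,
        lintegral_mul_const _ (by fun_prop), inter_comm, Ioi_inter_Iio,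
        lintegral_mul_pow_primitive hb hb0 n (le_of_lt hu)]
      ring
    · refine (Measurable.ite (measurableSet_lt measurable_fst measurable_snd) ?_
        measurable_const).aemeasurable
      fun_prop

end Points

/-! ### The `k`-th natural number with a given property -/

open Classical in
/-- At least `k + 1` natural numbers satisfy `p`. -/
def HasNth (p : ℕ → Prop) (k : ℕ) : Prop := ∃ N, p N ∧ Nat.count p N = k

section HasNth

variable {p : ℕ → Prop} {k n : ℕ}

theorem hasNth_iff : HasNth p k ↔ ∀ hf : (Set.ofPred p).Finite, k < hf.toFinset.card := by
  classical
  constructor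
  · rintro ⟨N, hN, hk⟩
    obtain ⟨n, hn, rfl⟩ := Nat.exists_lt_card_nth_eq hN
    have : n = k := by
      rw [← hk]; convert (Nat.count_nth hn).symm
    exact this ▸ hn
  · intro h
    exact ⟨Nat.nth p k, Nat.nth_mem k h, by convert Nat.count_nth h⟩

theorem hasNth_iff_encard : HasNth p k ↔ (k : ℕ∞) < {j | p j}.encard := by
  rw [hasNth_iff]
  by_cases h : {j | p j}.Finite
  · rw [h.encard_eq_coe_toFinset_card, Nat.cast_lt]
    exact ⟨fun h' => h' h, fun h' _ => h'⟩
  · rw [Set.encard_eq_top_iff.2 h]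
    exact ⟨fun _ => ENat.natCast_lt_top k, fun _ h' => absurd h' h⟩

theorem HasNth.mono (h : HasNth p n) (hk : k ≤ n) : HasNth p k :=
  hasNth_iff.2 fun hf => hk.trans_lt (hasNth_iff.1 h hf)

theorem HasNth.nth_mem (h : HasNth p k) : p (Nat.nth p k) := Nat.nth_mem k (hasNth_iff.1 h)

open Classical in
theorem HasNth.count_nth (h : HasNth p k) : Nat.count p (Nat.nth p k) = k := by
  convert Nat.count_nth (hasNth_iff.1 h)

theorem nth_eq_zero_of_not_hasNth (h : ¬HasNth p k) : Nat.nth p k = 0 := by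
  rw [hasNth_iff] at h
  push Not at h
  obtain ⟨hf, h⟩ := h
  exact Nat.nth_of_card_le hf h

open Classical in
-- `Nat.nth` has the default value `0` when there are too few elements. The second alternative
-- records this, so that the fibres of `Nat.nth` can be described exactly when proving
-- measurability.
theorem nth_eq_iff {m : ℕ} :
    Nat.nth p k = m ↔ (p m ∧ Nat.count p m = k) ∨ (m = 0 ∧ ¬HasNth p k) := by
  constructor
  · rintro rfl
    by_cases h : HasNth p k
    · exact Or.inl ⟨h.nth_mem, h.count_nth⟩
    · exact Or.inr ⟨nth_eq_zero_of_not_hasNth h, h⟩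
  · rintro (⟨h1, rfl⟩ | ⟨rfl, h⟩)
    · convert Nat.nth_count h1
    · exact nth_eq_zero_of_not_hasNth h

theorem nth_of_forall_lt_not (h : ∀ i < n, ¬p i) (hn : p n) : Nat.nth p 0 = n := by
  classical
  refine nth_eq_iff.2 (Or.inl ⟨hn, ?_⟩)
  rw [Nat.count_eq_card_filter_range, Finset.card_eq_zero, Finset.filter_eq_empty_iff]
  exact fun i hi => h i (Finset.mem_range.1 hi)

open Classical in
theorem count_add_of_forall_lt_not (h : ∀ i < n, ¬p i) (hn : p n) (m : ℕ) :
    Nat.count p (m + (n + 1)) = Nat.count (fun j => p (j + (n + 1))) m + 1 := by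
  have h0 : Nat.count p n = 0 := by
    rw [Nat.count_eq_card_filter_range, Finset.card_eq_zero, Finset.filter_eq_empty_iff]
    exact fun i hi => h i (Finset.mem_range.1 hi)
  have h1 : Nat.count p (n + 1) = 1 := by rw [Nat.count_succ, h0, if_pos hn]
  rw [add_comm m, Nat.count_add, h1, add_comm]
  simp_rw [add_comm (n + 1)]

theorem hasNth_succ_iff (h : ∀ i < n, ¬p i) (hn : p n) :
    HasNth p (k + 1) ↔ HasNth (fun j => p (j + (n + 1))) k := by
  classical
  constructor
  · rintro ⟨N, hN, hk⟩
    have hlt : n < N := by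
      by_contra hle
      have : Nat.count p N = 0 := by
        rw [Nat.count_eq_card_filter_range, Finset.card_eq_zero, Finset.filter_eq_empty_iff]
        exact fun i hi => h i ((Finset.mem_range.1 hi).trans_le (not_lt.1 hle))
      omega
    obtain ⟨m, rfl⟩ : ∃ m, N = m + (n + 1) := ⟨N - (n + 1), by omega⟩
    refine ⟨m, hN, ?_⟩
    rw [count_add_of_forall_lt_not h hn] at hk
    omega
  · rintro ⟨m, hm, hk⟩
    exact ⟨m + (n + 1), hm, by rw [count_add_of_forall_lt_not h hn, hk]⟩

theorem nth_succ_of_forall_lt_not (h : ∀ i < n, ¬p i) (hn : p n)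
    (hk : HasNth (fun j => p (j + (n + 1))) k) :
    Nat.nth p (k + 1) = Nat.nth (fun j => p (j + (n + 1))) k + (n + 1) := by
  classical
  refine nth_eq_iff.2 (Or.inl ⟨hk.nth_mem, ?_⟩)
  rw [count_add_of_forall_lt_not h hn, hk.count_nth]

theorem HasNth.exists_first (h : HasNth p k) : ∃ n, (∀ i < n, ¬p i) ∧ p n := by
  classical
  obtain ⟨N, hN, -⟩ := h
  exact ⟨Nat.find ⟨N, hN⟩, fun i hi => Nat.find_min _ hi, Nat.find_spec (⟨N, hN⟩ : ∃ n, p n)⟩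

theorem count_and_eq {r : ℕ → Prop} (hr : ∀ i j, i ≤ j → r j → r i) {N : ℕ} (hN : r N)
    {_ : DecidablePred p} {_ : DecidablePred fun j => p j ∧ r j} :
    Nat.count (fun j => p j ∧ r j) N = Nat.count p N := by
  rw [Nat.count_eq_card_filter_range, Nat.count_eq_card_filter_range]
  congr 1
  refine Finset.filter_congr fun i hi => ?_
  exact and_iff_left (hr i N (Finset.mem_range.1 hi).le hN)

/-- The elements of an initial segment. -/
theorem hasNth_and_iff {r : ℕ → Prop} (hr : ∀ i j, i ≤ j → r j → r i) :
    HasNth (fun j => p j ∧ r j) k ↔ HasNth p k ∧ r (Nat.nth p k) := by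
  classical
  constructor
  · rintro ⟨N, ⟨hN, hrN⟩, hk⟩
    rw [count_and_eq hr hrN] at hk
    have : Nat.nth p k = N := nth_eq_iff.2 (Or.inl ⟨hN, hk⟩)
    exact ⟨⟨N, hN, hk⟩, this ▸ hrN⟩
  · rintro ⟨h1, h2⟩
    exact ⟨_, ⟨h1.nth_mem, h2⟩, by rw [count_and_eq hr h2, h1.count_nth]⟩

theorem nth_and_eq {r : ℕ → Prop} (hr : ∀ i j, i ≤ j → r j → r i)
    (h : HasNth (fun j => p j ∧ r j) k) : Nat.nth (fun j => p j ∧ r j) k = Nat.nth p k := by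
  classical
  obtain ⟨N, ⟨hN, hrN⟩, hk⟩ := h
  have hk' : Nat.count p N = k := by rw [← hk, count_and_eq hr hrN]
  rw [nth_eq_iff.2 (Or.inl ⟨⟨hN, hrN⟩, by rw [← hk]⟩), nth_eq_iff.2 (Or.inl ⟨hN, hk'⟩)]

open Classical in
theorem measurable_count {Y : Type*} [MeasurableSpace Y] {p : Y → ℕ → Prop}
    (hp : ∀ j, MeasurableSet {y | p y j}) (n : ℕ) : Measurable fun y => Nat.count (p y) n := by
  induction n with
  | zero => simp only [Nat.count_zero]; exact measurable_const
  | succ n ih =>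
    simp only [Nat.count_succ]
    exact ih.add (Measurable.ite (hp n) measurable_const measurable_const)

theorem measurableSet_hasNth {Y : Type*} [MeasurableSpace Y] {p : Y → ℕ → Prop}
    (hp : ∀ j, MeasurableSet {y | p y j}) (k : ℕ) : MeasurableSet {y | HasNth (p y) k} := by
  classical
  have : {y | HasNth (p y) k} = ⋃ N, {y | p y N} ∩ {y | Nat.count (p y) N = k} := by
    ext y; simp [HasNth]
  rw [this]
  exact MeasurableSet.iUnion fun N => (hp N).inter (measurable_count hp N (measurableSet_singleton k))

theorem measurable_nth {Y : Type*} [MeasurableSpace Y] {p : Y → ℕ → Prop}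
    (hp : ∀ j, MeasurableSet {y | p y j}) (k : ℕ) : Measurable fun y => Nat.nth (p y) k := by
  classical
  refine measurable_to_countable' fun m => ?_
  have : (fun y => Nat.nth (p y) k) ⁻¹' {m} = ({y | p y m} ∩ {y | Nat.count (p y) m = k}) ∪
      ({_y | m = 0} ∩ {y | HasNth (p y) k}ᶜ) := by
    ext y
    simp only [mem_preimage, mem_singleton_iff, nth_eq_iff]
    rfl
  rw [this]
  exact ((hp m).inter (measurable_count hp m (measurableSet_singleton k))).union
    ((MeasurableSet.const _).inter (measurableSet_hasNth hp k).compl)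

theorem measurable_comp_nth {Y X : Type*} [MeasurableSpace Y] [MeasurableSpace X]
    {p : Y → ℕ → Prop} (hp : ∀ j, MeasurableSet {y | p y j}) (k : ℕ) {g : Y → ℕ → X}
    (hg : ∀ j, Measurable fun y => g y j) : Measurable fun y => g y (Nat.nth (p y) k) :=
  (measurable_from_prod_countable_left (f := fun z : Y × ℕ => g z.1 z.2) hg).comp
    (measurable_id.prodMk (measurable_nth hp k))

end HasNth

/-! ### The first accepted points -/

section Accepted

variable {E : Type*} [MeasurableSpace E] (P : Measure E)

/-- The rate at which points in `A` occur at time `u`. -/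
def rate (A : Set (ℝ × E)) (u : ℝ) : ℝ := P.real {e | (u, e) ∈ A}

/-- The intensity of the points in `A`. -/
def intensity (A : Set (ℝ × E)) : Measure (ℝ × E) := (volume.prod P).restrict A

instance (A : Set (ℝ × E)) [SigmaFinite P] : SigmaFinite (intensity P A) := by unfold intensity; infer_instance

variable {P} {A : Set (ℝ × E)}

theorem rate_nonneg (u : ℝ) : 0 ≤ rate P A u := measureReal_nonneg

theorem continuous_integral_rate (hr : Antitone (rate P A)) (s : ℝ) :
    Continuous fun t => ∫ u in s..t, rate P A u :=
  intervalIntegral.continuous_primitive (fun _ _ => hr.intervalIntegrable) s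

theorem lintegral_pi_fin_succ {X : Type*} [MeasurableSpace X] (μ : Measure X) [SigmaFinite μ]
    {n : ℕ} {G : (Fin (n + 1) → X) → ℝ≥0∞} (hG : Measurable G) :
    ∫⁻ x, G x ∂Measure.pi (fun _ : Fin (n + 1) => μ) =
      ∫⁻ a, ∫⁻ y, G (Fin.cons a y) ∂Measure.pi (fun _ : Fin n => μ) ∂μ := by
  have h := (measurePreserving_piFinSuccAbove (fun _ : Fin (n + 1) => μ) 0).symm
  rw [← h.lintegral_comp_emb (MeasurableEquiv.measurableEmbedding _)]
  refine (lintegral_prod _ (hG.comp (MeasurableEquiv.measurable _)).aemeasurable).trans ?_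
  simp [MeasurableEquiv.piFinSuccAbove, Fin.insertNthEquiv]

theorem lintegral_pi_fin_succ_last {X : Type*} [MeasurableSpace X] (μ : Measure X) [SigmaFinite μ]
    {n : ℕ} {G : (Fin (n + 1) → X) → ℝ≥0∞} (hG : Measurable G) :
    ∫⁻ x, G x ∂Measure.pi (fun _ : Fin (n + 1) => μ) =
      ∫⁻ a, ∫⁻ y, G (Fin.snoc y a) ∂Measure.pi (fun _ : Fin n => μ) ∂μ := by
  have h := (measurePreserving_piFinSuccAbove (fun _ : Fin (n + 1) => μ) (Fin.last n)).symm
  rw [← h.lintegral_comp_emb (MeasurableEquiv.measurableEmbedding _)]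
  refine (lintegral_prod _ (hG.comp (MeasurableEquiv.measurable _)).aemeasurable).trans ?_
  simp [MeasurableEquiv.piFinSuccAbove, Fin.insertNthEquiv]

theorem measurableSet_strictMono {X : Type*} [MeasurableSpace X] {ℓ : X → ℝ} (hℓ : Measurable ℓ)
    (n : ℕ) : MeasurableSet {x : Fin n → X | StrictMono fun k => ℓ (x k)} := by
  have : {x : Fin n → X | StrictMono fun k => ℓ (x k)} =
      ⋂ (i : Fin n) (j : Fin n) (_ : i < j), {x | ℓ (x i) < ℓ (x j)} := by
    ext x; simp [StrictMono]
  rw [this]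
  exact MeasurableSet.iInter fun i => MeasurableSet.iInter fun j => MeasurableSet.iInter
    fun _ => measurableSet_lt (by fun_prop) (by fun_prop)

theorem strictMono_fin_cons {E : Type*} {n : ℕ} (a : ℝ × E) (y : Fin (n + 1) → ℝ × E) :
    (StrictMono fun k : Fin (n + 2) => (Fin.cons a y : Fin (n + 2) → ℝ × E) k |>.1) ↔
      a.1 < (y 0).1 ∧ StrictMono fun k => (y k).1 := by
  rw [Fin.strictMono_iff_lt_succ, Fin.strictMono_iff_lt_succ, Fin.forall_fin_succ]
  simp

open Classical in
-- Decomposition according to the index `m` of the first element, of which there is at most one. It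
-- permits summation over the number of rejected points before the first accepted one.
theorem ite_hasNth_eq_tsum (p : ℕ → Prop) (n : ℕ) (c : ℝ≥0∞) :
    (if HasNth p n then c else 0) =
      ∑' m : ℕ, if (∀ i < m, ¬p i) ∧ p m then (if HasNth p n then c else 0) else 0 := by
  by_cases h : HasNth p n
  · obtain ⟨m, hm⟩ := h.exists_first
    rw [tsum_eq_single m, if_pos hm]
    intro m' hm'
    rw [if_neg]
    rintro ⟨h1, h2⟩
    rcases lt_or_gt_of_ne hm' with h3 | h3
    · exact hm.1 m' h3 h2
    · exact h1 m h3 hm.2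
  · simp [h]

theorem points_shift {E : Type*} (s : ℝ) (ξ : ℕ → ℝ × E) (m j : ℕ) :
    points (points s ξ m).1 (fun k => ξ (k + (m + 1))) j = points s ξ (j + (m + 1)) := by
  simp only [points]
  congr 1
  rw [add_assoc, show j + (m + 1) + 1 = (m + 1) + (j + 1) by ring, Finset.sum_range_add _ (m + 1)]
  simp_rw [add_comm (m + 1)]

theorem measurableSet_points_mem (hA : MeasurableSet A) (j : ℕ) :
    MeasurableSet {y : ℝ × (ℕ → ℝ × E) | points y.1 y.2 j ∈ A} := measurable_points j hA

theorem measurable_points_nth (hA : MeasurableSet A) (k : ℕ) :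
    Measurable fun y : ℝ × (ℕ → ℝ × E) =>
      points y.1 y.2 (Nat.nth (fun j => points y.1 y.2 j ∈ A) k) :=
  measurable_comp_nth (p := fun (y : ℝ × (ℕ → ℝ × E)) j => points y.1 y.2 j ∈ A)
    (measurableSet_points_mem hA) k (g := fun y j => points y.1 y.2 j) measurable_points

variable [IsProbabilityMeasure P]

theorem rate_le_one (u : ℝ) : rate P A u ≤ 1 := measureReal_le_one

theorem lintegral_intensity (hA : MeasurableSet A) {F : ℝ × E → ℝ≥0∞} (hF : Measurable F) :
    ∫⁻ x, F x ∂intensity P A = ∫⁻ t, ∫⁻ e, A.indicator F (t, e) ∂P := by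
  rw [intensity, ← lintegral_indicator hA, lintegral_prod _ (hF.indicator hA).aemeasurable]

open Classical in
/-- The law of the first accepted point and of the future after it. -/
theorem tsum_lintegral_first (hA : MeasurableSet A) (hr : Antitone (rate P A))
    {Φ : ℝ × E → (ℕ → ℝ × E) → ℝ≥0∞} (hΦ : Measurable (Function.uncurry Φ)) (s : ℝ) :
    ∑' n : ℕ, ∫⁻ ξ, (if (∀ i < n, points s ξ i ∉ A) ∧ points s ξ n ∈ A then
        Φ (points s ξ n) fun k => ξ (k + (n + 1)) else 0) ∂waitLaw P =
      ∫⁻ x, (if s < x.1 then ENNReal.ofReal (Real.exp (-∫ u in s..x.1, rate P A u)) *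
          ∫⁻ ξ, Φ x ξ ∂waitLaw P else 0) ∂intensity P A := by
  have hcompl : ∀ u, P.real {e | (u, e) ∈ Aᶜ} = 1 - rate P A u := fun u => by
    have : {e | (u, e) ∈ Aᶜ} = {e | (u, e) ∈ A}ᶜ := rfl
    have hm : MeasurableSet {e | (u, e) ∈ A} := measurable_prodMk_left hA
    rw [this, probReal_compl_eq_one_sub hm, rate]
  have hb : Monotone fun u => P.real {e | (u, e) ∈ Aᶜ} := fun u v huv => by
    simp only [hcompl]; linarith [hr huv]
  -- The acceptance of point `n` is moved into the test function, so that `lintegral_forall_lt_mem`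
  -- applies with `B = Aᶜ`.
  let Φ' : ℝ × E → (ℕ → ℝ × E) → ℝ≥0∞ := fun x ξ => if x ∈ A then Φ x ξ else 0
  have hΦ' : Measurable (Function.uncurry Φ') :=
    Measurable.ite (measurable_fst hA) hΦ measurable_const
  have hinner : Measurable fun x : ℝ × E => ∫⁻ ξ, Φ x ξ ∂waitLaw P :=
    Measurable.lintegral_prod_right hΦ
  have hΨm : Measurable fun t => ∫⁻ e, ∫⁻ ξ, Φ' (t, e) ξ ∂waitLaw P ∂P :=
    (Measurable.lintegral_prod_right hΦ').lintegral_prod_right'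
  have hcm := continuous_integral_rate hr s
  have h1 : ∀ n, ∫⁻ ξ, (if (∀ i < n, points s ξ i ∉ A) ∧ points s ξ n ∈ A then
        Φ (points s ξ n) fun k => ξ (k + (n + 1)) else 0) ∂waitLaw P =
      ∫⁻ t in Ioi s, ENNReal.ofReal (Real.exp (-(t - s))) *
        (ENNReal.ofReal (((t - s) - ∫ u in s..t, rate P A u) ^ n / n.factorial) *
          ∫⁻ e, ∫⁻ ξ, Φ' (t, e) ξ ∂waitLaw P ∂P) := by
    intro n
    have := lintegral_forall_lt_mem P hA.compl hb hΦ' n s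
    simp only [mem_compl_iff] at this
    convert this using 2
    · ext ξ
      simp only [Φ', ← ite_and]
    · ext t
      congr 4
      have h2 : ∀ u, P.real {e | (u, e) ∉ A} = 1 - rate P A u := hcompl
      simp_rw [h2]
      rw [intervalIntegral.integral_sub (by simp) hr.intervalIntegrable]
      simp
  simp_rw [h1]
  rw [← lintegral_tsum fun n => Measurable.aemeasurable (by fun_prop)]
  -- Thinning: the sum over the number `n` of rejected points is an exponential series, which turns
  -- `exp (-(t - s))` into the exponential of minus the integrated rate of `A`.
  have h2 : ∀ t ∈ Ioi s, ∑' n : ℕ, ENNReal.ofReal (Real.exp (-(t - s))) *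
        (ENNReal.ofReal (((t - s) - ∫ u in s..t, rate P A u) ^ n / n.factorial) *
          ∫⁻ e, ∫⁻ ξ, Φ' (t, e) ξ ∂waitLaw P ∂P) =
      ENNReal.ofReal (Real.exp (-∫ u in s..t, rate P A u)) *
          ∫⁻ e, ∫⁻ ξ, Φ' (t, e) ξ ∂waitLaw P ∂P := by
    intro t ht
    have hpos : 0 ≤ (t - s) - ∫ u in s..t, rate P A u := by
      have : ∫ u in s..t, rate P A u ≤ ∫ u in s..t, (1 : ℝ) :=
        intervalIntegral.integral_mono (le_of_lt ht) hr.intervalIntegrable (by simp)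
          fun u => rate_le_one u
      simp at this
      linarith
    rw [ENNReal.tsum_mul_left, ENNReal.tsum_mul_right, ← mul_assoc,
      ← ENNReal.ofReal_tsum_of_nonneg (fun n => by positivity)
        (Real.summable_pow_div_factorial _), ← ENNReal.ofReal_mul (Real.exp_nonneg _)]
    have h3 : ∑' n : ℕ, ((t - s) - ∫ u in s..t, rate P A u) ^ n / n.factorial =
        Real.exp ((t - s) - ∫ u in s..t, rate P A u) := by
      rw [Real.exp_eq_exp_ℝ, NormedSpace.exp_eq_tsum_div]
    rw [h3, ← Real.exp_add]
    congr 3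
    ring
  rw [setLIntegral_congr_fun measurableSet_Ioi h2, lintegral_intensity hA]
  · rw [← lintegral_indicator measurableSet_Ioi]
    refine lintegral_congr fun t => ?_
    by_cases ht : s < t
    · rw [indicator_of_mem (by exact ht), ← lintegral_const_mul]
      · refine lintegral_congr fun e => ?_
        by_cases he : (t, e) ∈ A
        · simp [indicator, he, ht, Φ']
        · simp [indicator, he, Φ']
      · exact (Measurable.lintegral_prod_right hΦ').comp measurable_prodMk_left
    · rw [indicator_of_notMem (by exact ht)]
      simp [indicator, ht]
  · refine Measurable.ite (measurableSet_lt measurable_const measurable_fst) ?_ measurable_const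
    fun_prop

open Classical in
/-- The law of the first `n + 1` accepted points. -/
theorem lintegral_first_points (hA : MeasurableSet A) (hr : Antitone (rate P A)) (n : ℕ) (s : ℝ)
    {F : (Fin (n + 1) → ℝ × E) → ℝ≥0∞} (hF : Measurable F) :
    ∫⁻ ξ, (if HasNth (fun j => points s ξ j ∈ A) n then
        F (fun k => points s ξ (Nat.nth (fun j => points s ξ j ∈ A) k)) else 0) ∂waitLaw P =
      ∫⁻ x, (if s < (x 0).1 ∧ StrictMono fun k => (x k).1 then
          ENNReal.ofReal (Real.exp (-∫ u in s..(x (Fin.last n)).1, rate P A u)) * F x else 0)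
        ∂Measure.pi fun _ : Fin (n + 1) => intensity P A := by
  have hmeas : ∀ n s (F : (Fin (n + 1) → ℝ × E) → ℝ≥0∞), Measurable F →
      Measurable fun x : Fin (n + 1) → ℝ × E => (if s < (x 0).1 ∧ StrictMono fun k => (x k).1 then
          ENNReal.ofReal (Real.exp (-∫ u in s..(x (Fin.last n)).1, rate P A u)) * F x else 0) := by
    intro n s F hF
    have hc := continuous_integral_rate hr s
    refine Measurable.ite ?_ (by fun_prop) measurable_const
    have h1 : MeasurableSet {x : Fin (n + 1) → ℝ × E | s < (x 0).1} :=
      measurableSet_lt measurable_const (by fun_prop)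
    exact h1.inter (measurableSet_strictMono measurable_fst _)
  have hLm : ∀ n (F : (Fin (n + 1) → ℝ × E) → ℝ≥0∞), Measurable F → ∀ s,
      Measurable fun ξ : ℕ → ℝ × E => (if HasNth (fun j => points s ξ j ∈ A) n then
        F (fun k => points s ξ (Nat.nth (fun j => points s ξ j ∈ A) k)) else 0) := by
    intro n F hF s
    refine Measurable.ite (measurableSet_hasNth (fun j => measurable_points' s j hA) n)
      (hF.comp (measurable_pi_lambda _ fun k => ?_)) measurable_const
    exact (measurable_points_nth hA k).comp (measurable_const.prodMk measurable_id)
  have hfirst : ∀ s m, MeasurableSet {ξ : ℕ → ℝ × E | (∀ i < m, points s ξ i ∉ A) ∧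
      points s ξ m ∈ A} := by
    intro s m
    have : {ξ : ℕ → ℝ × E | ∀ i < m, points s ξ i ∉ A} =
        ⋂ i, ⋂ _ : i < m, {ξ | points s ξ i ∈ A}ᶜ := by ext; simp
    have h2 : MeasurableSet {ξ : ℕ → ℝ × E | ∀ i < m, points s ξ i ∉ A} := by
      rw [this]
      exact MeasurableSet.iInter fun i => MeasurableSet.iInter fun _ =>
        (measurable_points' s i hA).compl
    exact h2.inter (measurable_points' s m hA)
  induction n generalizing s with
  | zero =>
    have hΦ : Measurable (Function.uncurry fun (x : ℝ × E) (_ : ℕ → ℝ × E) =>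
        F fun _ => x) := hF.comp (measurable_pi_lambda _ fun _ => measurable_fst)
    have hΦ' : Measurable fun x : ℝ × E => F fun _ => x :=
      hF.comp (measurable_pi_lambda _ fun _ => measurable_id)
    have key := tsum_lintegral_first hA hr hΦ s
    rw [lintegral_pi_fin_succ _ (hmeas 0 s F hF)]
    rw [lintegral_congr fun ξ => ite_hasNth_eq_tsum _ _ _,
      lintegral_tsum fun m => ((hLm 0 F hF s).ite (hfirst s m) measurable_const).aemeasurable]
    simp only [lintegral_const, measure_univ, mul_one] at key
    convert key using 1
    · refine tsum_congr fun m => lintegral_congr fun ξ => ?_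
      by_cases h : (∀ i < m, points s ξ i ∉ A) ∧ points s ξ m ∈ A
      · have h0 : HasNth (fun j => points s ξ j ∈ A) 0 := by
          refine ⟨m, h.2, ?_⟩
          rw [Nat.count_eq_card_filter_range, Finset.card_eq_zero, Finset.filter_eq_empty_iff]
          exact fun i hi => h.1 i (Finset.mem_range.1 hi)
        rw [if_pos h, if_pos h, if_pos h0]
        congr 1
        funext k
        rw [Fin.val_eq_zero k, nth_of_forall_lt_not h.1 h.2]
      · rw [if_neg h, if_neg h]
    · refine lintegral_congr fun x => ?_
      rw [Measure.pi_of_empty (fun _ : Fin 0 => intensity P A) default, lintegral_dirac]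
      by_cases h : s < x.1
      · rw [if_pos h, if_pos ⟨h, @Subsingleton.strictMono (Fin 1) _ _ _ _ _⟩]
        congr 2
        funext k
        rw [@Subsingleton.elim (Fin 1) _ k 0]
        rfl
      · rw [if_neg h, if_neg fun h' => h h'.1]
  | succ n ih =>
    -- The accepted points after the first one, `x`, are the first accepted points of the process
    -- restarted at time `x.1`; the exponents of the two stages add up.
    let Φ : ℝ × E → (ℕ → ℝ × E) → ℝ≥0∞ := fun x ξ =>
      if HasNth (fun j => points x.1 ξ j ∈ A) n then F (Fin.cons x fun k : Fin (n + 1) =>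
        points x.1 ξ (Nat.nth (fun j => points x.1 ξ j ∈ A) k)) else 0
    have hcons : Measurable fun y : (ℝ × E) × (Fin (n + 1) → ℝ × E) =>
        (Fin.cons y.1 y.2 : Fin (n + 2) → ℝ × E) := by
      refine measurable_pi_lambda _ fun k => ?_
      refine Fin.cases ?_ (fun k => ?_) k
      · simpa using measurable_fst
      · simp only [Fin.cons_succ]; fun_prop
    have hΦ : Measurable (Function.uncurry Φ) := by
      have hpr : Measurable fun y : (ℝ × E) × (ℕ → ℝ × E) => (y.1.1, y.2) := by fun_prop
      refine Measurable.ite ?_ (hF.comp (hcons.comp (measurable_fst.prodMk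
        (measurable_pi_lambda _ fun k => ?_)))) measurable_const
      · exact hpr (measurableSet_hasNth (p := fun (y : ℝ × (ℕ → ℝ × E)) j =>
          points y.1 y.2 j ∈ A) (measurableSet_points_mem hA) n)
      · exact (measurable_points_nth hA k).comp hpr
    have key := tsum_lintegral_first hA hr hΦ s
    rw [lintegral_pi_fin_succ _ (hmeas (n + 1) s F hF)]
    rw [lintegral_congr fun ξ => ite_hasNth_eq_tsum _ _ _,
      lintegral_tsum fun m => ((hLm (n + 1) F hF s).ite (hfirst s m) measurable_const).aemeasurable]
    convert key using 1
    · refine tsum_congr fun m => lintegral_congr fun ξ => ?_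
      by_cases h : (∀ i < m, points s ξ i ∉ A) ∧ points s ξ m ∈ A
      · rw [if_pos h, if_pos h]
        simp only [Φ, points_shift]
        rw [hasNth_succ_iff (p := fun j => points s ξ j ∈ A) h.1 h.2]
        by_cases h1 : HasNth (fun j => points s ξ (j + (m + 1)) ∈ A) n
        · rw [if_pos h1, if_pos h1]
          congr 1
          funext k
          refine Fin.cases ?_ (fun k => ?_) k
          · simp [nth_of_forall_lt_not (p := fun j => points s ξ j ∈ A) h.1 h.2]
          · rw [Fin.cons_succ, Fin.val_succ, nth_succ_of_forall_lt_not
              (p := fun j => points s ξ j ∈ A) h.1 h.2 (h1.mono (Nat.lt_succ_iff.1 k.2))]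
        · rw [if_neg h1, if_neg h1]
      · rw [if_neg h, if_neg h]
    · refine lintegral_congr fun x => ?_
      simp only [Fin.cons_zero, strictMono_fin_cons]
      by_cases h : s < x.1
      · have h2 : ∫⁻ ξ, Φ x ξ ∂waitLaw P = _ :=
          ih x.1 (F := fun y => F (Fin.cons x y)) (hF.comp (hcons.comp measurable_prodMk_left))
        have h4 := hmeas n x.1 _ (hF.comp (hcons.comp (measurable_prodMk_left (x := x))))
        simp only [Function.comp_def] at h4
        rw [if_pos h, h2, ← lintegral_const_mul _ h4]
        refine lintegral_congr fun y => ?_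
        by_cases h3 : x.1 < (y 0).1 ∧ StrictMono fun k => (y k).1
        · rw [if_pos ⟨h, h3⟩, if_pos h3, ← Fin.succ_last, Fin.cons_succ, ← mul_assoc,
            ← ENNReal.ofReal_mul (Real.exp_nonneg _), ← Real.exp_add]
          congr 3
          rw [← intervalIntegral.integral_add_adjacent_intervals
            (hr.intervalIntegrable (a := s) (b := x.1)) hr.intervalIntegrable]
          ring
        · rw [if_neg h3, if_neg fun h' => h3 h'.2, mul_zero]
      · simp [h]

end Accepted

/-! ### Sorting independent points -/

section Sorting

variable {X : Type*} [MeasurableSpace X] {ρ : Measure X} [SigmaFinite ρ] {ℓ : X → ℝ}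

/-- For a pair of indices, integrate out one coordinate first: given the others, a tie confines it
to a level set of `ℓ`, which is null. -/
theorem ae_injective_pi (hℓ : Measurable ℓ) (h0 : ∀ c, ρ {x | ℓ x = c} = 0) (n : ℕ) :
    ∀ᵐ x ∂Measure.pi (fun _ : Fin n => ρ), Function.Injective fun k => ℓ (x k) := by
  have key : ∀ i j : Fin n, i ≠ j →
      ∀ᵐ x ∂Measure.pi (fun _ : Fin n => ρ), ℓ (x i) ≠ ℓ (x j) := by
    intro i j hij
    obtain ⟨m, rfl⟩ : ∃ m, n = m + 1 := ⟨n - 1, by have := i.2; omega⟩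
    obtain ⟨j', rfl⟩ := Fin.exists_succAbove_eq hij.symm
    have hS : MeasurableSet {z : X × (Fin m → X) | ℓ z.1 = ℓ (z.2 j')} :=
      measurableSet_eq_fun (hℓ.comp measurable_fst)
        (hℓ.comp ((measurable_pi_apply j').comp measurable_snd))
    have h := (measurePreserving_piFinSuccAbove (fun _ : Fin (m + 1) => ρ) i).measure_preimage
      hS.nullMeasurableSet
    rw [Measure.prod_apply_symm hS] at h
    have h2 : ∀ y : Fin m → X, ρ ((fun x => (x, y)) ⁻¹' {z : X × (Fin m → X) | ℓ z.1 = ℓ (z.2 j')})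
        = 0 := fun y => h0 (ℓ (y j'))
    simp only [h2, lintegral_zero] at h
    rw [ae_iff]
    refine measure_mono_null (fun x hx => ?_) h
    have hx' : ℓ (x i) = ℓ (x (i.succAbove j')) := not_not.1 hx
    exact hx'
  have : ∀ᵐ x ∂Measure.pi (fun _ : Fin n => ρ), ∀ i j : Fin n, i ≠ j → ℓ (x i) ≠ ℓ (x j) := by
    simp only [ae_all_iff]
    exact key
  filter_upwards [this] with x hx i j hij
  by_contra hne
  exact hx i j hne hij

theorem sort_eq_iff {n : ℕ} {f : Fin n → ℝ} (hf : Function.Injective f) (σ : Equiv.Perm (Fin n)) :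
    Tuple.sort f = σ ↔ StrictMono fun k => f (σ k) := by
  constructor
  · rintro rfl
    exact (Tuple.monotone_sort f).strictMono_of_injective (hf.comp (Equiv.injective _))
  · intro h
    refine (Tuple.eq_sort_iff.2 ⟨h.monotone, fun i j hij h' => ?_⟩).symm
    exact absurd h' (h hij).ne

theorem measurableSet_sort_eq (hℓ : Measurable ℓ) (n : ℕ) (σ : Equiv.Perm (Fin n)) :
    MeasurableSet {x : Fin n → X | Tuple.sort (fun j => ℓ (x j)) = σ} := by
  have : {x : Fin n → X | Tuple.sort (fun j => ℓ (x j)) = σ} =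
      (⋂ (i : Fin n) (j : Fin n) (_ : i ≤ j), {x | ℓ (x (σ i)) ≤ ℓ (x (σ j))}) ∩
        ⋂ (i : Fin n) (j : Fin n) (_ : i < j),
          ({x | ℓ (x (σ i)) = ℓ (x (σ j))}ᶜ ∪ {_x | σ i < σ j}) := by
    ext x
    have h := Tuple.eq_sort_iff (f := fun j : Fin n => ℓ (x j)) (σ := σ)
    simp only [mem_inter_iff, mem_iInter, mem_union, mem_compl_iff, mem_ofPred_eq,
      ← imp_iff_not_or]
    rw [eq_comm, h]
    rfl
  rw [this]
  exact (MeasurableSet.iInter fun i => MeasurableSet.iInter fun j =>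
    MeasurableSet.iInter fun _ => measurableSet_le (by fun_prop) (by fun_prop)).inter
    (MeasurableSet.iInter fun i => MeasurableSet.iInter fun j => MeasurableSet.iInter fun _ =>
      (measurableSet_eq_fun (by fun_prop) (by fun_prop)).compl.union (MeasurableSet.const _))

theorem measurable_comp_sort (hℓ : Measurable ℓ) (n : ℕ) :
    Measurable fun (x : Fin n → X) (k : Fin n) => x (Tuple.sort (fun j => ℓ (x j)) k) := by
  let _ : MeasurableSpace (Equiv.Perm (Fin n)) := ⊤
  have h1 : Measurable fun x : Fin n → X => Tuple.sort fun j => ℓ (x j) :=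
    measurable_to_countable' fun σ => measurableSet_sort_eq hℓ n σ
  exact (measurable_from_prod_countable_left
    (f := fun (z : (Fin n → X) × Equiv.Perm (Fin n)) k => z.1 (z.2 k))
    fun σ => measurable_pi_lambda _ fun k => measurable_pi_apply (σ k)).comp
      (measurable_id.prodMk h1)

open Classical in
-- Off the null set of ties exactly one permutation puts the labels in increasing order. Each of the
-- `n!` permutations preserves the product measure, so all of them contribute equally.
theorem lintegral_comp_sort (hℓ : Measurable ℓ) (h0 : ∀ c, ρ {x | ℓ x = c} = 0) (n : ℕ)
    {F : (Fin n → X) → ℝ≥0∞} (hF : Measurable F) :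
    ∫⁻ x, F (fun k => x (Tuple.sort (fun j => ℓ (x j)) k)) ∂Measure.pi (fun _ : Fin n => ρ) =
      n.factorial * ∫⁻ x, (if StrictMono fun k => ℓ (x k) then F x else 0)
        ∂Measure.pi (fun _ : Fin n => ρ) := by
  have hG : Measurable fun x : Fin n → X => if StrictMono fun k => ℓ (x k) then F x else 0 := by
    exact Measurable.ite (measurableSet_strictMono hℓ n) hF measurable_const
  have hperm : ∀ σ : Equiv.Perm (Fin n), MeasurePreserving (fun (x : Fin n → X) k => x (σ k))
      (Measure.pi fun _ => ρ) (Measure.pi fun _ => ρ) := by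
    intro σ
    exact measurePreserving_arrowCongr' (fun _ : Fin n => ρ) (fun _ : Fin n => ρ) σ.symm
      (MeasurableEquiv.refl X) fun _ => MeasurePreserving.id _
  have h1 : ∀ᵐ x ∂Measure.pi (fun _ : Fin n => ρ),
      F (fun k => x (Tuple.sort (fun j => ℓ (x j)) k)) =
      ∑ σ : Equiv.Perm (Fin n), (if StrictMono fun k => ℓ (x (σ k)) then F fun k => x (σ k)
        else 0) := by
    filter_upwards [ae_injective_pi hℓ h0 n] with x hx
    rw [Finset.sum_eq_single (Tuple.sort fun j => ℓ (x j))]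
    · rw [if_pos ((sort_eq_iff hx _).1 rfl)]
    · intro σ _ hσ
      rw [if_neg]
      exact fun h => hσ ((sort_eq_iff hx σ).2 h).symm
    · simp
  have h2 : ∀ σ : Equiv.Perm (Fin n), ∫⁻ x, (if StrictMono fun k => ℓ (x (σ k)) then
      F fun k => x (σ k) else 0) ∂Measure.pi (fun _ : Fin n => ρ) =
      ∫⁻ x, (if StrictMono fun k => ℓ (x k) then F x else 0) ∂Measure.pi (fun _ : Fin n => ρ) :=
    fun σ => (hperm σ).lintegral_comp hG
  have h3 : ∀ σ : Equiv.Perm (Fin n), Measurable fun x : Fin n → X =>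
      if StrictMono fun k => ℓ (x (σ k)) then F fun k => x (σ k) else 0 :=
    fun σ => hG.comp (hperm σ).measurable
  rw [lintegral_congr_ae h1, lintegral_finsetSum _ fun σ _ => h3 σ]
  simp_rw [h2]
  simp [Fintype.card_perm]

end Sorting

/-! ### The accepted points before a given accepted point -/

section Accepted

variable {E : Type*} [MeasurableSpace E] {P : Measure E} {A : Set (ℝ × E)}

theorem fin_snoc_strictMono_iff {E : Type*} {n : ℕ} (y : Fin n → ℝ × E) (x : ℝ × E) :
    (0 < ((Fin.snoc y x : Fin (n + 1) → ℝ × E) 0).1 ∧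
      StrictMono fun k : Fin (n + 1) => ((Fin.snoc y x : Fin (n + 1) → ℝ × E) k).1) ↔
    0 < x.1 ∧ (∀ k, 0 < (y k).1 ∧ (y k).1 < x.1) ∧ StrictMono fun k => (y k).1 := by
  have hl : (Fin.snoc y x : Fin (n + 1) → ℝ × E) (Fin.last n) = x := Fin.snoc_last _ _
  have hc : ∀ k : Fin n, (Fin.snoc y x : Fin (n + 1) → ℝ × E) k.castSucc = y k :=
    fun k => Fin.snoc_castSucc _ _ _
  generalize (Fin.snoc y x : Fin (n + 1) → ℝ × E) = z at hl hc ⊢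
  subst hl
  constructor
  · rintro ⟨h0, h⟩
    refine ⟨h0.trans_le (h.monotone (Fin.zero_le _)), fun k => ?_, fun i j hij => ?_⟩
    · rw [← hc]
      exact ⟨h0.trans_le (h.monotone (Fin.zero_le _)), h (Fin.castSucc_lt_last k)⟩
    · simp only [← hc]
      exact h hij
  · rintro ⟨h0, h1, h2⟩
    constructor
    · cases n with
      | zero => exact h0
      | succ n =>
        have := (h1 0).1
        rwa [← hc] at this
    · intro i j
      refine Fin.lastCases (fun h => ?_) (fun j h => ?_) j
      · obtain ⟨i, rfl⟩ := Fin.exists_castSucc_eq.2 h.ne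
        simp only [hc]
        exact (h1 i).2
      · obtain ⟨i, rfl⟩ := Fin.exists_castSucc_eq.2 (h.trans (Fin.castSucc_lt_last j)).ne
        simp only [hc]
        exact h2 h

theorem intensity_fst_eq [SFinite P] (A : Set (ℝ × E)) (c : ℝ) : intensity P A {x | x.1 = c} = 0 := by
  refine measure_mono_null (t := {c} ×ˢ univ) (fun x hx => ⟨hx, trivial⟩) ?_
  refine Measure.absolutelyContinuous_of_le Measure.restrict_le_self ?_
  simp

/-- The points whose label lies in `(0, t)`. -/
def before (E : Type*) (t : ℝ) : Set (ℝ × E) := {y | 0 < y.1 ∧ y.1 < t}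

theorem measurableSet_before (t : ℝ) : MeasurableSet (before E t) :=
  (measurableSet_lt measurable_const measurable_fst).inter
    (measurableSet_lt measurable_fst measurable_const)

variable [IsProbabilityMeasure P]

open Classical in
/-- The joint law of the first `n` accepted points and the next one: given the next one,
at time `t`, the first `n` ones are independent points in `(0, t)`, in increasing order. -/
theorem lintegral_first_points_sort (hA : MeasurableSet A) (hr : Antitone (rate P A)) (n : ℕ)
    {F : (Fin n → ℝ × E) × (ℝ × E) → ℝ≥0∞} (hF : Measurable F) :
    ∫⁻ ξ, (if HasNth (fun j => points 0 ξ j ∈ A) n then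
        F (fun k => points 0 ξ (Nat.nth (fun j => points 0 ξ j ∈ A) k),
          points 0 ξ (Nat.nth (fun j => points 0 ξ j ∈ A) n)) else 0) ∂waitLaw P =
      ∫⁻ x, (if 0 < x.1 then
          ENNReal.ofReal (Real.exp (-∫ u in 0..x.1, rate P A u) / n.factorial) *
            ∫⁻ y, F (fun k => y (Tuple.sort (fun j => (y j).1) k), x)
              ∂Measure.pi fun _ : Fin n => (intensity P A).restrict (before E x.1)
          else 0) ∂intensity P A := by
  let G : (Fin (n + 1) → ℝ × E) → ℝ≥0∞ := fun x => F (fun k => x k.castSucc, x (Fin.last n))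
  have hG : Measurable G := by fun_prop
  have key := lintegral_first_points hA hr n 0 hG
  have hcr := continuous_integral_rate hr 0
  simp only [G, Fin.val_castSucc, Fin.val_last] at key
  rw [key, lintegral_pi_fin_succ_last]
  · refine lintegral_congr fun x => ?_
    simp only [fin_snoc_strictMono_iff, Fin.snoc_last, Fin.snoc_castSucc]
    by_cases h : 0 < x.1
    · have hFx : Measurable fun y : Fin n → ℝ × E => F (y, x) := hF.comp measurable_prodMk_right
      -- Passing from the increasing region to sorted independent points produces `n!`, which
      -- cancels the `1 / n!` in front; labels have no atoms under the intensity.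
      rw [if_pos h, lintegral_comp_sort (ℓ := Prod.fst) measurable_fst
        (fun c => Measure.absolutelyContinuous_of_le Measure.restrict_le_self
          (intensity_fst_eq A c)) n hFx, ← Measure.restrict_pi_pi, ← mul_assoc]
      rw [← lintegral_indicator (MeasurableSet.univ_pi fun _ => measurableSet_before _)]
      have h1 : ENNReal.ofReal (Real.exp (-∫ u in 0..x.1, rate P A u) / n.factorial) *
          (n.factorial : ℝ≥0∞) = ENNReal.ofReal (Real.exp (-∫ u in 0..x.1, rate P A u)) := by
        rw [← ENNReal.ofReal_natCast, ← ENNReal.ofReal_mul (by positivity)]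
        congr 1
        field_simp
      rw [h1, ← lintegral_const_mul']
      · refine lintegral_congr fun y => ?_
        have hmem : y ∈ Set.pi univ (fun _ : Fin n => before E x.1) ↔
          ∀ k, 0 < (y k).1 ∧ (y k).1 < x.1 := by
          simp only [Set.mem_pi, mem_univ, true_imp_iff]
          exact Iff.rfl
        by_cases h2 : ∀ k, 0 < (y k).1 ∧ (y k).1 < x.1
        · rw [indicator_of_mem (hmem.2 h2)]
          by_cases h3 : StrictMono fun k => (y k).1
          · rw [if_pos ⟨h, h2, h3⟩, if_pos h3]
          · rw [if_neg fun h' => h3 h'.2.2, if_neg h3, mul_zero]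
        · rw [indicator_of_notMem fun h' => h2 (hmem.1 h'), if_neg fun h' => h2 h'.2.1, mul_zero]
      · exact ENNReal.ofReal_ne_top
    · simp [h]
  · refine Measurable.ite ?_ (by fun_prop) measurable_const
    have h1 : MeasurableSet {x : Fin (n + 1) → ℝ × E | 0 < (x 0).1} :=
      measurableSet_lt measurable_const (by fun_prop)
    exact h1.inter (measurableSet_strictMono measurable_fst _)

end Accepted

/-! ### Products of kernels -/

section Products

theorem piKernel_apply {α ι : Type*} [MeasurableSpace α] [Countable ι] {γ : ι → Type*}
    [∀ i, MeasurableSpace (γ i)] (κ : ∀ i, Kernel α (γ i)) [∀ i, IsMarkovKernel (κ i)] (a : α) :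
    piKernel κ a = Measure.infinitePi fun i => κ i a := rfl

theorem lintegral_infinitePi_prod {ι : Type*} {X : ι → Type*} [∀ i, MeasurableSpace (X i)]
    (μ : ∀ i, Measure (X i)) [∀ i, IsProbabilityMeasure (μ i)] (s : Finset ι)
    {f : ∀ i, X i → ℝ≥0∞} (hf : ∀ i, Measurable (f i)) :
    ∫⁻ x, ∏ i ∈ s, f i (x i) ∂Measure.infinitePi μ = ∏ i ∈ s, ∫⁻ x, f i x ∂μ i := by
  have h := iIndepFun_infinitePi (P := μ) (X := f) hf
  rw [lintegral_prod_eq_prod_lintegral_of_indepFun s _ h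
    fun i => (hf i).comp (measurable_pi_apply i)]
  refine Finset.prod_congr rfl fun i _ => ?_
  rw [← (measurePreserving_eval_infinitePi μ i).lintegral_comp (hf i)]

variable {ι : Type*} [Countable ι] {X Y : ι → Type*} [∀ i, MeasurableSpace (X i)]
  [∀ i, MeasurableSpace (Y i)]

/-- The kernel which applies independent kernels to the coordinates. -/
def coordKernel (κ : ∀ i, Kernel (X i) (Y i)) [∀ i, IsMarkovKernel (κ i)] :
    Kernel (∀ i, X i) (∀ i, Y i) :=
  piKernel fun i => (κ i).comap (fun x : ∀ i, X i => x i) (measurable_pi_apply i)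

instance (κ : ∀ i, Kernel (X i) (Y i)) [∀ i, IsMarkovKernel (κ i)] :
    IsMarkovKernel (coordKernel κ) := by unfold coordKernel; infer_instance

theorem coordKernel_apply (κ : ∀ i, Kernel (X i) (Y i)) [∀ i, IsMarkovKernel (κ i)]
    (x : ∀ i, X i) : coordKernel κ x = Measure.infinitePi fun i => κ i (x i) := rfl

/-- On a box, the left-hand side is the integral of a finite product of functions of different
coordinates, which factorises by independence. -/
theorem infinitePi_bind (μ : ∀ i, Measure (X i)) [∀ i, IsProbabilityMeasure (μ i)]
    (κ : ∀ i, Kernel (X i) (Y i)) [∀ i, IsMarkovKernel (κ i)] :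
    (Measure.infinitePi μ).bind (coordKernel κ) = Measure.infinitePi fun i => (μ i).bind (κ i) := by
  refine Measure.eq_infinitePi _ fun s t ht => ?_
  rw [Measure.bind_apply (MeasurableSet.pi s.countable_toSet fun i _ => ht i)
    (Kernel.aemeasurable _)]
  simp_rw [coordKernel_apply]
  have : ∀ x : ∀ i, X i, Measure.infinitePi (fun i => κ i (x i)) (Set.pi s t) =
      ∏ i ∈ s, κ i (x i) (t i) := fun x => Measure.infinitePi_pi _ fun i _ => ht i
  simp_rw [this]
  rw [lintegral_infinitePi_prod μ s (f := fun i x => κ i x (t i))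
    fun i => (κ i).measurable_coe (ht i)]
  refine Finset.prod_congr rfl fun i _ => ?_
  rw [Measure.bind_apply (ht i) (Kernel.aemeasurable _)]

/-- A case of `infinitePi_bind`: each kernel keeps its coordinate and appends an independent one. -/
theorem infinitePi_prod (μ : ∀ i, Measure (X i)) [∀ i, IsProbabilityMeasure (μ i)]
    (ν : ∀ i, Measure (Y i)) [∀ i, IsProbabilityMeasure (ν i)] :
    ((Measure.infinitePi μ).prod (Measure.infinitePi ν)).map (fun y i => (y.1 i, y.2 i)) =
      Measure.infinitePi fun i => (μ i).prod (ν i) := by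
  have hprod : ∀ i, (μ i).bind (Kernel.id ×ₖ Kernel.const (X i) (ν i)) = (μ i).prod (ν i) := by
    intro i
    rw [← Measure.compProd_eq_comp_prod, Measure.compProd_const]
  simp_rw [← hprod, ← infinitePi_bind]
  ext s hs
  have hzip : Measurable fun (y : (∀ i, X i) × (∀ i, Y i)) i => (y.1 i, y.2 i) := by fun_prop
  rw [Measure.map_apply hzip hs, Measure.prod_apply (hzip hs),
    Measure.bind_apply hs (Kernel.aemeasurable _)]
  refine lintegral_congr fun x => ?_
  rw [coordKernel_apply]
  have : ∀ i, (Kernel.id ×ₖ Kernel.const (X i) (ν i)) (x i) = (ν i).map (Prod.mk (x i)) := by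
    intro i
    rw [Kernel.prod_apply, Kernel.id_apply, Kernel.const_apply, Measure.dirac_prod]
  simp_rw [this]
  rw [← Measure.infinitePi_map_pi _ fun i => measurable_prodMk_left, Measure.map_apply _ hs]
  · rfl
  · fun_prop

end Products

/-- Arrival times with independent marks. -/
theorem lintegral_pppLaw_prod {E : Type*} [MeasurableSpace E] (P : Measure E)
    [IsProbabilityMeasure P] {F : (ℕ → ℝ) × (ℕ → E) → ℝ≥0∞} (hF : Measurable F) :
    ∫⁻ y, F y ∂pppLaw.prod (Measure.infinitePi fun _ : ℕ => P) =
      ∫⁻ ξ, F (fun j => (points 0 ξ j).1, fun j => (points 0 ξ j).2) ∂waitLaw P := by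
  rw [waitLaw, ← infinitePi_prod, lintegral_map (by fun_prop) (by fun_prop)]
  have hsum : Measurable fun (g : ℕ → ℝ) (j : ℕ) => ∑ k ∈ Finset.range (j + 1), g k := by fun_prop
  have hid : Measurable fun c : ℕ → E => c := measurable_id
  rw [pppLaw, lintegral_prod _ hF.aemeasurable, lintegral_map hF.lintegral_prod_right' hsum,
    lintegral_prod _ (by fun_prop)]
  simp [points]

/-! ### The random variable `chi` -/

/-- The first `j` at which the number of successes reaches `n + 1` is itself a success with `n`
successes before it, hence the success with index `n` counted from zero. -/
theorem chi_succ (τ : ℕ → ℝ) (n : ℕ) (T : ℕ → ℝ≥0∞) [Decidable (HasNth (fun k => ENNReal.ofReal (τ k) < T k) n)] :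
    chi τ (n + 1) T = if HasNth (fun k => ENNReal.ofReal (τ k) < T k) n then
      ENNReal.ofReal (τ (Nat.nth (fun k => ENNReal.ofReal (τ k) < T k) n)) else ∞ := by
  classical
  set p : ℕ → Prop := fun k => ENNReal.ofReal (τ k) < T k with hp
  have hcard : ∀ j, ((Finset.range (j + 1)).filter fun k => ENNReal.ofReal (τ k) < T k).card =
      @Nat.count p (fun k => Classical.propDecidable (p k)) (j + 1) := fun j => by
    rw [Nat.count_eq_card_filter_range]
    congr
  let _ : DecidablePred p := fun k => Classical.propDecidable (p k)
  have hiff : ∀ j, (Nat.count p (j + 1) = n + 1 ∧ ∀ i < j, Nat.count p (i + 1) ≠ n + 1) ↔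
      (p j ∧ Nat.count p j = n) := by
    intro j
    rw [Nat.count_succ]
    constructor
    · rintro ⟨h1, h2⟩
      by_cases hj : p j
      · exact ⟨hj, by simpa [hj] using h1⟩
      · simp only [hj, if_false, add_zero] at h1
        cases j with
        | zero => simp at h1
        | succ j => exact absurd h1 (h2 j (Nat.lt_succ_self j))
    · rintro ⟨h1, h2⟩
      refine ⟨by simp [h1, h2], fun i hi h => ?_⟩
      have := Nat.count_monotone p (show i + 1 ≤ j from hi)
      omega
  unfold chi
  simp_rw [hcard]
  by_cases h : HasNth p n
  · have h' : ∃ j, Nat.count p (j + 1) = n + 1 :=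
      ⟨Nat.nth p n, ((hiff _).2 ⟨h.nth_mem, h.count_nth⟩).1⟩
    rw [dif_pos h', if_pos h]
    congr 2
    rw [Nat.find_eq_iff]
    exact (hiff _).2 ⟨h.nth_mem, h.count_nth⟩
  · rw [dif_neg, if_neg h]
    intro h'
    exact h ⟨Nat.find h', (hiff _).1 ⟨Nat.find_spec h', fun i hi => Nat.find_min h' hi⟩⟩

/-- The degenerate constraint: `j = 0` qualifies unless it is a success, and after a success the
count is never zero again. It enters in the measurability of `chi` for all constraints. -/
theorem chi_zero (τ : ℕ → ℝ) (T : ℕ → ℝ≥0∞) :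
    chi τ 0 T = if ENNReal.ofReal (τ 0) < T 0 then ∞ else ENNReal.ofReal (τ 0) := by
  unfold chi
  split_ifs with h1 h2 h2
  · obtain ⟨j, hj⟩ := h1
    rw [Finset.card_eq_zero, Finset.filter_eq_empty_iff] at hj
    exact absurd h2 (hj (Finset.mem_range.2 (Nat.succ_pos j)))
  · congr 2
    rw [Nat.find_eq_zero]
    simpa using h2
  · rfl
  · exact absurd ⟨0, by simpa using h2⟩ h1

theorem measurable_chi {Y : Type*} [MeasurableSpace Y] {τ : Y → ℕ → ℝ} {T : Y → ℕ → ℝ≥0∞}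
    (hτ : Measurable τ) (hT : Measurable T) (D : ℕ) : Measurable fun y => chi (τ y) D (T y) := by
  classical
  have hm : ∀ j, MeasurableSet {y | ENNReal.ofReal (τ y j) < T y j} := fun j =>
    measurableSet_lt (by fun_prop) (by fun_prop)
  cases D with
  | zero =>
    simp_rw [chi_zero]
    exact Measurable.ite (hm 0) measurable_const (by fun_prop)
  | succ n =>
    simp_rw [chi_succ]
    refine Measurable.ite (measurableSet_hasNth hm n) ?_ measurable_const
    exact (measurable_comp_nth hm n (fun j => (measurable_pi_apply j).comp hτ)).ennreal_ofReal

/-- The marked points with label smaller than the mark. -/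
def early {E : Type*} (T : E → ℝ≥0∞) : Set (ℝ × E) := {x | ENNReal.ofReal x.1 < T x.2}

/-! ### The points whose label is smaller than their mark -/

section Early

variable {E : Type*} [MeasurableSpace E] {P : Measure E} [IsProbabilityMeasure P] {T : E → ℝ≥0∞}

theorem measurableSet_early (hT : Measurable T) : MeasurableSet (early T) :=
  measurableSet_lt (by fun_prop) (by fun_prop)

/-- A later label is harder to beat. This is the monotonicity that the general results on accepted
points require. -/
theorem antitone_rate_early : Antitone (rate P (early T)) := fun u v huv =>
  measureReal_mono fun e (he : ENNReal.ofReal v < T e) =>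
    show ENNReal.ofReal u < T e from (ENNReal.ofReal_le_ofReal huv).trans_lt he

theorem lintegral_rate {A : Set (ℝ × E)} (hA : MeasurableSet A)
    {φ : ℝ → ℝ≥0∞} (hφ : Measurable φ) :
    ∫⁻ x, φ x.1 ∂intensity P A = ∫⁻ u, ENNReal.ofReal (rate P A u) * φ u := by
  rw [lintegral_intensity hA (by fun_prop)]
  refine lintegral_congr fun u => ?_
  have : ∀ e, A.indicator (fun x : ℝ × E => φ x.1) (u, e) =
      {e | (u, e) ∈ A}.indicator (fun _ => φ u) e := fun e => rfl
  simp_rw [this]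
  have hm : MeasurableSet {e | (u, e) ∈ A} := measurable_prodMk_left hA
  rw [lintegral_indicator_const hm, rate, ofReal_measureReal, mul_comm]

theorem intensity_before {A : Set (ℝ × E)} (hA : MeasurableSet A) (hr : Antitone (rate P A))
    {t : ℝ} (ht : 0 ≤ t) :
    intensity P A (before E t) = ENNReal.ofReal (∫ u in 0..t, rate P A u) := by
  have h1 : ∫⁻ x, (Ioo 0 t).indicator 1 x.1 ∂intensity P A = _ :=
    lintegral_rate hA (measurable_one.indicator measurableSet_Ioo)
  have h2 : ∫⁻ x, (Ioo 0 t).indicator 1 x.1 ∂intensity P A = intensity P A (before E t) := by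
    rw [← lintegral_indicator_one (measurableSet_before t)]
    rfl
  rw [← h2, h1, intervalIntegral.integral_of_le ht, ofReal_integral_eq_lintegral_ofReal
    hr.intervalIntegrable.1 (Filter.Eventually.of_forall fun u => rate_nonneg u),
    setLIntegral_congr Ioo_ae_eq_Ioc.symm, ← lintegral_indicator measurableSet_Ioo]
  refine lintegral_congr fun u => ?_
  by_cases hu : u ∈ Ioo 0 t <;> simp [indicator, hu]

/-- The early points behave as a Poisson process with the given rate, so the `(n + 1)`-st of them
has the time-changed Gamma density on the right. Its mass may be less than `1`; the condition `φ ∞ =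
0` discards the event that there are too few points. -/
theorem lintegral_chi_succ (hT : Measurable T) (n : ℕ) {φ : ℝ≥0∞ → ℝ≥0∞} (hφ : Measurable φ)
    (hφ' : φ ∞ = 0) :
    ∫⁻ y, φ (chi y.1 (n + 1) fun k => T (y.2 k)) ∂pppLaw.prod (Measure.infinitePi fun _ : ℕ => P) =
      ∫⁻ u in Ioi 0, ENNReal.ofReal (Real.exp (-∫ x in 0..u, rate P (early T) x) *
          ((∫ x in 0..u, rate P (early T) x) ^ n / n.factorial) * rate P (early T) u) *
        φ (ENNReal.ofReal u) := by
  classical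
  set A := early T with hAdef
  have hA : MeasurableSet A := measurableSet_early hT
  have hr : Antitone (rate P A) := antitone_rate_early
  have hc := continuous_integral_rate hr 0
  rw [lintegral_pppLaw_prod P (F := fun y => φ (chi y.1 (n + 1) fun k => T (y.2 k)))
    (hφ.comp (measurable_chi measurable_fst (by fun_prop) (n + 1)))]
  have h1 : ∀ ξ : ℕ → ℝ × E, φ (chi (fun j => (points 0 ξ j).1) (n + 1) fun k =>
      T (points 0 ξ k).2) = if HasNth (fun j => points 0 ξ j ∈ A) n then
        φ (ENNReal.ofReal (points 0 ξ (Nat.nth (fun j => points 0 ξ j ∈ A) n)).1) else 0 := by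
    intro ξ
    have hp : (fun j => points 0 ξ j ∈ A) =
      fun j => ENNReal.ofReal (points 0 ξ j).1 < T (points 0 ξ j).2 := rfl
    rw [chi_succ, hp]
    split_ifs
    · rfl
    · exact hφ'
  simp_rw [h1]
  have key := lintegral_first_points_sort (P := P) hA hr n
    (F := fun x => φ (ENNReal.ofReal x.2.1)) (by fun_prop)
  rw [key]
  simp only [lintegral_const, Measure.pi_univ, Measure.restrict_apply_univ, Finset.prod_const,
    Finset.card_univ, Fintype.card_fin]
  rw [lintegral_congr (g := fun x : ℝ × E => (Ioi (0 : ℝ)).indicator (fun u =>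
    ENNReal.ofReal (Real.exp (-∫ x in 0..u, rate P A x) *
          ((∫ x in 0..u, rate P A x) ^ n / n.factorial)) * φ (ENNReal.ofReal u)) x.1)]
  · rw [lintegral_rate hA (φ := (Ioi (0 : ℝ)).indicator (fun u =>
      ENNReal.ofReal (Real.exp (-∫ x in 0..u, rate P A x) *
          ((∫ x in 0..u, rate P A x) ^ n / n.factorial)) * φ (ENNReal.ofReal u)))
      (Measurable.indicator (by fun_prop) measurableSet_Ioi),
      ← lintegral_indicator measurableSet_Ioi]
    refine lintegral_congr fun u => ?_
    by_cases hu : u ∈ Ioi (0 : ℝ)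
    · rw [indicator_of_mem hu, indicator_of_mem hu, ENNReal.ofReal_mul' (rate_nonneg u)]
      ring
    · rw [indicator_of_notMem hu, indicator_of_notMem hu, mul_zero]
  · intro x
    by_cases hx : 0 < x.1
    · have h0 : 0 ≤ ∫ u in 0..x.1, rate P A u :=
        intervalIntegral.integral_nonneg hx.le fun u _ => rate_nonneg u
      rw [if_pos hx, indicator_of_mem (by exact hx), intensity_before hA hr hx.le,
        ← ENNReal.ofReal_pow h0, mul_comm (φ _), ← mul_assoc,
        ← ENNReal.ofReal_mul (by positivity)]
      congr 2
      ring
    · rw [if_neg hx, indicator_of_notMem (by exact hx)]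

end Early

/-! ### The differential equation -/

/-- The right-hand side of the differential equation for `λ`: the probability that a Poisson
variable with mean `x` is less than an independent degree constraint. -/
def openProb (p : PMF ℕ) (Δ : ℕ) (x : ℝ) : ℝ :=
  Real.exp (-x) * ∑ k ∈ Finset.range Δ, x ^ k / k.factorial * q p (k + 1)

/-- The negative derivative of `openProb`. -/
def closeRate (p : PMF ℕ) (Δ : ℕ) (x : ℝ) : ℝ :=
  Real.exp (-x) * ∑ k ∈ Finset.range Δ, x ^ k / k.factorial * (p (k + 1)).toReal

section ODE

variable {p : PMF ℕ} {Δ : ℕ}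

theorem q_eq_sum (hΔ : ∀ k, Δ < k → p k = 0) (k : ℕ) :
    q p k = ∑ d ∈ Finset.range (Δ + 1), if k ≤ d then (p d).toReal else 0 := by
  refine tsum_eq_sum fun d hd => ?_
  have : Δ < d := by simpa using hd
  simp [hΔ d this]

theorem q_sub_q (hΔ : ∀ k, Δ < k → p k = 0) (k : ℕ) : q p k - q p (k + 1) = (p k).toReal := by
  rw [q_eq_sum hΔ, q_eq_sum hΔ, ← Finset.sum_sub_distrib]
  have : ∀ d ∈ Finset.range (Δ + 1), ((if k ≤ d then (p d).toReal else 0) -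
      if k + 1 ≤ d then (p d).toReal else 0) = if k = d then (p d).toReal else 0 := by
    intro d _
    rcases lt_trichotomy k d with h | h | h
    · rw [if_pos h.le, if_pos (Nat.succ_le_of_lt h), if_neg h.ne, sub_self]
    · rw [if_pos h.le, if_neg (by omega), if_pos h, sub_zero]
    · rw [if_neg (by omega), if_neg (by omega), if_neg h.ne', sub_self]
  rw [Finset.sum_congr rfl this, Finset.sum_ite_eq]
  split_ifs with h
  · rfl
  · rw [hΔ k (by simpa using h)]; rfl

theorem q_succ_eq_zero (hΔ : ∀ k, Δ < k → p k = 0) : q p (Δ + 1) = 0 := by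
  rw [q_eq_sum hΔ]
  refine Finset.sum_eq_zero fun d hd => if_neg ?_
  have := Finset.mem_range.1 hd
  omega

theorem sum_toReal (hΔ : ∀ k, Δ < k → p k = 0) :
    ∑ d ∈ Finset.range (Δ + 1), (p d).toReal = 1 := by
  have h : ∑' d, p d = ∑ d ∈ Finset.range (Δ + 1), p d :=
    tsum_eq_sum fun d hd => hΔ d (by simpa using hd)
  rw [← ENNReal.toReal_sum fun d _ => p.apply_ne_top d, ← h, p.tsum_coe]
  rfl

theorem q_one (hp0 : p 0 = 0) (hΔ : ∀ k, Δ < k → p k = 0) : q p 1 = 1 := by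
  have h := q_sub_q hΔ 0
  have h0 : q p 0 = 1 := by rw [q_eq_sum hΔ]; simpa using sum_toReal hΔ
  simp [hp0] at h
  linarith

theorem q_nonneg (k : ℕ) : 0 ≤ q p k :=
  tsum_nonneg fun d => by split_ifs <;> simp

theorem delta_pos (hp0 : p 0 = 0) (hΔ : ∀ k, Δ < k → p k = 0) : 0 < Δ := by
  by_contra h
  have := sum_toReal hΔ
  simp [Nat.eq_zero_of_not_pos h, hp0] at this

theorem openProb_zero (hp0 : p 0 = 0) (hΔ : ∀ k, Δ < k → p k = 0) : openProb p Δ 0 = 1 := by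
  obtain ⟨m, rfl⟩ := Nat.exists_eq_succ_of_ne_zero (delta_pos hp0 hΔ).ne'
  rw [openProb, Finset.sum_range_succ']
  simp [q_one hp0 hΔ]

/-- Telescoping: differentiating the powers shifts `q (k + 1)` to `q (k + 2)`, the exponential
contributes `-q (k + 1)`, and the difference is `-p (k + 1)`. -/
theorem hasDerivAt_openProb (hp0 : p 0 = 0) (hΔ : ∀ k, Δ < k → p k = 0) (x : ℝ) :
    HasDerivAt (openProb p Δ) (-closeRate p Δ x) x := by
  obtain ⟨m, rfl⟩ := Nat.exists_eq_succ_of_ne_zero (delta_pos hp0 hΔ).ne'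
  have h1 : HasDerivAt (fun x : ℝ => ∑ k ∈ Finset.range (m + 1), x ^ k / k.factorial * q p (k + 1))
      (∑ k ∈ Finset.range (m + 1), (k : ℝ) * x ^ (k - 1) / k.factorial * q p (k + 1)) x :=
    HasDerivAt.fun_sum fun k _ => ((hasDerivAt_pow k x).div_const _).mul_const _
  have h2 : ∑ k ∈ Finset.range (m + 1), (k : ℝ) * x ^ (k - 1) / k.factorial * q p (k + 1) =
      ∑ k ∈ Finset.range (m + 1), x ^ k / k.factorial * q p (k + 2) := by
    rw [Finset.sum_range_succ', Finset.sum_range_succ]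
    -- Differentiation lowers the degree, so the shifted sum has one term too many at the top; its
    -- coefficient vanishes.
    have h3 := q_succ_eq_zero hΔ
    simp only [Nat.succ_eq_add_one, add_assoc] at h3
    norm_num at h3 ⊢
    rw [h3, mul_zero, add_zero]
    refine Finset.sum_congr rfl fun k _ => ?_
    have : ((k + 1).factorial : ℝ) = (k + 1) * k.factorial := by
      rw [Nat.factorial_succ]; push_cast; ring
    have h4 : (k.factorial : ℝ) ≠ 0 := by positivity
    have h5 : (k + 1 : ℝ) ≠ 0 := by positivity
    rw [this]
    field_simp
  rw [h2] at h1
  have h3 : HasDerivAt (fun x : ℝ => Real.exp (-x)) (-Real.exp (-x)) x := by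
    simpa using (hasDerivAt_neg x).exp
  have h4 := h3.mul h1
  have h5 : -closeRate p (m + 1) x = -Real.exp (-x) *
      ∑ k ∈ Finset.range (m + 1), x ^ k / k.factorial * q p (k + 1) + Real.exp (-x) *
      ∑ k ∈ Finset.range (m + 1), x ^ k / k.factorial * q p (k + 2) := by
    rw [closeRate]
    simp_rw [← q_sub_q hΔ, mul_sub, Finset.sum_sub_distrib]
    ring
  rw [Nat.succ_eq_add_one, h5]
  exact h4

theorem continuous_closeRate : Continuous (closeRate p Δ) := by
  unfold closeRate; fun_prop

theorem continuous_openProb : Continuous (openProb p Δ) := by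
  unfold openProb; fun_prop

theorem closeRate_nonneg {x : ℝ} (hx : 0 ≤ x) : 0 ≤ closeRate p Δ x :=
  mul_nonneg (Real.exp_nonneg _) (Finset.sum_nonneg fun k _ => by positivity)

theorem openProb_pos (hp0 : p 0 = 0) (hΔ : ∀ k, Δ < k → p k = 0) {x : ℝ} (hx : 0 ≤ x) :
    0 < openProb p Δ x := by
  obtain ⟨m, rfl⟩ := Nat.exists_eq_succ_of_ne_zero (delta_pos hp0 hΔ).ne'
  refine mul_pos (Real.exp_pos _) ?_
  rw [Finset.sum_range_succ']
  have : 0 ≤ ∑ k ∈ Finset.range m, x ^ (k + 1) / (k + 1).factorial * q p (k + 1 + 1) :=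
    Finset.sum_nonneg fun k _ => mul_nonneg (by positivity) (q_nonneg _)
  simp only [zero_add, q_one hp0 hΔ]
  norm_num
  linarith

theorem tendsto_openProb : Filter.Tendsto (openProb p Δ) Filter.atTop (nhds 0) := by
  have h : ∀ k : ℕ, Filter.Tendsto (fun x : ℝ => x ^ k * Real.exp (-x) *
      (q p (k + 1) / k.factorial)) Filter.atTop (nhds (0 * (q p (k + 1) / k.factorial))) :=
    fun k => (Real.tendsto_pow_mul_exp_neg_atTop_nhds_zero k).mul_const _
  have h2 := tendsto_finsetSum (Finset.range Δ) fun k _ => h k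
  simp only [zero_mul, Finset.sum_const_zero] at h2
  refine h2.congr fun x => ?_
  rw [openProb, Finset.mul_sum]
  exact Finset.sum_congr rfl fun k _ => by ring

theorem tsum_z (hΔ : ∀ k, Δ < k → p k = 0) (lam : ℝ → ℝ) (t : ℝ) :
    ∑' k, z p lam t k = closeRate p Δ (lam t) := by
  rw [closeRate, Finset.mul_sum, tsum_eq_sum (s := Finset.range Δ)]
  · exact Finset.sum_congr rfl fun k _ => by rw [z]; ring
  · intro k hk
    rw [z, hΔ (k + 1) (by simp at hk; omega)]
    simp

/-- The right-hand side is only locally Lipschitz. On `[0, b]` both solutions stay in some `[-M,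
M]`, where `closeRate` is bounded, and Grönwall's inequality applies. -/
theorem IsLambda.eqOn (hp0 : p 0 = 0) (hΔ : ∀ k, Δ < k → p k = 0) {l₁ l₂ : ℝ → ℝ}
    (h₁ : IsLambda p Δ l₁) (h₂ : IsLambda p Δ l₂) : EqOn l₁ l₂ (Ici 0) := by
  intro b hb
  have hc : ∀ {l}, IsLambda p Δ l → ContinuousOn l (Icc 0 b) := fun h t ht =>
    ((h.deriv t ht.1).continuousWithinAt).mono Icc_subset_Ici_self
  obtain ⟨M₁, hM₁⟩ := isCompact_Icc.exists_bound_of_continuousOn (hc h₁)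
  obtain ⟨M₂, hM₂⟩ := isCompact_Icc.exists_bound_of_continuousOn (hc h₂)
  set M := max M₁ M₂
  obtain ⟨K, hK⟩ := (isCompact_Icc (a := -M) (b := M)).exists_bound_of_continuousOn
    (continuous_closeRate (p := p) (Δ := Δ)).continuousOn
  have hlip : LipschitzOnWith K.toNNReal (openProb p Δ) (Icc (-M) M) := by
    refine (convex_Icc _ _).lipschitzOnWith_of_nnnorm_hasDerivWithin_le
      (fun x _ => (hasDerivAt_openProb hp0 hΔ x).hasDerivWithinAt) fun x hx => ?_
    rw [nnnorm_neg, ← NNReal.coe_le_coe, coe_nnnorm]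
    exact (hK x hx).trans (Real.le_coe_toNNReal K)
  refine ODE_solution_unique_of_mem_Icc_right (v := fun _ => openProb p Δ)
    (s := fun _ => Icc (-M) M) (K := K.toNNReal) (fun _ _ => hlip)
    (hc h₁) (fun t ht => (h₁.deriv t ht.1).mono (Ici_subset_Ici.2 ht.1)) ?_
    (hc h₂) (fun t ht => (h₂.deriv t ht.1).mono (Ici_subset_Ici.2 ht.1)) ?_
    (h₁.zero.trans h₂.zero.symm) (right_mem_Icc.2 hb)
  · intro t ht
    exact abs_le.1 ((hM₁ t ⟨ht.1, ht.2.le⟩).trans (le_max_left _ _))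
  · intro t ht
    exact abs_le.1 ((hM₂ t ⟨ht.1, ht.2.le⟩).trans (le_max_right _ _))

end ODE

/-! ### The recursive distributional equation -/

section RDE

variable {p : PMF ℕ} {Δ : ℕ}

theorem lintegral_toMeasure_eq_sum (hp0 : p 0 = 0) (hΔ : ∀ k, Δ < k → p k = 0) (F : ℕ → ℝ≥0∞) :
    ∫⁻ d, F d ∂p.toMeasure = ∑ k ∈ Finset.range Δ, p (k + 1) * F (k + 1) := by
  rw [lintegral_countable', tsum_eq_sum (s := Finset.range (Δ + 1)), Finset.sum_range_succ']
  · simp [PMF.toMeasure_apply_singleton, hp0, mul_comm]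
  · intro d hd
    rw [PMF.toMeasure_apply_singleton _ _ (measurableSet_singleton d), hΔ d (by simpa using hd),
      mul_zero]

variable {E : Type*} [MeasurableSpace E] {T : E → ℝ≥0∞}

theorem lintegral_prod_prod_comm {X Y Z : Type*} [MeasurableSpace X] [MeasurableSpace Y]
    [MeasurableSpace Z] {μ : Measure X} {π : Measure Y} {ν : Measure Z} [SFinite μ] [SFinite π]
    [SFinite ν] {G : (X × Y) × Z → ℝ≥0∞} (hG : Measurable G) :
    ∫⁻ y, G y ∂(μ.prod π).prod ν = ∫⁻ d, ∫⁻ z, G ((z.1, d), z.2) ∂μ.prod ν ∂π := by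
  rw [lintegral_prod _ hG.aemeasurable, lintegral_prod _ hG.lintegral_prod_right'.aemeasurable,
    lintegral_lintegral_swap hG.lintegral_prod_right'.aemeasurable]
  refine lintegral_congr fun d => ?_
  rw [lintegral_prod]
  exact (hG.comp (by fun_prop)).aemeasurable

theorem measurable_chi_prod (hT : Measurable T) :
    Measurable fun y : ((ℕ → ℝ) × ℕ) × (ℕ → E) => chi y.1.1 y.1.2 fun k => T (y.2 k) := by
  have h : Measurable fun z : ((ℕ → ℝ) × (ℕ → E)) × ℕ => chi z.1.1 z.2 fun k => T (z.1.2 k) :=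
    measurable_from_prod_countable_left fun D => measurable_chi measurable_fst (by fun_prop) D
  exact h.comp (f := fun y : ((ℕ → ℝ) × ℕ) × (ℕ → E) => ((y.1.1, y.2), y.1.2)) (by fun_prop)

variable {P : Measure E} [IsProbabilityMeasure P]

/-- The law of the first time when the number of accepted points reaches the degree constraint. -/
theorem lintegral_chi (hp0 : p 0 = 0) (hΔ : ∀ k, Δ < k → p k = 0) (hT : Measurable T)
    {φ : ℝ≥0∞ → ℝ≥0∞} (hφ : Measurable φ) (hφ' : φ ∞ = 0) :
    ∫⁻ y, φ (chi y.1.1 y.1.2 fun k => T (y.2 k))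
        ∂(pppLaw.prod p.toMeasure).prod (Measure.infinitePi fun _ : ℕ => P) =
      ∫⁻ u in Ioi 0, ENNReal.ofReal (closeRate p Δ (∫ x in 0..u, rate P (early T) x) *
          rate P (early T) u) * φ (ENNReal.ofReal u) := by
  have hmeas : Measurable fun y : ((ℕ → ℝ) × ℕ) × (ℕ → E) =>
      φ (chi y.1.1 y.1.2 fun k => T (y.2 k)) := hφ.comp (measurable_chi_prod hT)
  rw [lintegral_prod_prod_comm hmeas, lintegral_toMeasure_eq_sum hp0 hΔ]
  have hr : Antitone (rate P (early T)) := antitone_rate_early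
  have hc := continuous_integral_rate hr 0
  have hrm := hr.measurable
  simp_rw [lintegral_chi_succ hT _ hφ hφ']
  have hm : ∀ n : ℕ, Measurable fun u => ENNReal.ofReal (Real.exp (-∫ x in 0..u, rate P (early T) x) *
          ((∫ x in 0..u, rate P (early T) x) ^ n / n.factorial) * rate P (early T) u) *
        φ (ENNReal.ofReal u) := fun n => by fun_prop
  simp_rw [← fun n => lintegral_const_mul (μ := volume.restrict (Ioi 0)) (p (n + 1)) (hm n)]
  rw [← lintegral_finsetSum _ fun n _ => (hm n).const_mul _]
  refine setLIntegral_congr_fun measurableSet_Ioi fun u hu => ?_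
  have h0 : 0 ≤ ∫ x in 0..u, rate P (early T) x :=
    intervalIntegral.integral_nonneg (le_of_lt hu) fun u _ => rate_nonneg u
  have hr0 : 0 ≤ rate P (early T) u := rate_nonneg u
  simp_rw [← mul_assoc, ← Finset.sum_mul]
  congr 1
  have h1 : ∀ n : ℕ, p (n + 1) = ENNReal.ofReal (p (n + 1)).toReal := fun n =>
    (ENNReal.ofReal_toReal (p.apply_ne_top _)).symm
  simp_rw [fun n => congrArg (· * ENNReal.ofReal (Real.exp (-∫ x in 0..u, rate P (early T) x) *
          ((∫ x in 0..u, rate P (early T) x) ^ n / n.factorial) * rate P (early T) u)) (h1 n),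
    ← ENNReal.ofReal_mul ENNReal.toReal_nonneg]
  rw [← ENNReal.ofReal_sum_of_nonneg fun n _ => by positivity]
  congr 1
  rw [closeRate, Finset.mul_sum, Finset.sum_mul]
  exact Finset.sum_congr rfl fun n _ => by ring

/-- The analytic form of the recursive distributional equation. -/
def HasEarlyLaw (p : PMF ℕ) (Δ : ℕ) (ν : Measure ℝ≥0∞) : Prop :=
  ∀ φ : ℝ≥0∞ → ℝ≥0∞, Measurable φ → φ ∞ = 0 →
    ∫⁻ x, φ x ∂ν = ∫⁻ u in Ioi 0, ENNReal.ofReal (closeRate p Δ (∫ x in 0..u, rate ν (early id) x) *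
          rate ν (early id) u) * φ (ENNReal.ofReal u)

theorem SolvesRDE.hasEarlyLaw (hp0 : p 0 = 0) (hΔ : ∀ k, Δ < k → p k = 0) {ν : Measure ℝ≥0∞}
    (hν : SolvesRDE p ν) : HasEarlyLaw p Δ ν := by
  intro φ hφ hφ'
  have := hν.1
  conv_lhs => rw [← hν.2]
  rw [lintegral_map hφ (by exact measurable_chi_prod measurable_id)]
  exact lintegral_chi hp0 hΔ measurable_id hφ hφ'

/-! ### From the recursive distributional equation to the differential equation -/

section EarlyLaw

variable {ν : Measure ℝ≥0∞}

/-- The integrated tail of `ν`. -/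
def cumTail (ν : Measure ℝ≥0∞) (t : ℝ) : ℝ := ∫ x in 0..t, rate ν (early id) x

theorem rate_early_id (t : ℝ) : rate ν (early id) t = ν.real (Ioi (ENNReal.ofReal t)) := rfl

theorem cumTail_nonneg {t : ℝ} (ht : 0 ≤ t) : 0 ≤ cumTail ν t :=
  intervalIntegral.integral_nonneg ht fun u _ => rate_nonneg u

variable [IsProbabilityMeasure ν]

theorem intervalIntegrable_closeRate_mul_rate (a b : ℝ) : IntervalIntegrable
    (fun u => closeRate p Δ (cumTail ν u) * rate ν (early id) u) volume a b := by
  have hr : Antitone (rate ν (early id)) := antitone_rate_early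
  refine IntervalIntegrable.continuousOn_mul hr.intervalIntegrable ?_
  exact (continuous_closeRate.comp (continuous_integral_rate hr 0)).continuousOn

/-- Testing the law against the indicator of `[0, t]` gives the distribution function, and the rate
is its complement. -/
theorem HasEarlyLaw.rate_eq (h : HasEarlyLaw p Δ ν) {t : ℝ} (ht : 0 ≤ t) :
    rate ν (early id) t =
      1 - ∫ u in 0..t, closeRate p Δ (cumTail ν u) * rate ν (early id) u := by
  have hr : Antitone (rate ν (early id)) := antitone_rate_early
  have h1 := h ((Iic (ENNReal.ofReal t)).indicator 1)
    (measurable_one.indicator measurableSet_Iic) (by simp)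
  rw [lintegral_indicator_one measurableSet_Iic] at h1
  have h2 : ν.real (Iic (ENNReal.ofReal t)) =
      ∫ u in 0..t, closeRate p Δ (cumTail ν u) * rate ν (early id) u := by
    have hnn : 0 ≤ ∫ u in 0..t, closeRate p Δ (cumTail ν u) * rate ν (early id) u :=
      intervalIntegral.integral_nonneg ht fun u hu =>
        mul_nonneg (closeRate_nonneg (cumTail_nonneg hu.1)) (rate_nonneg u)
    rw [Measure.real, h1, ← ENNReal.toReal_ofReal hnn]
    congr 1
    rw [intervalIntegral.integral_of_le ht, ofReal_integral_eq_lintegral_ofReal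
      (intervalIntegrable_closeRate_mul_rate 0 t).1, ← lintegral_indicator measurableSet_Ioi,
      ← lintegral_indicator measurableSet_Ioc]
    · refine lintegral_congr fun u => ?_
      by_cases hu : 0 < u
      · rw [indicator_of_mem (by exact hu)]
        by_cases hut : u ≤ t
        · rw [indicator_of_mem (by exact ENNReal.ofReal_le_ofReal hut),
            indicator_of_mem (by exact ⟨hu, hut⟩)]
          simp [cumTail]
        · rw [indicator_of_notMem, indicator_of_notMem, mul_zero]
          · exact fun h => hut h.2
          · exact fun h => hut ((ENNReal.ofReal_le_ofReal_iff ht).1 h)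
      · rw [indicator_of_notMem (by exact hu), indicator_of_notMem]
        exact fun h => hu h.1
    · filter_upwards [ae_restrict_mem measurableSet_Ioc] with u hu
      exact mul_nonneg (closeRate_nonneg (cumTail_nonneg hu.1.le)) (rate_nonneg u)
  rw [rate_early_id, ← compl_Iic, probReal_compl_eq_one_sub measurableSet_Iic, h2]

/-- A bootstrap: the tail is a priori just antitone, but `HasEarlyLaw.rate_eq` exhibits it as one
minus a primitive. This makes `cumTail ν` differentiable at every point of `[0, ∞)`. -/
theorem HasEarlyLaw.continuousOn_rate (h : HasEarlyLaw p Δ ν) :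
    ContinuousOn (rate ν (early id)) (Ici 0) := by
  have hc : Continuous fun t => 1 - ∫ u in 0..t, closeRate p Δ (cumTail ν u) * rate ν (early id) u :=
    continuous_const.sub (intervalIntegral.continuous_primitive
      intervalIntegrable_closeRate_mul_rate 0)
  exact hc.continuousOn.congr fun t ht => h.rate_eq ht

theorem HasEarlyLaw.hasDerivWithinAt_cumTail (h : HasEarlyLaw p Δ ν) {t : ℝ} (ht : 0 ≤ t) :
    HasDerivWithinAt (cumTail ν) (rate ν (early id) t) (Ici 0) t := by
  have hr : Antitone (rate ν (early id)) := antitone_rate_early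
  rcases ht.eq_or_lt with rfl | ht'
  · exact intervalIntegral.integral_hasDerivWithinAt_right hr.intervalIntegrable
      (s := Ici 0) (t := Ioi 0)
      hr.measurable.stronglyMeasurable.stronglyMeasurableAtFilter
      ((h.continuousOn_rate 0 (mem_Ici.2 le_rfl)).mono Ioi_subset_Ici_self)
  · refine (intervalIntegral.integral_hasDerivAt_right hr.intervalIntegrable
      hr.measurable.stronglyMeasurable.stronglyMeasurableAtFilter
      ((h.continuousOn_rate t ht).continuousAt (Ici_mem_nhds ht'))).hasDerivWithinAt

/-- The crucial integration: both sides start at `1` and have right derivative `-closeRate(cumTail)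
· rate`, because `openProb' = -closeRate` and `cumTail' = rate`. The second-order equation for
`cumTail` thereby becomes the first-order one. -/
theorem HasEarlyLaw.rate_eq_openProb (hp0 : p 0 = 0) (hΔ : ∀ k, Δ < k → p k = 0)
    (h : HasEarlyLaw p Δ ν) {t : ℝ} (ht : 0 ≤ t) :
    rate ν (early id) t = openProb p Δ (cumTail ν t) := by
  have hr : Antitone (rate ν (early id)) := antitone_rate_early
  have hcont : Continuous (cumTail ν) := continuous_integral_rate hr 0
  let g : ℝ → ℝ := fun t => (1 - ∫ u in 0..t, closeRate p Δ (cumTail ν u) * rate ν (early id) u) -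
    openProb p Δ (cumTail ν t)
  have hg : ∀ x ∈ Icc 0 t, g x = g 0 := by
    refine constant_of_has_deriv_right_zero ?_ ?_
    · exact ((continuous_const.sub (intervalIntegral.continuous_primitive
        intervalIntegrable_closeRate_mul_rate 0)).sub
        (continuous_openProb.comp hcont)).continuousOn
    · intro x hx
      have hsub : Ici x ⊆ Ici (0 : ℝ) := Ici_subset_Ici.2 hx.1
      have hw : ContinuousWithinAt (fun u => closeRate p Δ (cumTail ν u) * rate ν (early id) u)
          (Ici x) x :=
        ((continuous_closeRate.comp hcont).continuousWithinAt).mul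
          ((h.continuousOn_rate x hx.1).mono hsub)
      have hwm : Measurable (fun u => closeRate p Δ (cumTail ν u) * rate ν (early id) u) :=
        (continuous_closeRate.comp hcont).measurable.mul hr.measurable
      have h1 : HasDerivWithinAt (fun t => ∫ u in 0..t, closeRate p Δ (cumTail ν u) *
          rate ν (early id) u) (closeRate p Δ (cumTail ν x) * rate ν (early id) x) (Ici x) x :=
        intervalIntegral.integral_hasDerivWithinAt_right
          (intervalIntegrable_closeRate_mul_rate 0 x) (s := Ici x) (t := Ioi x)
          hwm.stronglyMeasurable.stronglyMeasurableAtFilter (hw.mono Ioi_subset_Ici_self)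
      have h2 := (hasDerivAt_openProb hp0 hΔ (cumTail ν x)).comp_hasDerivWithinAt x
        ((h.hasDerivWithinAt_cumTail hx.1).mono hsub)
      have h3 := (h1.const_sub 1).sub h2
      have h4 : -(closeRate p Δ (cumTail ν x) * rate ν (early id) x) -
          -closeRate p Δ (cumTail ν x) * rate ν (early id) x = 0 := by ring
      rw [h4] at h3
      exact h3
  have h0 : g 0 = 0 := by simp [g, cumTail, openProb_zero hp0 hΔ]
  have := hg t ⟨ht, le_rfl⟩
  rw [h0] at this
  simp only [g, ← h.rate_eq ht] at this
  linarith

theorem HasEarlyLaw.isLambda (hp0 : p 0 = 0) (hΔ : ∀ k, Δ < k → p k = 0)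
    (h : HasEarlyLaw p Δ ν) : IsLambda p Δ (cumTail ν) where
  zero := by simp [cumTail]
  deriv t ht := by
    have := h.hasDerivWithinAt_cumTail ht
    rwa [h.rate_eq_openProb hp0 hΔ ht] at this

/-- An atom of mass `c` at `∞` would keep the tail above `c`, so `cumTail` would grow at least
linearly. But the tail equals `openProb` of `cumTail`, which would then tend to `0`. -/
theorem HasEarlyLaw.measure_top (hp0 : p 0 = 0) (hΔ : ∀ k, Δ < k → p k = 0)
    (h : HasEarlyLaw p Δ ν) : ν {∞} = 0 := by
  by_contra hne
  have hr : Antitone (rate ν (early id)) := antitone_rate_early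
  set c := ν.real {∞} with hc
  have hcpos : 0 < c := ENNReal.toReal_pos hne (measure_ne_top _ _)
  have hle : ∀ t, c ≤ rate ν (early id) t := fun t => by
    rw [rate_early_id]
    exact measureReal_mono (by simp)
  have hcum : ∀ t, 0 ≤ t → c * t ≤ cumTail ν t := by
    intro t ht
    have : ∫ _ in 0..t, c ≤ cumTail ν t :=
      intervalIntegral.integral_mono ht (by simp) hr.intervalIntegrable hle
    simpa [mul_comm] using this
  have htend : Filter.Tendsto (cumTail ν) Filter.atTop Filter.atTop :=
    Filter.tendsto_atTop_mono' _ (Filter.eventually_atTop.2 ⟨0, hcum⟩)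
      (Filter.tendsto_id.const_mul_atTop hcpos)
  have h0 := (tendsto_openProb (p := p) (Δ := Δ)).comp htend
  have : c ≤ 0 := ge_of_tendsto h0 (Filter.eventually_atTop.2 ⟨0, fun t ht => by
    simpa [← h.rate_eq_openProb hp0 hΔ ht] using hle t⟩)
  linarith

end EarlyLaw

end RDE

/-! ### The densities of the branching process -/

section Densities

variable {p : PMF ℕ} {Δ : ℕ} {lam : ℝ → ℝ}

theorem IsLambda.lamDeriv_eq (h : IsLambda p Δ lam) {t : ℝ} (ht : 0 ≤ t) :
    lamDeriv lam t = openProb p Δ (lam t) :=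
  (h.deriv t ht).derivWithin (uniqueDiffOn_Ici 0 t ht)

theorem IsLambda.hasDerivWithinAt (h : IsLambda p Δ lam) {t : ℝ} (ht : 0 ≤ t) :
    HasDerivWithinAt lam (lamDeriv lam t) (Ici 0) t := by
  rw [h.lamDeriv_eq ht]; exact h.deriv t ht

theorem IsLambda.hasDerivWithinAt_lamDeriv (hp0 : p 0 = 0) (hΔ : ∀ k, Δ < k → p k = 0)
    (h : IsLambda p Δ lam) {t : ℝ} (ht : 0 ≤ t) :
    HasDerivWithinAt (lamDeriv lam) (-(closeRate p Δ (lam t) * lamDeriv lam t)) (Ici 0) t := by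
  have h1 := (hasDerivAt_openProb hp0 hΔ (lam t)).comp_hasDerivWithinAt t (h.hasDerivWithinAt ht)
  rw [← neg_mul]
  exact h1.congr (fun s hs => h.lamDeriv_eq hs) (h.lamDeriv_eq ht)

theorem IsLambda.typeDensity_eq (hp0 : p 0 = 0) (hΔ : ∀ k, Δ < k → p k = 0)
    (h : IsLambda p Δ lam) {t : ℝ} (ht : 0 ≤ t) :
    typeDensity lam t = closeRate p Δ (lam t) * lamDeriv lam t := by
  rw [typeDensity, (h.hasDerivWithinAt_lamDeriv hp0 hΔ ht).derivWithin (uniqueDiffOn_Ici 0 t ht),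
    neg_neg]

/-- The default value of `derivWithin` away from the closure of the set; it makes the density
measurable on all of `ℝ`. -/
theorem typeDensity_of_neg {t : ℝ} (ht : t < 0) : typeDensity lam t = 0 := by
  rw [typeDensity, derivWithin_zero_of_notMem_closure, neg_zero]
  rw [isClosed_Ici.closure_eq]
  exact notMem_Ici.2 ht

theorem IsLambda.continuousOn (h : IsLambda p Δ lam) : ContinuousOn lam (Ici 0) :=
  fun t ht => (h.deriv t ht).continuousWithinAt

theorem IsLambda.continuousOn_lamDeriv (h : IsLambda p Δ lam) :
    ContinuousOn (lamDeriv lam) (Ici 0) :=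
  (continuous_openProb.comp_continuousOn h.continuousOn).congr fun _ ht => h.lamDeriv_eq ht

theorem IsLambda.continuousOn_typeDensity (hp0 : p 0 = 0) (hΔ : ∀ k, Δ < k → p k = 0)
    (h : IsLambda p Δ lam) : ContinuousOn (typeDensity lam) (Ici 0) :=
  ((continuous_closeRate.comp_continuousOn h.continuousOn).mul h.continuousOn_lamDeriv).congr
    fun _ ht => h.typeDensity_eq hp0 hΔ ht

theorem measurable_indicator_of_continuousOn {f : ℝ → ℝ} (hf : ContinuousOn f (Ici 0)) :
    Measurable ((Ici 0).indicator f) := by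
  have h1 : Continuous fun t : ℝ => f (max t 0) :=
    hf.comp_continuous (by fun_prop) fun t => le_max_right t 0
  have h2 : (Ici 0).indicator f = (Ici 0).indicator fun t => f (max t 0) :=
    indicator_congr fun t ht => by rw [max_eq_left ht]
  rw [h2]
  exact h1.measurable.indicator measurableSet_Ici

theorem IsLambda.measurable_typeDensity (hp0 : p 0 = 0) (hΔ : ∀ k, Δ < k → p k = 0)
    (h : IsLambda p Δ lam) : Measurable (typeDensity lam) := by
  have : typeDensity lam = (Ici 0).indicator (typeDensity lam) := by
    ext t
    by_cases ht : t ∈ Ici (0 : ℝ)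
    · rw [indicator_of_mem ht]
    · rw [indicator_of_notMem ht, typeDensity_of_neg (notMem_Ici.1 ht)]
  rw [this]
  exact measurable_indicator_of_continuousOn (h.continuousOn_typeDensity hp0 hΔ)

variable {ν : Measure ℝ≥0∞} [IsProbabilityMeasure ν]

/-- Uniqueness for the initial value problem identifies `λ` with the integrated tail of `ν`. The
signs and normalisations needed for the branching process are read off from this probabilistic
meaning. -/
theorem IsLambda.eq_cumTail (hp0 : p 0 = 0) (hΔ : ∀ k, Δ < k → p k = 0) (h : IsLambda p Δ lam)
    (hν : HasEarlyLaw p Δ ν) {t : ℝ} (ht : 0 ≤ t) : lam t = cumTail ν t :=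
  h.eqOn hp0 hΔ (hν.isLambda hp0 hΔ) ht

theorem IsLambda.lamDeriv_eq_rate (hp0 : p 0 = 0) (hΔ : ∀ k, Δ < k → p k = 0)
    (h : IsLambda p Δ lam) (hν : HasEarlyLaw p Δ ν) {t : ℝ} (ht : 0 ≤ t) :
    lamDeriv lam t = rate ν (early id) t := by
  rw [h.lamDeriv_eq ht, h.eq_cumTail hp0 hΔ hν ht, hν.rate_eq_openProb hp0 hΔ ht]

theorem IsLambda.nonneg (hp0 : p 0 = 0) (hΔ : ∀ k, Δ < k → p k = 0) (h : IsLambda p Δ lam)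
    (hν : HasEarlyLaw p Δ ν) {t : ℝ} (ht : 0 ≤ t) : 0 ≤ lam t := by
  rw [h.eq_cumTail hp0 hΔ hν ht]; exact cumTail_nonneg ht

theorem IsLambda.lamDeriv_pos (hp0 : p 0 = 0) (hΔ : ∀ k, Δ < k → p k = 0) (h : IsLambda p Δ lam)
    (hν : HasEarlyLaw p Δ ν) {t : ℝ} (ht : 0 ≤ t) : 0 < lamDeriv lam t := by
  rw [h.lamDeriv_eq ht]; exact openProb_pos hp0 hΔ (h.nonneg hp0 hΔ hν ht)

theorem IsLambda.typeDensity_nonneg (hp0 : p 0 = 0) (hΔ : ∀ k, Δ < k → p k = 0)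
    (h : IsLambda p Δ lam) (hν : HasEarlyLaw p Δ ν) (t : ℝ) : 0 ≤ typeDensity lam t := by
  rcases lt_or_ge t 0 with ht | ht
  · rw [typeDensity_of_neg ht]
  · rw [h.typeDensity_eq hp0 hΔ ht]
    exact mul_nonneg (closeRate_nonneg (h.nonneg hp0 hΔ hν ht)) (h.lamDeriv_pos hp0 hΔ hν ht).le

theorem lintegral_typeLaw (hp0 : p 0 = 0) (hΔ : ∀ k, Δ < k → p k = 0) (h : IsLambda p Δ lam)
    {φ : ℝ → ℝ≥0∞} (hφ : Measurable φ) :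
    ∫⁻ u, φ u ∂typeLaw lam = ∫⁻ u in Ioi 0, ENNReal.ofReal (typeDensity lam u) * φ u := by
  have := h.measurable_typeDensity hp0 hΔ
  rw [typeLaw, lintegral_withDensity_eq_lintegral_mul _ (by fun_prop) hφ,
    setLIntegral_congr Ioi_ae_eq_Ici.symm]
  rfl

/-- On `(0, ∞)` the law `ν` has density `closeRate(λ) λ' = f`, and it does not charge `∞`. As `ν` is
arbitrary, this contains the uniqueness for the recursive distributional equation. -/
theorem IsLambda.map_typeLaw (hp0 : p 0 = 0) (hΔ : ∀ k, Δ < k → p k = 0) (h : IsLambda p Δ lam)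
    (hν : HasEarlyLaw p Δ ν) : (typeLaw lam).map ENNReal.ofReal = ν := by
  have key : ∀ φ : ℝ≥0∞ → ℝ≥0∞, Measurable φ → φ ∞ = 0 →
      ∫⁻ x, φ x ∂(typeLaw lam).map ENNReal.ofReal = ∫⁻ x, φ x ∂ν := by
    intro φ hφ hφ'
    rw [hν φ hφ hφ', lintegral_map hφ ENNReal.measurable_ofReal,
      lintegral_typeLaw hp0 hΔ h (φ := fun u => φ (ENNReal.ofReal u)) (by fun_prop)]
    refine setLIntegral_congr_fun measurableSet_Ioi fun u hu => ?_
    have hu' : 0 ≤ u := le_of_lt hu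
    rw [h.typeDensity_eq hp0 hΔ hu', h.eq_cumTail hp0 hΔ hν hu', h.lamDeriv_eq_rate hp0 hΔ hν hu']
    rfl
  ext s hs
  -- The test functions vanish at `∞`, so `∞` is removed from `s` and put back as a null set of both
  -- measures.
  have h1 := key ((s \ {∞}).indicator 1)
    (measurable_one.indicator (hs.diff (measurableSet_singleton _))) (by simp)
  rw [lintegral_indicator_one (hs.diff (measurableSet_singleton _)),
    lintegral_indicator_one (hs.diff (measurableSet_singleton _))] at h1
  have h2 : (typeLaw lam).map ENNReal.ofReal {∞} = 0 := by
    rw [Measure.map_apply ENNReal.measurable_ofReal (measurableSet_singleton _)]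
    have : ENNReal.ofReal ⁻¹' {∞} = ∅ := by ext; simp
    rw [this, measure_empty]
  rwa [measure_sdiff_null h2, measure_sdiff_null (hν.measure_top hp0 hΔ)] at h1

theorem IsLambda.isProbabilityMeasure_typeLaw (hp0 : p 0 = 0) (hΔ : ∀ k, Δ < k → p k = 0)
    (h : IsLambda p Δ lam) (hν : HasEarlyLaw p Δ ν) : IsProbabilityMeasure (typeLaw lam) := by
  have h1 : IsProbabilityMeasure ((typeLaw lam).map ENNReal.ofReal) := by
    rw [h.map_typeLaw hp0 hΔ hν]; infer_instance
  constructor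
  have := h1.measure_univ
  rwa [Measure.map_apply ENNReal.measurable_ofReal MeasurableSet.univ, preimage_univ] at this

/-- `λ'` is the tail of the law with density `f`. -/
theorem IsLambda.lintegral_Ioi_typeDensity (hp0 : p 0 = 0) (hΔ : ∀ k, Δ < k → p k = 0)
    (h : IsLambda p Δ lam) (hν : HasEarlyLaw p Δ ν) {t : ℝ} (ht : 0 ≤ t) :
    ∫⁻ u in Ioi t, ENNReal.ofReal (typeDensity lam u) = ENNReal.ofReal (lamDeriv lam t) := by
  rw [h.lamDeriv_eq_rate hp0 hΔ hν ht, rate_early_id, ofReal_measureReal, ← h.map_typeLaw hp0 hΔ hν,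
    Measure.map_apply ENNReal.measurable_ofReal measurableSet_Ioi]
  have : ENNReal.ofReal ⁻¹' Ioi (ENNReal.ofReal t) = Ioi t := by
    ext u
    simp only [mem_preimage, mem_Ioi]
    constructor
    · intro hu
      by_contra hle
      exact absurd (ENNReal.ofReal_le_ofReal (not_lt.1 hle)) (not_le.2 hu)
    · intro hu
      exact (ENNReal.ofReal_lt_ofReal_iff (ht.trans_lt hu)).2 hu
  rw [this, typeLaw, withDensity_apply _ measurableSet_Ioi,
    Measure.restrict_restrict measurableSet_Ioi, inter_eq_left.2]
  exact fun u hu => ht.trans (le_of_lt hu)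

theorem IsLambda.integral_Ioi_typeDensity (hp0 : p 0 = 0) (hΔ : ∀ k, Δ < k → p k = 0)
    (h : IsLambda p Δ lam) (hν : HasEarlyLaw p Δ ν) {t : ℝ} (ht : 0 ≤ t) :
    ∫ u in Ioi t, typeDensity lam u = lamDeriv lam t := by
  rw [integral_eq_lintegral_of_nonneg_ae (Filter.Eventually.of_forall fun u =>
    h.typeDensity_nonneg hp0 hΔ hν u) (h.measurable_typeDensity hp0 hΔ).aestronglyMeasurable,
    h.lintegral_Ioi_typeDensity hp0 hΔ hν ht,
    ENNReal.toReal_ofReal (h.lamDeriv_pos hp0 hΔ hν ht).le]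

end Densities

/-! ### The kernels of the branching process -/

section BranchingKernels

variable {p : PMF ℕ} {Δ : ℕ} {lam : ℝ → ℝ}

theorem IsLambda.measurable_indicator (h : IsLambda p Δ lam) :
    Measurable ((Ici 0).indicator lam) :=
  measurable_indicator_of_continuousOn h.continuousOn

/-- Nothing is known about `lam` on the negative axis. Where the density is not cut off, `lam`
agrees with its truncation to `[0, ∞)`, which is measurable. -/
theorem IsLambda.measurable_constraintDensity (hΔ : ∀ k, Δ < k → p k = 0)
    (h : IsLambda p Δ lam) : Measurable (Function.uncurry fun (t₀ : ℝ) (k : ℕ) =>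
      if 0 ≤ t₀ ∧ 2 ≤ k then ENNReal.ofReal (z p lam t₀ (k - 1) / ∑' l, z p lam t₀ l) else 0) := by
  refine measurable_from_prod_countable_left fun k => ?_
  have hl := h.measurable_indicator
  have hc : Measurable fun t => closeRate p Δ ((Ici 0).indicator lam t) :=
    continuous_closeRate.measurable.comp hl
  have : (fun t₀ : ℝ => Function.uncurry (fun (t₀ : ℝ) (k : ℕ) => if 0 ≤ t₀ ∧ 2 ≤ k then
      ENNReal.ofReal (z p lam t₀ (k - 1) / ∑' l, z p lam t₀ l) else 0) (t₀, k)) =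
      fun t₀ => if 0 ≤ t₀ ∧ 2 ≤ k then ENNReal.ofReal (z p ((Ici 0).indicator lam) t₀ (k - 1) /
        closeRate p Δ ((Ici 0).indicator lam t₀)) else 0 := by
    ext t
    simp only [Function.uncurry]
    by_cases ht : 0 ≤ t
    · rw [tsum_z hΔ, z, z, indicator_of_mem (by exact ht)]
    · rw [if_neg (by tauto), if_neg (by tauto)]
  rw [this]
  refine Measurable.ite ?_ ?_ measurable_const
  · exact (measurableSet_le measurable_const measurable_id).inter (MeasurableSet.const _)
  · refine ENNReal.measurable_ofReal.comp (Measurable.div ?_ hc)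
    unfold z
    fun_prop

theorem IsLambda.measurable_pairDensity (hp0 : p 0 = 0) (hΔ : ∀ k, Δ < k → p k = 0)
    (h : IsLambda p Δ lam) {_ : ∀ t₀ x, Decidable (x ∈ region t₀)} :
    Measurable (Function.uncurry fun (t₀ : ℝ) (x : ℝ × ℝ) =>
      if x ∈ region t₀ then ENNReal.ofReal (typeDensity lam x.2 / lam t₀) else 0) := by
  have hl := h.measurable_indicator
  have hf := h.measurable_typeDensity hp0 hΔ
  have : (Function.uncurry fun (t₀ : ℝ) (x : ℝ × ℝ) =>
      if x ∈ region t₀ then ENNReal.ofReal (typeDensity lam x.2 / lam t₀) else 0) =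
      fun y => if y.2 ∈ region y.1 then
        ENNReal.ofReal (typeDensity lam y.2.2 / (Ici 0).indicator lam y.1) else 0 := by
    ext y
    simp only [Function.uncurry]
    by_cases hy : y.2 ∈ region y.1
    · rw [if_pos hy, if_pos hy, indicator_of_mem (by exact hy.1.trans hy.2.1)]
    · rw [if_neg hy, if_neg hy]
  rw [this]
  refine Measurable.ite ?_ (by fun_prop) measurable_const
  exact (measurableSet_le measurable_const measurable_snd.fst).inter
    ((measurableSet_le measurable_snd.fst measurable_fst).inter
      (measurableSet_le measurable_snd.fst measurable_snd.snd))

theorem IsLambda.measurable_lastTypeDensity (hp0 : p 0 = 0) (hΔ : ∀ k, Δ < k → p k = 0)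
    (h : IsLambda p Δ lam) : Measurable (Function.uncurry fun (t₀ s : ℝ) => if t₀ < s then
      ENNReal.ofReal (typeDensity lam s / ∫ u in Ioi t₀, typeDensity lam u) else 0) := by
  have hf := h.measurable_typeDensity hp0 hΔ
  have hI : Measurable fun t₀ : ℝ => ∫ u in Ioi t₀, typeDensity lam u := by
    have : (fun t₀ : ℝ => ∫ u in Ioi t₀, typeDensity lam u) =
        fun t₀ => ∫ u, {y : ℝ × ℝ | y.1 < y.2}.indicator (fun y => typeDensity lam y.2) (t₀, u) := by
      ext t₀
      rw [← integral_indicator measurableSet_Ioi]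
      rfl
    rw [this]
    refine StronglyMeasurable.measurable (StronglyMeasurable.integral_prod_right' ?_)
    exact (Measurable.indicator (by fun_prop)
      (measurableSet_lt measurable_fst measurable_snd)).stronglyMeasurable
  exact Measurable.ite (measurableSet_lt measurable_fst measurable_snd)
    ((hf.comp measurable_snd).div (hI.comp measurable_fst)).ennreal_ofReal measurable_const

variable {ν : Measure ℝ≥0∞} [IsProbabilityMeasure ν]

theorem IsLambda.pos (hp0 : p 0 = 0) (hΔ : ∀ k, Δ < k → p k = 0) (h : IsLambda p Δ lam)
    (hν : HasEarlyLaw p Δ ν) {t : ℝ} (ht : 0 < t) : 0 < lam t := by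
  have hm : StrictMonoOn lam (Ici 0) := by
    refine strictMonoOn_of_deriv_pos (convex_Ici 0) h.continuousOn fun x hx => ?_
    rw [interior_Ici] at hx
    have := (h.hasDerivWithinAt hx.le).hasDerivAt (Ici_mem_nhds hx)
    rw [this.deriv]
    exact h.lamDeriv_pos hp0 hΔ hν hx.le
  have := hm (mem_Ici.2 le_rfl) (mem_Ici.2 ht.le) ht
  rwa [h.zero] at this

theorem closeRate_pos (hp0 : p 0 = 0) (hΔ : ∀ k, Δ < k → p k = 0) {x : ℝ} (hx : 0 < x) :
    0 < closeRate p Δ x := by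
  refine mul_pos (Real.exp_pos _) (Finset.sum_pos' (fun k _ => by positivity) ?_)
  by_contra! hcon
  have h1 := sum_toReal hΔ
  rw [Finset.sum_range_succ'] at h1
  have : ∑ k ∈ Finset.range Δ, (p (k + 1)).toReal = 0 := by
    refine Finset.sum_eq_zero fun k hk => ?_
    have h2 := hcon k hk
    have h3 : 0 < x ^ k / k.factorial := by positivity
    exact le_antisymm (nonpos_of_mul_nonpos_right h2 h3) ENNReal.toReal_nonneg
  rw [this, hp0] at h1
  simp at h1

/-- The integral of a function with respect to the law of the degree constraint of a vertex
of type `t`. -/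
theorem IsLambda.lintegral_constraintKernel (hp1 : p 1 = 0)
    (hΔ : ∀ k, Δ < k → p k = 0) (h : IsLambda p Δ lam) {t : ℝ}
    (ht : 0 < t) (φ : ℕ → ℝ≥0∞) :
    ∫⁻ d, φ d ∂constraintKernel p lam t = ∑ k ∈ Finset.range Δ,
      ENNReal.ofReal (z p lam t k / closeRate p Δ (lam t)) * φ (k + 1) := by
  rw [constraintKernel, Kernel.withDensity_apply _ (h.measurable_constraintDensity hΔ),
    lintegral_withDensity_eq_lintegral_mul _ (measurable_of_countable _) (measurable_of_countable _),
    Kernel.const_apply, lintegral_count]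
  have hsum : ∀ k ∉ Finset.image Nat.succ (Finset.range Δ),
      (((fun k => if 0 ≤ t ∧ 2 ≤ k then
        ENNReal.ofReal (z p lam t (k - 1) / ∑' l, z p lam t l) else 0) : ℕ → ℝ≥0∞) * φ) k = 0 := by
    intro k hk
    simp only [Finset.mem_image, Finset.mem_range, not_exists, not_and] at hk
    rw [Pi.mul_apply]
    split_ifs with h2
    · obtain ⟨-, h3⟩ := h2
      have h4 : Δ < k := by
        by_contra h5
        exact hk (k - 1) (by omega) (by simp only [Nat.succ_eq_add_one]; omega)
      rw [z, show k - 1 + 1 = k by omega, hΔ k h4]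
      simp
    · rw [zero_mul]
  rw [tsum_eq_sum hsum, Finset.sum_image fun a _ b _ hab => Nat.succ_injective hab]
  refine Finset.sum_congr rfl fun k _ => ?_
  rw [Pi.mul_apply, tsum_z hΔ, Nat.succ_eq_add_one, Nat.add_sub_cancel]
  congr 1
  -- For `k = 0` the density is cut off by the condition `2 ≤ k + 1`; the corresponding summand also
  -- vanishes, since `p 1 = 0`.
  rcases Nat.eq_zero_or_pos k with rfl | hk
  · rw [if_neg (by omega), z]
    simp [hp1]
  · rw [if_pos ⟨ht.le, by omega⟩]

theorem IsLambda.isProbabilityMeasure_constraintKernel (hp0 : p 0 = 0) (hp1 : p 1 = 0)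
    (hΔ : ∀ k, Δ < k → p k = 0) (h : IsLambda p Δ lam) (hν : HasEarlyLaw p Δ ν) {t : ℝ}
    (ht : 0 < t) : IsProbabilityMeasure (constraintKernel p lam t) := by
  constructor
  have h1 := h.lintegral_constraintKernel hp1 hΔ ht 1
  have hl := h.pos hp0 hΔ hν ht
  have hc := closeRate_pos hp0 hΔ hl
  simp only [Pi.one_apply, lintegral_const, one_mul, mul_one] at h1
  rw [h1, ← ENNReal.ofReal_sum_of_nonneg fun k _ => by unfold z; positivity, ← Finset.sum_div]
  have : ∑ k ∈ Finset.range Δ, z p lam t k = closeRate p Δ (lam t) := by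
    simp_rw [closeRate, z, Finset.mul_sum, mul_assoc]
  rw [this, div_self hc.ne', ENNReal.ofReal_one]

/-- The normalising integral is the tail `λ'(t)`. The formula is stated multiplied by it because
this factor is what the density of the root's saturation time supplies. -/
theorem IsLambda.lintegral_lastTypeKernel (hp0 : p 0 = 0)
    (hΔ : ∀ k, Δ < k → p k = 0) (h : IsLambda p Δ lam) (hν : HasEarlyLaw p Δ ν) {t : ℝ}
    (ht : 0 < t) {φ : ℝ → ℝ≥0∞} (hφ : Measurable φ) :
    ENNReal.ofReal (lamDeriv lam t) * ∫⁻ s, φ s ∂lastTypeKernel lam t =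
      ∫⁻ s in Ioi t, ENNReal.ofReal (typeDensity lam s) * φ s := by
  have hm := h.measurable_lastTypeDensity hp0 hΔ
  have hpos := h.lamDeriv_pos hp0 hΔ hν ht.le
  have hm' := h.measurable_typeDensity hp0 hΔ
  rw [lastTypeKernel, Kernel.lintegral_withDensity _ hm t hφ, Kernel.const_apply,
    ← lintegral_const_mul' _ _ ENNReal.ofReal_ne_top,
    ← lintegral_indicator measurableSet_Ioi]
  refine lintegral_congr fun s => ?_
  rw [h.integral_Ioi_typeDensity hp0 hΔ hν ht.le]
  by_cases hs : t < s
  · rw [if_pos hs, indicator_of_mem (by exact hs), ← mul_assoc, ← ENNReal.ofReal_mul hpos.le,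
      mul_div_cancel₀ _ hpos.ne']
  · rw [if_neg hs, indicator_of_notMem (by exact hs), zero_mul, mul_zero]

theorem IsLambda.isProbabilityMeasure_lastTypeKernel (hp0 : p 0 = 0)
    (hΔ : ∀ k, Δ < k → p k = 0) (h : IsLambda p Δ lam) (hν : HasEarlyLaw p Δ ν) {t : ℝ}
    (ht : 0 < t) : IsProbabilityMeasure (lastTypeKernel lam t) := by
  constructor
  have h1 := h.lintegral_lastTypeKernel hp0 hΔ hν ht (φ := 1) measurable_one
  have hpos := h.lamDeriv_pos hp0 hΔ hν ht.le
  simp only [Pi.one_apply, lintegral_const, one_mul, mul_one] at h1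
  rw [h.lintegral_Ioi_typeDensity hp0 hΔ hν ht.le] at h1
  exact (ENNReal.mul_eq_left (by simpa using hpos) ENNReal.ofReal_ne_top).1 h1

theorem IsLambda.lintegral_pairKernel (hp0 : p 0 = 0)
    (hΔ : ∀ k, Δ < k → p k = 0) (h : IsLambda p Δ lam) (hν : HasEarlyLaw p Δ ν) {t₀ : ℝ}
    (ht : 0 < t₀) {φ : ℝ × ℝ → ℝ≥0∞} (hφ : Measurable φ) :
    ENNReal.ofReal (lam t₀) * ∫⁻ x, φ x ∂pairKernel lam t₀ =
      ∫⁻ t in Ioo 0 t₀, ∫⁻ s in Ioi t, ENNReal.ofReal (typeDensity lam s) * φ (t, s) := by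
  classical
  have hm' := h.measurable_typeDensity hp0 hΔ
  have hpos := h.pos hp0 hΔ hν ht
  have hm : Measurable (Function.uncurry fun (t₀ : ℝ) (x : ℝ × ℝ) =>
      if x ∈ region t₀ then ENNReal.ofReal (typeDensity lam x.2 / lam t₀) else 0) :=
    h.measurable_pairDensity hp0 hΔ
  rw [pairKernel, Kernel.lintegral_withDensity _ hm t₀ hφ, Kernel.const_apply,
    ← lintegral_const_mul' _ _ ENNReal.ofReal_ne_top]
  have h1 : ∀ x : ℝ × ℝ, ENNReal.ofReal (lam t₀) * ((if x ∈ region t₀ then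
      ENNReal.ofReal (typeDensity lam x.2 / lam t₀) else 0) * φ x) =
      (region t₀).indicator (fun x => ENNReal.ofReal (typeDensity lam x.2) * φ x) x := by
    intro x
    by_cases hx : x ∈ region t₀
    · rw [if_pos hx, indicator_of_mem hx, ← mul_assoc, ← ENNReal.ofReal_mul hpos.le,
        mul_div_cancel₀ _ hpos.ne']
    · rw [if_neg hx, indicator_of_notMem hx, zero_mul, mul_zero]
  have hreg : MeasurableSet (region t₀) :=
    (measurableSet_le measurable_const measurable_fst).inter
      ((measurableSet_le measurable_fst measurable_const).inter
        (measurableSet_le measurable_fst measurable_snd))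
  simp_rw [h1]
  rw [Measure.volume_eq_prod, lintegral_prod _ (Measurable.indicator (by fun_prop) hreg).aemeasurable,
    setLIntegral_congr Ioo_ae_eq_Icc, ← lintegral_indicator measurableSet_Icc]
  refine lintegral_congr fun t => ?_
  by_cases hx : t ∈ Icc 0 t₀
  · rw [indicator_of_mem hx, setLIntegral_congr Ioi_ae_eq_Ici, ← lintegral_indicator measurableSet_Ici]
    refine lintegral_congr fun s => ?_
    by_cases hs : t ≤ s
    · rw [indicator_of_mem (by exact ⟨hx.1, hx.2, hs⟩), indicator_of_mem (by exact hs)]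
    · rw [indicator_of_notMem (fun hc => hs hc.2.2), indicator_of_notMem (by exact hs)]
  · rw [indicator_of_notMem hx]
    refine (lintegral_congr fun s => indicator_of_notMem ?_ _).trans lintegral_zero
    exact fun hc => hx ⟨hc.1, hc.2.1⟩

/-- The law of the (type, degree constraint) pair of a vertex whose type has density `f`. -/
def typeConstraintLaw (p : PMF ℕ) (lam : ℝ → ℝ) : Measure (ℝ × ℕ) :=
  typeLaw lam ⊗ₘ completed (constraintKernel p lam) 0

theorem completed_apply {α β : Type*} [MeasurableSpace α] [MeasurableSpace β] (κ : Kernel α β)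
    (b : β) {a : α} (ha : IsProbabilityMeasure (κ a)) : completed κ b a = κ a := by
  classical
  rw [completed, Kernel.piecewise_apply]
  exact if_pos ha.measure_univ

instance : SFinite (typeLaw lam) := by unfold typeLaw; infer_instance

theorem IsLambda.lintegral_typeConstraintLaw (hp0 : p 0 = 0)
    (hΔ : ∀ k, Δ < k → p k = 0) (h : IsLambda p Δ lam)
    {φ : ℝ × ℕ → ℝ≥0∞} (hφ : Measurable φ) :
    ∫⁻ m, φ m ∂typeConstraintLaw p lam = ∫⁻ s in Ioi 0, ENNReal.ofReal (typeDensity lam s) *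
      ∫⁻ d, φ (s, d) ∂completed (constraintKernel p lam) 0 s := by
  rw [typeConstraintLaw, Measure.lintegral_compProd hφ, lintegral_typeLaw hp0 hΔ h
    (φ := fun s => ∫⁻ d, φ (s, d) ∂completed (constraintKernel p lam) 0 s)]
  exact Measurable.lintegral_kernel_prod_right' hφ

/-- The law of the (type, degree constraint) pair of a vertex in terms of the degree. -/
theorem IsLambda.lintegral_typeConstraintLaw_eq_sum (hp0 : p 0 = 0) (hp1 : p 1 = 0)
    (hΔ : ∀ k, Δ < k → p k = 0) (h : IsLambda p Δ lam) (hν : HasEarlyLaw p Δ ν)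
    {φ : ℝ × ℕ → ℝ≥0∞} (hφ : Measurable φ) :
    ∫⁻ m, φ m ∂typeConstraintLaw p lam = ∑ k ∈ Finset.range Δ, p (k + 1) * ∫⁻ s in Ioi 0,
      ENNReal.ofReal (Real.exp (-lam s) * (lam s ^ k / k.factorial) * lamDeriv lam s) *
        φ (s, k + 1) := by
  rw [h.lintegral_typeConstraintLaw hp0 hΔ hφ]
  have hm := measurable_indicator_of_continuousOn h.continuousOn_lamDeriv
  have hl := h.measurable_indicator
  have h1 : ∀ k : ℕ, p (k + 1) * ∫⁻ s in Ioi 0,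
      ENNReal.ofReal (Real.exp (-lam s) * (lam s ^ k / k.factorial) * lamDeriv lam s) *
        φ (s, k + 1) = ∫⁻ s in Ioi 0, p (k + 1) * (ENNReal.ofReal (Real.exp (-(Ici 0).indicator lam s) *
          ((Ici 0).indicator lam s ^ k / k.factorial) * (Ici 0).indicator (lamDeriv lam) s) *
        φ (s, k + 1)) := by
    intro k
    rw [lintegral_const_mul _ (by fun_prop)]
    congr 1
    refine setLIntegral_congr_fun measurableSet_Ioi fun s hs => ?_
    have hs' : s ∈ Ici (0 : ℝ) := mem_Ici.2 (le_of_lt hs)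
    simp only [indicator_of_mem hs']
  simp_rw [h1]
  rw [← lintegral_finsetSum _ fun k _ => by fun_prop]
  refine setLIntegral_congr_fun measurableSet_Ioi fun s hs => ?_
  have hs' : s ∈ Ici (0 : ℝ) := mem_Ici.2 (le_of_lt hs)
  have hc := closeRate_pos hp0 hΔ (h.pos hp0 hΔ hν hs)
  have h0 := h.pos hp0 hΔ hν hs
  have hd := h.lamDeriv_pos hp0 hΔ hν hs'
  simp only [indicator_of_mem hs']
  rw [completed_apply _ _ (h.isProbabilityMeasure_constraintKernel hp0 hp1 hΔ hν hs),
    h.lintegral_constraintKernel hp1 hΔ hs, Finset.mul_sum]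
  -- As `f = closeRate(λ) λ'`, the normalisation of the degree constraint cancels against `f`, and
  -- `p (k + 1)` splits off from `z`.
  refine Finset.sum_congr rfl fun k _ => ?_
  rw [← mul_assoc, ← mul_assoc, h.typeDensity_eq hp0 hΔ hs']
  congr 1
  rw [← ENNReal.ofReal_toReal (p.apply_ne_top (k + 1)), ← ENNReal.ofReal_mul (by positivity),
    ← ENNReal.ofReal_mul ENNReal.toReal_nonneg]
  congr 1
  rw [z]
  field_simp

theorem IsLambda.lintegral_typeConstraintLaw_indicator (hp0 : p 0 = 0)
    (hΔ : ∀ k, Δ < k → p k = 0) (h : IsLambda p Δ lam) {t : ℝ} (ht : 0 ≤ t)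
    {φ : ℝ × ℕ → ℝ≥0∞} (hφ : Measurable φ) :
    ∫⁻ m, (if t < m.1 then φ m else 0) ∂typeConstraintLaw p lam =
      ∫⁻ s in Ioi t, ENNReal.ofReal (typeDensity lam s) *
      ∫⁻ d, φ (s, d) ∂completed (constraintKernel p lam) 0 s := by
  have hset : MeasurableSet {m : ℝ × ℕ | t < m.1} := measurableSet_lt measurable_const measurable_fst
  rw [h.lintegral_typeConstraintLaw hp0 hΔ (Measurable.ite hset hφ measurable_const),
    ← lintegral_indicator measurableSet_Ioi, ← lintegral_indicator measurableSet_Ioi]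
  refine lintegral_congr fun s => ?_
  by_cases hs : t < s
  · rw [indicator_of_mem (by exact ht.trans_lt hs), indicator_of_mem (by exact hs)]
    simp only [hs, if_true]
  · rw [indicator_of_notMem (s := Ioi t) (by exact hs), indicator_apply]
    split_ifs <;> simp

/-- The mass of `f` on the region is the integral over `t ∈ (0, t₀)` of the tail `λ'(t)`, that is,
`λ(t₀)`. -/
theorem IsLambda.isProbabilityMeasure_pairKernel (hp0 : p 0 = 0)
    (hΔ : ∀ k, Δ < k → p k = 0) (h : IsLambda p Δ lam) (hν : HasEarlyLaw p Δ ν) {t₀ : ℝ}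
    (ht : 0 < t₀) : IsProbabilityMeasure (pairKernel lam t₀) := by
  constructor
  have h1 := h.lintegral_pairKernel hp0 hΔ hν ht (φ := 1) measurable_one
  have hpos := h.pos hp0 hΔ hν ht
  simp only [Pi.one_apply, lintegral_const, one_mul, mul_one] at h1
  have h2 : ∫⁻ t in Ioo 0 t₀, ∫⁻ s in Ioi t, ENNReal.ofReal (typeDensity lam s) =
      ENNReal.ofReal (lam t₀) := by
    rw [setLIntegral_congr_fun measurableSet_Ioo fun t ht =>
      h.lintegral_Ioi_typeDensity hp0 hΔ hν (le_of_lt ht.1), setLIntegral_congr Ioo_ae_eq_Ioc]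
    have hint : IntervalIntegrable (lamDeriv lam) volume 0 t₀ :=
      (h.continuousOn_lamDeriv.mono (by
        rw [uIcc_of_le ht.le]; exact Icc_subset_Ici_self)).intervalIntegrable
    rw [← ofReal_integral_eq_lintegral_ofReal hint.1
      ((ae_restrict_mem measurableSet_Ioc).mono fun t ht =>
        (h.lamDeriv_pos hp0 hΔ hν ht.1.le).le), ← intervalIntegral.integral_of_le ht.le,
      intervalIntegral.integral_eq_sub_of_hasDerivAt_of_le ht.le
        (h.continuousOn.mono Icc_subset_Ici_self)
        (fun x hx => (h.hasDerivWithinAt hx.1.le).hasDerivAt (Ici_mem_nhds hx.1)) hint,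
      h.zero, sub_zero]
  rw [h2] at h1
  exact (ENNReal.mul_eq_left (by simpa using hpos) ENNReal.ofReal_ne_top).1 h1

/-- In unnormalised form a child is a Lebesgue-distributed label `t < t₀` with an independent (type,
constraint) pair, kept if the type exceeds `t`. This is the shape in which available children of the
PWIT occur. -/
theorem IsLambda.lintegral_childKernel (hp0 : p 0 = 0)
    (hΔ : ∀ k, Δ < k → p k = 0) (h : IsLambda p Δ lam) (hν : HasEarlyLaw p Δ ν) {t₀ : ℝ}
    (ht : 0 < t₀) {φ : Mark → ℝ≥0∞} (hφ : Measurable φ) :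
    ENNReal.ofReal (lam t₀) * ∫⁻ m, φ m ∂childKernel p lam t₀ =
      ∫⁻ t in Ioo 0 t₀, ∫⁻ m, (if t < m.1 then φ (t, m) else 0) ∂typeConstraintLaw p lam := by
  have hP := h.isProbabilityMeasure_pairKernel hp0 hΔ hν ht
  rw [childKernel, Kernel.map_apply _ (by fun_prop), lintegral_map hφ (by fun_prop),
    Kernel.lintegral_compProd _ _ _ (by fun_prop), completed_apply _ _ hP]
  simp only [Kernel.comap_apply]
  rw [h.lintegral_pairKernel hp0 hΔ hν ht (φ := fun x => ∫⁻ d, φ (x.1, x.2, d)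
    ∂completed (constraintKernel p lam) 0 x.2)]
  · refine setLIntegral_congr_fun measurableSet_Ioo fun t ht => ?_
    exact (h.lintegral_typeConstraintLaw_indicator hp0 hΔ ht.1.le (φ := fun m => φ (t, m))
      (by fun_prop)).symm
  · exact Measurable.lintegral_kernel_prod_right' (κ := (completed (constraintKernel p lam) 0).comap
      (fun x : ℝ × ℝ => x.2) (by fun_prop)) (f := fun y : (ℝ × ℝ) × ℕ => φ (y.1.1, y.1.2, y.2))
      (by fun_prop)

/-- The last child is a typical vertex conditioned on its type exceeding `t₀`, an event of
probability `λ'(t₀)`. -/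
theorem IsLambda.lintegral_lastChildKernel (hp0 : p 0 = 0)
    (hΔ : ∀ k, Δ < k → p k = 0) (h : IsLambda p Δ lam) (hν : HasEarlyLaw p Δ ν) {t₀ : ℝ}
    (ht : 0 < t₀) {φ : Mark → ℝ≥0∞} (hφ : Measurable φ) :
    ENNReal.ofReal (lamDeriv lam t₀) * ∫⁻ m, φ m ∂lastChildKernel p lam t₀ =
      ∫⁻ m, (if t₀ < m.1 then φ (t₀, m) else 0) ∂typeConstraintLaw p lam := by
  have hP := h.isProbabilityMeasure_lastTypeKernel hp0 hΔ hν ht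
  rw [lastChildKernel, Kernel.prod_apply, Kernel.id_apply, lintegral_prod _ hφ.aemeasurable,
    lintegral_dirac' _ (Measurable.lintegral_prod_right' hφ),
    Kernel.lintegral_compProd _ _ _ (by fun_prop), completed_apply _ _ hP]
  simp only [Kernel.comap_apply]
  rw [h.lintegral_lastTypeKernel hp0 hΔ hν ht (φ := fun s => ∫⁻ d, φ (t₀, s, d)
    ∂completed (constraintKernel p lam) 0 s)]
  · exact (h.lintegral_typeConstraintLaw_indicator hp0 hΔ ht.le (φ := fun m => φ (t₀, m))
      (by fun_prop)).symm
  · exact Measurable.lintegral_kernel_prod_right' (f := fun y : ℝ × ℕ => φ (t₀, y.1, y.2))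
      (by fun_prop)

end BranchingKernels

/-! ### The branching structure of the PWIT -/

theorem measurableSet_forall {α ι : Type*} [MeasurableSpace α] [Countable ι] {q : ι → α → Prop}
    (h : ∀ i, MeasurableSet {x | q i x}) : MeasurableSet {x | ∀ i, q i x} := by
  rw [show {x | ∀ i, q i x} = ⋂ i, {x | q i x} by ext; simp]
  exact MeasurableSet.iInter h

theorem map_infinitePi_option {ι X : Type*} [MeasurableSpace X] (V : Measure X)
    [IsProbabilityMeasure V] :
    (Measure.infinitePi fun _ : Option ι => V).map (fun x => (x none, fun i => x (some i))) =
      V.prod (Measure.infinitePi fun _ : ι => V) := by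
  classical
  have hm : Measurable fun (y : X × (ι → X)) (o : Option ι) => o.elim y.1 y.2 := by
    refine measurable_pi_lambda _ fun o => ?_
    cases o with
    | none => exact measurable_fst
    | some i => exact (measurable_pi_apply i).comp measurable_snd
  have h : (V.prod (Measure.infinitePi fun _ : ι => V)).map
      (fun (y : X × (ι → X)) (o : Option ι) => o.elim y.1 y.2) =
      Measure.infinitePi fun _ : Option ι => V := by
    refine Measure.eq_infinitePi _ fun s t ht => ?_
    rw [Measure.map_apply hm (MeasurableSet.pi s.countable_toSet fun i _ => ht i)]
    have hpre : (fun (y : X × (ι → X)) (o : Option ι) => o.elim y.1 y.2) ⁻¹' (Set.pi s t) =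
        (if none ∈ s then t none else univ) ×ˢ
          (Set.pi (Finset.eraseNone s) fun i => t (some i)) := by
      ext ⟨a, x⟩
      simp only [mem_preimage, mem_pi, Option.forall, mem_prod, Finset.mem_coe,
        Finset.mem_eraseNone, Option.elim]
      split_ifs with hn <;> simp [hn]
    rw [hpre, Measure.prod_prod, Measure.infinitePi_pi _ fun i _ => ht _]
    have h2 : ∏ i ∈ Finset.eraseNone s, V (t (some i)) = ∏ o ∈ s.erase none, V (t o) := by
      rw [← Finset.map_some_eraseNone, Finset.prod_map]
      rfl
    rw [h2]
    split_ifs with hn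
    · rw [Finset.mul_prod_erase s (fun o => V (t o)) hn]
    · rw [measure_univ, one_mul, Finset.erase_eq_of_notMem hn]
  rw [← h, Measure.map_map (by fun_prop) hm]
  exact Measure.map_id

instance (p : PMF ℕ) : IsProbabilityMeasure (pwitLaw p) := by unfold pwitLaw; infer_instance

@[fun_prop]
theorem measurable_subtree (i : List ℕ) : Measurable fun ω : Env => subtree ω i :=
  measurable_pi_lambda _ fun _ => measurable_pi_apply _

theorem subtree_subtree (ω : Env) (i j : List ℕ) : subtree (subtree ω i) j = subtree ω (j ++ i) := by
  funext l; simp [subtree]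

@[simp] theorem subtree_nil (ω : Env) : subtree ω [] = ω := by
  funext l; simp [subtree]

theorem measurePreserving_subtree (p : PMF ℕ) (i : List ℕ) :
    MeasurePreserving (fun ω => subtree ω i) (pwitLaw p) (pwitLaw p) :=
  ⟨measurable_subtree i, Measure.map_infinitePi_infinitePi_of_inj
    (P := fun _ : List ℕ => pppLaw.prod p.toMeasure) (List.append_left_injective i)⟩

/-- The data at the root and the subtrees of the children of the root are independent. -/
theorem map_root_subtree (p : PMF ℕ) :
    (pwitLaw p).map (fun ω => (ω [], fun j => subtree ω [j])) =
      (pppLaw.prod p.toMeasure).prod (Measure.infinitePi fun _ : ℕ => pwitLaw p) := by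
  set V := pppLaw.prod p.toMeasure
  -- The root is `none`, and the vertex `l` of the subtree at child `j` is the pair `(j, l)`.
  -- Strings are stored in reverse, so `j` is the last entry.
  let e : Option (ℕ × List ℕ) → List ℕ := fun o => o.elim [] fun y => y.2 ++ [y.1]
  have he : Function.Injective e := by
    rintro (_ | ⟨a, l⟩) (_ | ⟨b, m⟩) h
    · rfl
    · simp [e] at h
    · simp [e] at h
    · obtain ⟨h1, h2⟩ := List.append_inj' h rfl
      simp only [List.cons.injEq, and_true] at h2
      subst h2
      rw [show l = m from h1]
  have h1 : (pwitLaw p).map (fun ω o => ω (e o)) = Measure.infinitePi fun _ => V :=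
    Measure.map_infinitePi_infinitePi_of_inj (P := fun _ : List ℕ => V) he
  have h2 := congrArg (Measure.map fun x : Option (ℕ × List ℕ) → (ℕ → ℝ) × ℕ =>
    (x none, fun i => x (some i))) h1
  rw [map_infinitePi_option, Measure.map_map (by fun_prop) (by fun_prop)] at h2
  have h3 := Measure.infinitePi_map_curry (fun (_ : ℕ) (_ : List ℕ) => V)
  have h4 := congrArg (Measure.map (Prod.map id (MeasurableEquiv.curry ℕ (List ℕ) _))) h2
  rw [← Measure.map_prod_map _ _ measurable_id (by fun_prop), h3, Measure.map_id,
    Measure.map_map (by fun_prop) (by fun_prop)] at h4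
  exact h4

theorem lintegral_pwitLaw (p : PMF ℕ) {F : ((ℕ → ℝ) × ℕ) × (ℕ → Env) → ℝ≥0∞}
    (hF : Measurable F) :
    ∫⁻ ω, F (ω [], fun j => subtree ω [j]) ∂pwitLaw p =
      ∫⁻ y, F y ∂(pppLaw.prod p.toMeasure).prod (Measure.infinitePi fun _ : ℕ => pwitLaw p) := by
  rw [← map_root_subtree, lintegral_map hF (by fun_prop)]

/-- The labels at the root and the subtrees of the children in terms of the waiting times. -/
theorem lintegral_pwitLaw_labels (p : PMF ℕ) {F : (ℕ → ℝ) × (ℕ → Env) → ℝ≥0∞}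
    (hF : Measurable F) :
    ∫⁻ ω, F ((ω []).1, fun j => subtree ω [j]) ∂pwitLaw p =
      ∫⁻ ξ, F (fun j => (points 0 ξ j).1, fun j => (points 0 ξ j).2) ∂waitLaw (pwitLaw p) := by
  rw [lintegral_pwitLaw p (F := fun y => F (y.1.1, y.2)) (by fun_prop),
    ← lintegral_pppLaw_prod _ hF, lintegral_prod_prod_comm (by fun_prop)]
  simp

section Campbell

variable {E : Type*} [MeasurableSpace E] {P : Measure E} [IsProbabilityMeasure P]

/-- Campbell's formula for a Poisson process with independent marks. -/
theorem tsum_lintegral_points {Φ : ℝ × E → ℝ≥0∞} (hΦ : Measurable Φ) :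
    ∑' n, ∫⁻ ξ, Φ (points 0 ξ n) ∂waitLaw P = ∫⁻ t in Ioi 0, ∫⁻ e, Φ (t, e) ∂P := by
  have h1 : ∀ n, ∫⁻ ξ, Φ (points 0 ξ n) ∂waitLaw P = ∫⁻ t in Ioi 0,
      ENNReal.ofReal (Real.exp (-t) * (t ^ n / n.factorial)) * ∫⁻ e, Φ (t, e) ∂P := by
    intro n
    have := lintegral_forall_lt_mem (P := P) (B := univ) MeasurableSet.univ
      (by simpa using monotone_const) (Φ := fun x _ => Φ x) (by
        exact hΦ.comp measurable_fst) n 0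
    simp only [mem_univ, implies_true, if_true, lintegral_const, measure_univ, mul_one] at this
    rw [this]
    refine setLIntegral_congr_fun measurableSet_Ioi fun t ht => ?_
    simp only [sub_zero, ofPred_true, probReal_univ, intervalIntegral.integral_const, smul_eq_mul,
      mul_one]
    rw [← mul_assoc, ← ENNReal.ofReal_mul (Real.exp_nonneg _)]
  simp_rw [h1]
  have hm : Measurable fun t => ∫⁻ e, Φ (t, e) ∂P := hΦ.lintegral_prod_right'
  rw [← lintegral_tsum fun n => by fun_prop]
  refine setLIntegral_congr_fun measurableSet_Ioi fun t ht => ?_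
  have ht' : (0 : ℝ) < t := ht
  have h2 : HasSum (fun n : ℕ => Real.exp (-t) * (t ^ n / n.factorial)) 1 := by
    have := (NormedSpace.expSeries_div_hasSum_exp t).mul_left (Real.exp (-t))
    rwa [← Real.exp_eq_exp_ℝ, ← Real.exp_add, neg_add_cancel, Real.exp_zero] at this
  rw [ENNReal.tsum_mul_right, ← ENNReal.ofReal_tsum_of_nonneg (fun n => by positivity) h2.summable,
    h2.tsum_eq, ENNReal.ofReal_one, one_mul]

end Campbell

/-! ### Almost sure properties of labels and constraints -/

section AlmostSure

variable {p : PMF ℕ}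

theorem tsum_lintegral_child {Φ : ℝ × Env → ℝ≥0∞} (hΦ : Measurable Φ) :
    ∑' n, ∫⁻ ω, Φ ((ω []).1 n, subtree ω [n]) ∂pwitLaw p =
      ∫⁻ t in Ioi 0, ∫⁻ ω, Φ (t, ω) ∂pwitLaw p := by
  rw [← tsum_lintegral_points hΦ]
  refine tsum_congr fun n => ?_
  exact lintegral_pwitLaw_labels p (F := fun y => Φ (y.1 n, y.2 n)) (by fun_prop)

/-- By Campbell's formula the expected number of children violating `Q` is the mass of the
complement of `Q` under Lebesgue measure times `pwitLaw p`, which is zero. -/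
theorem ae_child {Q : ℝ × Env → Prop} (hQ : MeasurableSet {x | Q x})
    (h : ∀ᵐ x ∂(volume.restrict (Ioi 0)).prod (pwitLaw p), Q x) :
    ∀ᵐ ω ∂pwitLaw p, ∀ n, Q ((ω []).1 n, subtree ω [n]) := by
  have hm : Measurable (({x | Q x}ᶜ).indicator (1 : ℝ × Env → ℝ≥0∞)) :=
    measurable_one.indicator hQ.compl
  have h1 := tsum_lintegral_child (p := p) hm
  rw [← lintegral_prod _ hm.aemeasurable, lintegral_indicator_one hQ.compl,
    show ((volume.restrict (Ioi 0)).prod (pwitLaw p)) {x | Q x}ᶜ = 0 from ae_iff.1 h,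
    ENNReal.tsum_eq_zero] at h1
  refine ae_all_iff.2 fun n => ?_
  have h2 := (lintegral_eq_zero_iff (hm.comp (by fun_prop))).1 (h1 n)
  filter_upwards [h2] with ω hω
  by_contra hc
  simp [indicator_of_mem (show ((ω []).1 n, subtree ω [n]) ∈ {x | Q x}ᶜ from hc)] at hω

theorem ae_forall_subtree {Q : Env → Prop} (h : ∀ᵐ ω ∂pwitLaw p, Q ω) :
    ∀ᵐ ω ∂pwitLaw p, ∀ i, Q (subtree ω i) :=
  ae_all_iff.2 fun i => (measurePreserving_subtree p i).quasiMeasurePreserving.ae h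

theorem ae_root {Q : (ℕ → ℝ) × ℕ → Prop} (h : ∀ᵐ a ∂pppLaw.prod p.toMeasure, Q a) :
    ∀ᵐ ω ∂pwitLaw p, ∀ i, Q (ω i) :=
  ae_all_iff.2 fun i => (measurePreserving_eval_infinitePi
    (fun _ : List ℕ => pppLaw.prod p.toMeasure) i).quasiMeasurePreserving.ae h

theorem ae_pppLaw : ∀ᵐ τ ∂pppLaw, StrictMono τ ∧ 0 < τ 0 := by
  have hm : Measurable fun (g : ℕ → ℝ) (j : ℕ) => ∑ k ∈ Finset.range (j + 1), g k := by fun_prop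
  have h0 : ∀ᵐ x ∂expMeasure 1, 0 < x := by
    have := lintegral_expMeasure_one_add 0 (φ := (Iic 0).indicator 1)
      (measurable_one.indicator measurableSet_Iic)
    simp only [zero_add] at this
    rw [lintegral_indicator_one measurableSet_Iic] at this
    rw [ae_iff]
    simp only [not_lt]
    refine this.trans ?_
    rw [setLIntegral_congr_fun (g := 0) measurableSet_Ioi fun t ht => ?_]
    · simp
    · rw [indicator_of_notMem (show t ∉ Iic (0 : ℝ) from fun hc => not_lt.2 (mem_Iic.1 hc) (mem_Ioi.1 ht)),
        mul_zero]
      rfl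
  have h1 : ∀ᵐ g ∂Measure.infinitePi fun _ : ℕ => expMeasure 1, ∀ n, 0 < g n :=
    ae_all_iff.2 fun n => (measurePreserving_eval_infinitePi
      (fun _ : ℕ => expMeasure 1) n).quasiMeasurePreserving.ae h0
  have hset : MeasurableSet {τ : ℕ → ℝ | StrictMono τ ∧ 0 < τ 0} := by
    have : {τ : ℕ → ℝ | StrictMono τ ∧ 0 < τ 0} = {τ | (∀ n, τ n < τ (n + 1)) ∧ 0 < τ 0} := by
      ext τ
      exact and_congr_left fun _ => ⟨fun h n => h (Nat.lt_succ_self n), strictMono_nat_of_lt_succ⟩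
    rw [this]
    exact (measurableSet_forall fun n => measurableSet_lt (by fun_prop) (by fun_prop)).inter
      (measurableSet_lt measurable_const (measurable_pi_apply 0))
  rw [pppLaw, ae_map_iff hm.aemeasurable hset]
  filter_upwards [h1] with g hg
  refine ⟨strictMono_nat_of_lt_succ fun n => ?_, by simpa using hg 0⟩
  rw [Finset.sum_range_succ _ (n + 1)]
  exact lt_add_of_pos_right _ (hg _)

theorem ae_labels : ∀ᵐ ω ∂pwitLaw p, ∀ i, StrictMono (ω i).1 ∧ 0 < (ω i).1 0 :=
  ae_root (Measure.quasiMeasurePreserving_fst.ae ae_pppLaw)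

theorem ae_two_le_constraint (hp0 : p 0 = 0) (hp1 : p 1 = 0) :
    ∀ᵐ ω ∂pwitLaw p, ∀ i, 2 ≤ (ω i).2 := by
  refine ae_root (Q := fun a => 2 ≤ a.2) (Measure.quasiMeasurePreserving_snd.ae (p := fun d => 2 ≤ d) ?_)
  rw [ae_iff, PMF.toMeasure_apply_eq_zero_iff _ (MeasurableSet.of_discrete),
    Set.disjoint_left]
  intro d hd hd'
  have : d = 0 ∨ d = 1 := by simp only [mem_ofPred_eq] at hd'; omega
  rcases this with rfl | rfl
  · exact (p.mem_support_iff _).1 hd hp0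
  · exact (p.mem_support_iff _).1 hd hp1

/-- Given the subtree, the labels at its root form a countable set, hence a Lebesgue null set for
the label above it. -/
theorem ae_label_ne_label_child :
    ∀ᵐ ω ∂pwitLaw p, ∀ i k j, (ω i).1 k ≠ (ω (k :: i)).1 j := by
  have hset : MeasurableSet {x : ℝ × Env | ∀ j, x.1 ≠ (x.2 []).1 j} :=
    measurableSet_forall fun j => (measurableSet_eq_fun (by fun_prop) (by fun_prop)).compl
  have h1 : ∀ᵐ ω ∂pwitLaw p, ∀ k j, (ω []).1 k ≠ (subtree ω [k] []).1 j := by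
    refine ae_child (Q := fun x => ∀ j, x.1 ≠ (x.2 []).1 j) hset ?_
    rw [ae_iff, ← Measure.prod_swap]
    change Measure.map Prod.swap _ {x : ℝ × Env | ∀ j, x.1 ≠ (x.2 []).1 j}ᶜ = 0
    rw [Measure.map_apply measurable_swap hset.compl,
      Measure.measure_prod_null (measurable_swap hset.compl)]
    refine Filter.Eventually.of_forall fun ω => ?_
    have : Prod.mk ω ⁻¹' (Prod.swap ⁻¹' {x : ℝ × Env | ∀ j, x.1 ≠ (x.2 []).1 j}ᶜ) ⊆
        range (ω []).1 := by
      intro t ht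
      simp only [mem_preimage, mem_compl_iff, mem_ofPred_eq, Prod.swap_prod_mk, not_forall,
        not_not] at ht
      obtain ⟨j, hj⟩ := ht
      exact ⟨j, hj.symm⟩
    exact measure_mono_null this ((countable_range _).measure_zero _)
  filter_upwards [ae_forall_subtree h1] with ω hω i k j
  simpa [subtree] using hω i k j

theorem ae_label_ne (t : ℝ) : ∀ᵐ ω ∂pwitLaw p, ∀ i k, (ω i).1 k ≠ t := by
  have hset : MeasurableSet {x : ℝ × Env | x.1 ≠ t} :=
    (measurableSet_eq_fun (by fun_prop) (by fun_prop)).compl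
  have h1 : ∀ᵐ ω ∂pwitLaw p, ∀ k, (ω []).1 k ≠ t := by
    refine ae_child (Q := fun x => x.1 ≠ t) hset ?_
    exact Measure.quasiMeasurePreserving_fst.ae (p := fun x => x ≠ t)
      (ae_restrict_of_ae (by simp [ae_iff]))
  filter_upwards [ae_forall_subtree h1] with ω hω i k
  simpa [subtree] using hω i k

/-! ### Paths with decreasing labels -/

/-- Every path from the root with decreasing labels, all at most `x`, has length less
than `n`. -/
def DecreasingPathsShort : ℕ → ℝ → Env → Prop
  | 0, _, _ => False
  | n + 1, x, ω => ∀ k, (ω []).1 k ≤ x → DecreasingPathsShort n ((ω []).1 k) (subtree ω [k])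

theorem DecreasingPathsShort.anti {n : ℕ} {x y : ℝ} {ω : Env} (h : DecreasingPathsShort n y ω)
    (hxy : x ≤ y) : DecreasingPathsShort n x ω := by
  cases n with
  | zero => exact h
  | succ n => exact fun k hk => h k (hk.trans hxy)

theorem measurableSet_decreasingPathsShort (n : ℕ) :
    MeasurableSet {y : ℝ × Env | DecreasingPathsShort n y.1 y.2} := by
  induction n with
  | zero => exact MeasurableSet.const False
  | succ n ih =>
    refine measurableSet_forall fun k => MeasurableSet.imp ?_ ?_
    · exact measurableSet_le (by fun_prop) (by fun_prop)
    · exact (show Measurable fun y : ℝ × Env => ((y.2 []).1 k, subtree y.2 [k]) by fun_prop) ih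

/-- A first moment bound. By Campbell's formula, one more generation integrates the previous bound
over `(0, x]`, which produces the volume `x^n / n!` of a simplex. -/
theorem measure_not_decreasingPathsShort_le (n : ℕ) {x : ℝ} (hx : 0 ≤ x) :
    pwitLaw p {ω | ¬DecreasingPathsShort n x ω} ≤ ENNReal.ofReal (x ^ n / n.factorial) := by
  induction n generalizing x with
  | zero => simpa using prob_le_one
  | succ n ih =>
    set S : Set (ℝ × Env) := {y | y.1 ≤ x ∧ ¬DecreasingPathsShort n y.1 y.2} with hS
    have hSm : MeasurableSet S := (measurableSet_le measurable_fst measurable_const).inter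
      (measurableSet_decreasingPathsShort n).compl
    have hsub : {ω | ¬DecreasingPathsShort (n + 1) x ω} ⊆
        ⋃ k, {ω | ((ω []).1 k, subtree ω [k]) ∈ S} := by
      intro ω hω
      simp only [mem_ofPred_eq, DecreasingPathsShort, not_forall] at hω
      obtain ⟨k, hk, h⟩ := hω
      exact mem_iUnion.2 ⟨k, hk, h⟩
    calc pwitLaw p {ω | ¬DecreasingPathsShort (n + 1) x ω}
        ≤ ∑' k, pwitLaw p {ω | ((ω []).1 k, subtree ω [k]) ∈ S} :=
          (measure_mono hsub).trans (measure_iUnion_le _)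
      _ = ∑' k, ∫⁻ ω, S.indicator 1 ((ω []).1 k, subtree ω [k]) ∂pwitLaw p := by
          refine tsum_congr fun k => ?_
          rw [← lintegral_indicator_one (by
            exact (show Measurable fun ω : Env => ((ω []).1 k, subtree ω [k]) by fun_prop) hSm)]
          rfl
      _ = ∫⁻ t in Ioi 0, ∫⁻ ω, S.indicator 1 (t, ω) ∂pwitLaw p :=
          tsum_lintegral_child (measurable_one.indicator hSm)
      _ ≤ ∫⁻ t in Ioi 0, (Ioc 0 x).indicator
            (fun t => ENNReal.ofReal (t ^ n / n.factorial)) t := by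
          refine setLIntegral_mono' measurableSet_Ioi fun t ht => ?_
          have h0 : (0 : ℝ) < t := ht
          have : ∀ ω, S.indicator (1 : ℝ × Env → ℝ≥0∞) (t, ω) = {ω | (t, ω) ∈ S}.indicator 1 ω :=
            fun ω => rfl
          simp_rw [this]
          rw [lintegral_indicator_one (by exact measurable_prodMk_left hSm)]
          by_cases hx : t ≤ x
          · rw [indicator_of_mem (by exact ⟨h0, hx⟩)]
            exact (measure_mono fun ω hω => hω.2).trans (ih h0.le)
          · have : {ω : Env | (t, ω) ∈ S} = ∅ := by ext ω; simp [hS, hx]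
            rw [this, measure_empty]
            exact bot_le
      _ = ∫⁻ t in Ioc 0 x, ENNReal.ofReal (t ^ n / n.factorial) := by
          rw [lintegral_indicator measurableSet_Ioc, Measure.restrict_restrict measurableSet_Ioc,
            inter_eq_left.2 fun t ht => ht.1]
      _ = ENNReal.ofReal (x ^ (n + 1) / (n + 1).factorial) := by
          have hc : Continuous fun t : ℝ => t ^ n / n.factorial := by fun_prop
          rw [← ofReal_integral_eq_lintegral_ofReal (hc.intervalIntegrable 0 x).1
            ((ae_restrict_mem measurableSet_Ioc).mono fun t ht => by
              have := ht.1; simp only [Pi.zero_apply]; positivity),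
            ← intervalIntegral.integral_of_le hx, intervalIntegral.integral_div, integral_pow,
            Nat.factorial_succ]
          congr 1
          push_cast
          rw [zero_pow (Nat.succ_ne_zero n), sub_zero]
          field_simp

theorem ae_exists_decreasingPathsShort :
    ∀ᵐ ω ∂pwitLaw p, ∀ i x, ∃ n, DecreasingPathsShort n x (subtree ω i) := by
  have h1 : ∀ᵐ ω ∂pwitLaw p, ∀ K : ℕ, ∃ n, DecreasingPathsShort n K ω := by
    refine ae_all_iff.2 fun K => ?_
    rw [ae_iff]
    refine le_antisymm (ge_of_tendsto' (x := Filter.atTop) (f := fun n : ℕ => ENNReal.ofReal ((K : ℝ) ^ n / n.factorial))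
      ?_ fun n => (measure_mono ?_).trans
        (measure_not_decreasingPathsShort_le n (Nat.cast_nonneg K))) bot_le
    · have := ENNReal.tendsto_ofReal (FloorSemiring.tendsto_pow_div_factorial_atTop (K : ℝ))
      rwa [ENNReal.ofReal_zero] at this
    · exact fun ω hω h => hω ⟨n, h⟩
  filter_upwards [ae_forall_subtree h1] with ω hω i x
  obtain ⟨K, hK⟩ := exists_nat_ge x
  obtain ⟨n, hn⟩ := hω i K
  exact ⟨n, hn.anti hK⟩

end AlmostSure

/-! ### The process on a fixed environment -/

/-- The properties of the environment which hold almost surely and guarantee that the process is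
well defined. -/
structure Regular (ω : Env) : Prop where
  strictMono : ∀ i, StrictMono (ω i).1
  pos : ∀ i, 0 < (ω i).1 0
  two_le : ∀ i, 2 ≤ (ω i).2
  ne : ∀ i k j, (ω i).1 k ≠ (ω (k :: i)).1 j
  short : ∀ i x, ∃ n, DecreasingPathsShort n x (subtree ω i)

theorem ae_regular {p : PMF ℕ} (hp0 : p 0 = 0) (hp1 : p 1 = 0) :
    ∀ᵐ ω ∂pwitLaw p, Regular ω := by
  filter_upwards [ae_labels, ae_two_le_constraint hp0 hp1, ae_label_ne_label_child,
    ae_exists_decreasingPathsShort] with ω h1 h2 h3 h4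
  exact ⟨fun i => (h1 i).1, fun i => (h1 i).2, h2, h3, h4⟩

theorem Regular.subtree {ω : Env} (h : Regular ω) (i : List ℕ) : Regular (subtree ω i) where
  strictMono l := h.strictMono (l ++ i)
  pos l := h.pos (l ++ i)
  two_le l := h.two_le (l ++ i)
  ne l := h.ne (l ++ i)
  short l x := by rw [subtree_subtree]; exact h.short (l ++ i) x

theorem Regular.label_pos {ω : Env} (h : Regular ω) {e : List ℕ} (he : e ≠ []) :
    0 < label ω e := by
  cases e with
  | nil => exact absurd rfl he
  | cons j i => exact (h.pos i).trans_le ((h.strictMono i).monotone (Nat.zero_le j))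

/-- The edges on which the decision about the edge `e` depends. -/
def Precedes (ω : Env) (e' e : List ℕ) : Prop :=
  e' ≠ [] ∧ (e' = e.tail ∨ e'.tail = e.tail ∨ e' = e ∨ e'.tail = e) ∧ label ω e' < label ω e

theorem Regular.acc_nil {ω : Env} (h : Regular ω) : Acc (Precedes ω) [] :=
  ⟨_, fun _ he => absurd he.2.2 (not_lt.2 (h.label_pos he.1).le)⟩

/-- Siblings with smaller labels are treated by strong induction on `j`, edges one level below by
induction on `n`, since they prolong a decreasing path. The parent edge is covered by `hv`: either
its label is too large to precede, or it is already accessible. -/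
theorem Regular.acc_child {ω : Env} (h : Regular ω) {n : ℕ} {x : ℝ} {v : List ℕ}
    (hs : DecreasingPathsShort n x (RDCP.subtree ω v)) (hv : x ≤ label ω v ∨ Acc (Precedes ω) v)
    (j : ℕ) (hj : (ω v).1 j ≤ x) : Acc (Precedes ω) (j :: v) := by
  induction n generalizing x v j with
  | zero => exact hs.elim
  | succ n ih =>
    induction j using Nat.strong_induction_on with
    | _ j ihj =>
      refine ⟨_, fun e ⟨he0, he, hlt⟩ => ?_⟩
      simp only [List.tail_cons] at he
      rcases he with rfl | he | rfl | he
      · rcases hv with hv | hv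
        · exact absurd (hlt.trans_le hj) (not_lt.2 hv)
        · exact hv
      · obtain ⟨k, i, rfl⟩ := List.exists_cons_of_ne_nil he0
        obtain rfl : i = v := he
        have hk : k < j := (h.strictMono i).lt_iff_lt.1 hlt
        exact ihj k hk (hlt.le.trans hj)
      · exact absurd hlt (lt_irrefl _)
      · obtain ⟨k, i, rfl⟩ := List.exists_cons_of_ne_nil he0
        obtain rfl : i = j :: v := he
        have h1 := hs j hj
        rw [subtree_subtree] at h1
        exact ih (x := (ω v).1 j) (v := j :: v) h1 (Or.inl le_rfl) k hlt.le

/-- Dependence on edges towards the root is handled by induction on the string, dependence on edges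
away from it by `Regular.acc_child`. -/
theorem Regular.wellFounded {ω : Env} (h : Regular ω) : WellFounded (Precedes ω) := by
  refine ⟨fun e => ?_⟩
  induction e with
  | nil => exact h.acc_nil
  | cons j v ih =>
    obtain ⟨n, hn⟩ := h.short v ((ω v).1 j)
    exact h.acc_child hn (Or.inr ih) j le_rfl

/-- The rule for adding the edge `e`, provided that the edges with smaller labels are as in `G`. -/
def Rule (ω : Env) (G : Set (List ℕ)) (e : List ℕ) : Prop :=
  e ≠ [] ∧ degree ω G (Iio (label ω e)) e.tail < constraint ω e.tail ∧
    degree ω G (Iio (label ω e)) e < constraint ω e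

theorem rule_congr {ω : Env} {G G' : Set (List ℕ)} {e : List ℕ}
    (h : ∀ e', Precedes ω e' e → (e' ∈ G ↔ e' ∈ G')) : Rule ω G e ↔ Rule ω G' e := by
  have h1 : degree ω G (Iio (label ω e)) e.tail = degree ω G' (Iio (label ω e)) e.tail := by
    refine congrArg encard (Set.ext fun e' => ?_)
    simp only [mem_ofPred_eq]
    exact and_congr_left fun ⟨h0, h1, h2⟩ => h e' ⟨h0, by tauto, h2⟩
  have h2 : degree ω G (Iio (label ω e)) e = degree ω G' (Iio (label ω e)) e := by
    refine congrArg encard (Set.ext fun e' => ?_)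
    simp only [mem_ofPred_eq]
    exact and_congr_left fun ⟨h0, h1, h2⟩ => h e' ⟨h0, by tauto, h2⟩
  rw [Rule, Rule, h1, h2]

/-- The rule for an edge consults preceding edges only, so well-founded recursion constructs a
solution and well-founded induction determines it. -/
theorem Regular.existsUnique_isRDCP {ω : Env} (h : Regular ω) : ∃! G, IsRDCP ω G := by
  have hwf := h.wellFounded
  refine ⟨{e | hwf.fix (C := fun _ => Prop)
    (fun e ih => Rule ω {e' | ∃ h : Precedes ω e' e, ih e' h} e) e}, fun e => ?_, fun G hG => ?_⟩
  · rw [mem_ofPred_eq, hwf.fix_eq]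
    exact rule_congr fun e' he' => ⟨fun ⟨_, h⟩ => h, fun h => ⟨he', h⟩⟩
  · ext e
    induction e using hwf.induction with
    | _ e ih =>
      rw [mem_ofPred_eq, hwf.fix_eq]
      refine (hG e).trans (rule_congr fun e' he' => (ih e' he').trans ?_)
      exact ⟨fun h => ⟨he', h⟩, fun ⟨_, h⟩ => h⟩

theorem Regular.isRDCP_rdcp {ω : Env} (h : Regular ω) : IsRDCP ω (rdcp ω) := by
  have : ∃ G, IsRDCP ω G := h.existsUnique_isRDCP.exists
  rw [rdcp, dif_pos this]
  exact this.choose_spec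

theorem degree_eq (ω : Env) (G : Set (List ℕ)) (S : Set ℝ) (i : List ℕ)
    [Decidable (i ≠ [] ∧ i ∈ G ∧ label ω i ∈ S)] :
    degree ω G S i = {k | k :: i ∈ G ∧ (ω i).1 k ∈ S}.encard +
      if i ≠ [] ∧ i ∈ G ∧ label ω i ∈ S then 1 else 0 := by
  have hset : {e | e ∈ G ∧ e ≠ [] ∧ (e = i ∨ e.tail = i) ∧ label ω e ∈ S} =
      (fun k => k :: i) '' {k | k :: i ∈ G ∧ (ω i).1 k ∈ S} ∪
        {e | e = i ∧ i ≠ [] ∧ i ∈ G ∧ label ω i ∈ S} := by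
    ext e
    simp only [mem_ofPred_eq, mem_union, mem_image]
    constructor
    · rintro ⟨h1, h2, rfl | h3, h4⟩
      · exact Or.inr ⟨rfl, h2, h1, h4⟩
      · obtain ⟨k, l, rfl⟩ := List.exists_cons_of_ne_nil h2
        obtain rfl : l = i := h3
        exact Or.inl ⟨k, ⟨h1, h4⟩, rfl⟩
    · rintro (⟨k, ⟨h1, h2⟩, rfl⟩ | ⟨rfl, h1, h2, h3⟩)
      · exact ⟨h1, List.cons_ne_nil _ _, Or.inr rfl, h2⟩
      · exact ⟨h2, h1, Or.inl rfl, h3⟩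
  rw [degree, hset, encard_union_eq]
  · congr 1
    · exact Function.Injective.encard_image (fun a b hab => by simpa using hab) _
    · split_ifs with h
      · rw [← encard_singleton i]
        congr 1
        ext e
        simp [h]
      · rw [encard_eq_zero]
        ext e
        simp [h]
  · rw [Set.disjoint_left]
    rintro _ ⟨k, _, rfl⟩ ⟨h, -⟩
    exact List.cons_ne_self _ _ h

theorem degree_nil (ω : Env) (G : Set (List ℕ)) (S : Set ℝ) :
    degree ω G S [] = {k | [k] ∈ G ∧ (ω []).1 k ∈ S}.encard := by
  classical
  simp [degree_eq]

theorem label_append (ω : Env) {l : List ℕ} (hl : l ≠ []) (i : List ℕ) :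
    label ω (l ++ i) = label (subtree ω i) l := by
  cases l with
  | nil => exact absurd rfl hl
  | cons j l => rfl

/-- Below an edge, the process before the label of this edge only depends on the subtree. -/
theorem Regular.mem_rdcp_append {ω : Env} (h : Regular ω) {i l : List ℕ} (hl : l ≠ [])
    (hlt : label (RDCP.subtree ω i) l < label ω i) :
    l ++ i ∈ rdcp ω ↔ l ∈ rdcp (RDCP.subtree ω i) := by
  classical
  induction l using (h.subtree i).wellFounded.induction with
  | _ l ih =>
    obtain ⟨j, v, rfl⟩ := List.exists_cons_of_ne_nil hl
    rw [h.isRDCP_rdcp, (h.subtree i).isRDCP_rdcp]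
    have hlab : label ω (j :: v ++ i) = label (RDCP.subtree ω i) (j :: v) := rfl
    have hdeg : ∀ w, (w = v ∨ w = j :: v) →
        degree ω (rdcp ω) (Iio (label ω (j :: v ++ i))) (w ++ i) =
          degree (RDCP.subtree ω i) (rdcp (RDCP.subtree ω i))
            (Iio (label (RDCP.subtree ω i) (j :: v))) w := by
      intro w hw
      rw [degree_eq, degree_eq, hlab]
      congr 1
      · refine congrArg encard (Set.ext fun k => and_congr_left fun hk => ?_)
        refine ih (k :: w) ⟨List.cons_ne_nil _ _, ?_, hk⟩ (List.cons_ne_nil _ _)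
          (lt_trans (show label (RDCP.subtree ω i) (k :: w) < _ from hk) hlt)
        rcases hw with rfl | rfl
        · exact Or.inr (Or.inl rfl)
        · exact Or.inr (Or.inr (Or.inr rfl))
      · refine if_congr ?_ rfl rfl
        -- At `w = []` the full tree has the additional edge above `i`. Its label exceeds that of
        -- `l`, so it does not count yet.
        rcases eq_or_ne w [] with rfl | hw0
        · simp only [List.nil_append, mem_Iio, ne_eq, not_true, false_and, iff_false, not_and]
          exact fun _ _ => not_lt.2 hlt.le
        · rw [label_append ω hw0]
          refine and_congr (by simp [hw0]) (and_congr_left fun hk => ?_)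
          refine ih w ⟨hw0, ?_, hk⟩ hw0 (lt_trans hk hlt)
          rcases hw with rfl | rfl
          · exact Or.inl rfl
          · exact Or.inr (Or.inr (Or.inl rfl))
    have h1 := hdeg v (Or.inl rfl)
    have h2 := hdeg (j :: v) (Or.inr rfl)
    simp only [List.cons_append, List.tail_cons] at h1 h2 ⊢
    rw [h1, h2]
    simp only [ne_eq, reduceCtorEq, not_false_eq_true, true_and]
    rfl

theorem phantomTime_subtree (ω : Env) (i j : List ℕ) :
    phantomTime (subtree ω i) j = phantomTime ω (j ++ i) := by
  rw [phantomTime, subtree_subtree, phantomTime]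

open Classical in
theorem Regular.phantomTime_nil {ω : Env} (h : Regular ω) : phantomTime ω [] =
    if HasNth (fun k => [k] ∈ rdcp ω) ((ω []).2 - 1) then
      ENNReal.ofReal ((ω []).1 (Nat.nth (fun k => [k] ∈ rdcp ω) ((ω []).2 - 1))) else ∞ := by
  set A : ℕ → Prop := fun k => [k] ∈ rdcp ω with hA
  set n := (ω []).2 - 1 with hn
  have hd : (ω []).2 = n + 1 := by have := h.two_le []; omega
  have key : ∀ t : ℝ≥0∞, ((constraint ω [] : ℕ∞) ≤ degree ω (rdcp ω) {x | ENNReal.ofReal x ≤ t} [])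
      ↔ HasNth A n ∧ ENNReal.ofReal ((ω []).1 (Nat.nth A n)) ≤ t := by
    intro t
    rw [degree_nil, constraint, hd, Nat.cast_add, Nat.cast_one,
      ENat.add_one_le_iff (ENat.natCast_ne_top n)]
    refine Iff.trans ?_ (hasNth_and_iff (p := A) (k := n)
      (r := fun k => ENNReal.ofReal ((ω []).1 k) ≤ t) fun i j hij hj =>
        (ENNReal.ofReal_le_ofReal ((h.strictMono []).monotone hij)).trans hj)
    rw [hasNth_iff_encard]
    rfl
  rw [phantomTime, subtree_nil, saturationTime]
  simp_rw [key]
  split_ifs with hN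
  · simp only [hN, true_and]
    exact csInf_Ici
  · simp only [hN, false_and, ofPred_false, sInf_empty]

/-- The labels increase, so saturation occurs at the added edge with index `d - 1`. The assumption
`hx` excludes the tie in which `x` is the saturation time and the degree strictly before `x` is
still too small. -/
theorem Regular.ofReal_lt_phantomTime_nil_iff {ω : Env} (h : Regular ω) {x : ℝ}
    (hx : ∀ k, (ω []).1 k ≠ x) :
    ENNReal.ofReal x < phantomTime ω [] ↔ degree ω (rdcp ω) (Iio x) [] < constraint ω [] := by
  classical
  set A : ℕ → Prop := fun k => [k] ∈ rdcp ω with hA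
  set n := (ω []).2 - 1 with hn
  have hd : (ω []).2 = n + 1 := by have := h.two_le []; omega
  have key : (n : ℕ∞) < degree ω (rdcp ω) (Iio x) [] ↔ HasNth A n ∧ (ω []).1 (Nat.nth A n) < x := by
    rw [degree_nil]
    refine Iff.trans ?_ (hasNth_and_iff (p := A) (k := n)
      (r := fun k => (ω []).1 k < x) fun i j hij hj =>
        ((h.strictMono []).monotone hij).trans_lt hj)
    rw [hasNth_iff_encard]
    rfl
  rw [h.phantomTime_nil]
  change (ENNReal.ofReal x < if HasNth A n then ENNReal.ofReal ((ω []).1 (Nat.nth A n)) else ∞) ↔ _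
  rw [constraint, hd, Nat.cast_add, Nat.cast_one,
    ENat.lt_add_one_iff (ENat.natCast_ne_top n), ← not_lt, key]
  split_ifs with hN
  · have h2 : 0 < (ω []).1 (Nat.nth A n) := h.label_pos (e := [Nat.nth A n]) (by simp)
    rw [ENNReal.ofReal_lt_ofReal_iff h2]
    simp only [hN, true_and, not_lt]
    exact ⟨le_of_lt, fun hle => lt_of_le_of_ne hle (hx _).symm⟩
  · simp [hN]

/-- Until the label of the edge above it, the degree of `k :: i` is governed by its descendants
alone, and there the process coincides with the phantom one (`Regular.mem_rdcp_append`). -/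
theorem Regular.degree_lt_constraint_iff {ω : Env} (h : Regular ω) (k : ℕ) (i : List ℕ) :
    degree ω (rdcp ω) (Iio (label ω (k :: i))) (k :: i) < constraint ω (k :: i) ↔
      ENNReal.ofReal (label ω (k :: i)) < phantomTime ω (k :: i) := by
  classical
  have h1 := (h.subtree (k :: i)).ofReal_lt_phantomTime_nil_iff (x := label ω (k :: i))
    (fun j => (h.ne i k j).symm)
  rw [phantomTime_subtree, List.nil_append] at h1
  rw [h1, degree_nil, degree_eq, if_neg (fun hc => lt_irrefl _ (mem_Iio.1 hc.2.2)), add_zero]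
  have : {j | j :: k :: i ∈ rdcp ω ∧ (ω (k :: i)).1 j ∈ Iio (label ω (k :: i))} =
      {j | [j] ∈ rdcp (RDCP.subtree ω (k :: i)) ∧
        (RDCP.subtree ω (k :: i) []).1 j ∈ Iio (label ω (k :: i))} := by
    refine Set.ext fun j => and_congr_left fun hj => ?_
    exact h.mem_rdcp_append (l := [j]) (by simp) hj
  rw [this]
  rfl

/-- The vertex `k :: i` is not saturated before the label of the edge to its parent in the process
on the subtree of its descendants. -/
def Available (ω : Env) (i : List ℕ) (k : ℕ) : Prop :=
  ENNReal.ofReal ((ω i).1 k) < phantomTime ω (k :: i)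

theorem Regular.mem_rdcp_cons_iff {ω : Env} (h : Regular ω) (k : ℕ) (i : List ℕ) :
    k :: i ∈ rdcp ω ↔
      degree ω (rdcp ω) (Iio ((ω i).1 k)) i < (ω i).2 ∧ Available ω i k := by
  have := h.isRDCP_rdcp (k :: i)
  rw [h.degree_lt_constraint_iff] at this
  rw [this]
  simp only [ne_eq, reduceCtorEq, not_false_eq_true, true_and, List.tail_cons]
  rfl

theorem Regular.encard_lt {ω : Env} (h : Regular ω) (i : List ℕ) (A : ℕ → Prop) [DecidablePred A]
    (k : ℕ) : {j | A j ∧ (ω i).1 j ∈ Iio ((ω i).1 k)}.encard = Nat.count A k := by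
  have : {j | A j ∧ (ω i).1 j ∈ Iio ((ω i).1 k)} = ((Finset.range k).filter A : Finset ℕ) := by
    ext j
    simp [(h.strictMono i).lt_iff_lt, and_comm]
  rw [this, encard_coe_eq_coe_finsetCard, Nat.count_eq_card_filter_range]

/-- Greedy selection: candidates are taken until `d` of them have been taken, so the number taken is
the minimum of `d` and the number of candidates. This turns the self-referential rule into an
explicit one. -/
theorem iff_count_lt_of_iff {A g : ℕ → Prop} [DecidablePred A] [DecidablePred g] {d : ℕ}
    (h : ∀ k, A k ↔ Nat.count A k < d ∧ g k) (k : ℕ) : A k ↔ g k ∧ Nat.count g k < d := by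
  have hc : ∀ k, Nat.count A k = min (Nat.count g k) d := by
    intro k
    induction k with
    | zero => simp
    | succ k ih =>
      rw [Nat.count_succ, Nat.count_succ]
      have := h k
      by_cases hg : g k <;> by_cases hA : A k <;> simp only [hg, hA, if_true, if_false] <;>
        simp only [hg, hA, and_true, and_false, true_iff, false_iff] at this <;> omega
  rw [h k, hc k]
  constructor
  · exact fun ⟨h1, h2⟩ => ⟨h2, by omega⟩
  · exact fun ⟨h1, h2⟩ => ⟨by omega, h1⟩

open Classical in
theorem Regular.mem_rdcp_root_iff {ω : Env} (h : Regular ω) (k : ℕ) :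
    [k] ∈ rdcp ω ↔ Available ω [] k ∧ Nat.count (Available ω []) k < (ω []).2 := by
  refine iff_count_lt_of_iff (A := fun k => [k] ∈ rdcp ω) (fun k => ?_) k
  rw [h.mem_rdcp_cons_iff, degree_nil, h.encard_lt [] (fun j => [j] ∈ rdcp ω), Nat.cast_lt]

open Classical in
-- The edge above `i` takes one unit of the constraint from every child edge: later ones find it
-- counted, and earlier ones must leave room for it, because it is known to be added.
theorem Regular.mem_rdcp_child_iff {ω : Env} (h : Regular ω) {i : List ℕ} (hi : i ∈ rdcp ω)
    (k : ℕ) : k :: i ∈ rdcp ω ↔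
      Available ω i k ∧ Nat.count (Available ω i) k < (ω i).2 - 1 := by
  have hi' := (h.isRDCP_rdcp i).1 hi
  have h2 := h.two_le i
  refine iff_count_lt_of_iff (A := fun k => k :: i ∈ rdcp ω) (fun k => ?_) k
  rw [h.mem_rdcp_cons_iff, degree_eq, h.encard_lt i (fun j => j :: i ∈ rdcp ω)]
  split_ifs with hlt
  · refine and_congr_left fun _ => ?_
    rw [← Nat.cast_one, ← Nat.cast_add, Nat.cast_lt]
    omega
  · have hle : (ω i).1 k ≤ label ω i := not_lt.1 fun hc => hlt ⟨hi'.1, hi, hc⟩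
    rw [add_zero, Nat.cast_lt]
    refine ⟨fun ⟨h3, h4⟩ => ⟨?_, h4⟩, fun ⟨h3, h4⟩ => ⟨by omega, h4⟩⟩
    have hk : k :: i ∈ rdcp ω := by
      rw [h.mem_rdcp_cons_iff, degree_eq, h.encard_lt i (fun j => j :: i ∈ rdcp ω), if_neg hlt,
        add_zero, Nat.cast_lt]
      exact ⟨h3, h4⟩
    have hne : (ω i).1 k < label ω i := by
      refine lt_of_le_of_ne hle ?_
      obtain ⟨j, v, rfl⟩ := List.exists_cons_of_ne_nil hi'.1
      exact (h.ne v j k).symm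
    have h5 := hi'.2.2
    rw [degree_eq, if_neg (fun hc => lt_irrefl _ (mem_Iio.1 hc.2.2)), add_zero] at h5
    -- All added child edges up to and including `k` come before the edge above `i`. When that edge
    -- is added fewer than `d` edges are present, so fewer than `d - 1` precede `k`.
    have h6 : {j | j :: i ∈ rdcp ω ∧ (ω i).1 j ∈ Iio ((ω i).1 (k + 1))} ⊆
        {j | j :: i ∈ rdcp ω ∧ (ω i).1 j ∈ Iio (label ω i)} := by
      rintro j ⟨hj1, hj2⟩
      refine ⟨hj1, lt_of_le_of_lt ?_ hne⟩
      exact (h.strictMono i).monotone (Nat.lt_succ_iff.1 ((h.strictMono i).lt_iff_lt.1 hj2))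
    have h7 := (encard_le_encard h6).trans_lt h5
    rw [h.encard_lt i (fun j => j :: i ∈ rdcp ω), constraint, Nat.cast_lt, Nat.count_succ,
      if_pos hk] at h7
    omega

/-- The recursion for the phantom saturation times. -/
theorem Regular.phantomTime_eq {ω : Env} (h : Regular ω) (i : List ℕ) :
    phantomTime ω i = chi (ω i).1 (ω i).2 fun k => phantomTime ω (k :: i) := by
  classical
  suffices hroot : ∀ ω, Regular ω →
      phantomTime ω [] = chi (ω []).1 (ω []).2 fun k => phantomTime ω [k] by
    have := hroot _ (h.subtree i)
    simp only [phantomTime_subtree] at this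
    exact this
  clear h ω
  intro ω h
  have hd : (ω []).2 = (ω []).2 - 1 + 1 := by have := h.two_le []; omega
  have hA : (fun k => [k] ∈ rdcp ω) =
      fun k => Available ω [] k ∧ Nat.count (Available ω []) k < (ω []).2 :=
    funext fun k => propext (h.mem_rdcp_root_iff k)
  have hr : ∀ i j, i ≤ j → Nat.count (Available ω []) j < (ω []).2 →
      Nat.count (Available ω []) i < (ω []).2 := fun i j hij hj =>
    (Nat.count_monotone _ hij).trans_lt hj
  rw [h.phantomTime_nil, hd, chi_succ, Nat.add_sub_cancel, hA]
  set n := (ω []).2 - 1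
  -- The available child with index `n = d - 1` still passes the cutoff `< d`, so the cutoff does
  -- not affect the saturation time.
  have hH : HasNth (fun k => Available ω [] k ∧ Nat.count (Available ω []) k < (ω []).2) n ↔
      HasNth (Available ω []) n := by
    rw [hasNth_and_iff hr]
    refine and_iff_left_of_imp fun hn => ?_
    rw [hn.count_nth]
    omega
  change (if HasNth _ n then _ else _) = if HasNth (Available ω []) n then
    ENNReal.ofReal ((ω []).1 (Nat.nth (Available ω []) n)) else ∞
  by_cases hn : HasNth (Available ω []) n
  · rw [if_pos hn, if_pos (hH.2 hn), nth_and_eq hr (hH.2 hn)]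
  · rw [if_neg hn, if_neg (fun hc => hn (hH.1 hc))]

/-! ### The law of the phantom saturation times -/

/-- Whether `chi` exceeds `c` is decided by the points with label at most `c`. This locality permits
truncation of the tree. -/
theorem lt_chi_succ_iff {τ : ℕ → ℝ} (hτ : Monotone τ) (n : ℕ) (T : ℕ → ℝ≥0∞) {c : ℝ≥0∞}
    (hc : c < ∞) : c < chi τ (n + 1) T ↔
      ¬HasNth (fun k => ENNReal.ofReal (τ k) < T k ∧ ENNReal.ofReal (τ k) ≤ c) n := by
  classical
  rw [chi_succ, hasNth_and_iff (r := fun k => ENNReal.ofReal (τ k) ≤ c)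
    fun i j hij hj => (ENNReal.ofReal_le_ofReal (hτ hij)).trans hj]
  split_ifs with h
  · simp [h]
  · simp [h, hc]

/-- The phantom saturation time of the root, if only the first `n` generations are taken into
account. -/
def approxTime : ℕ → Env → ℝ≥0∞
  | 0, _ => 0
  | n + 1, ω => chi (ω []).1 (ω []).2 fun k => approxTime n (subtree ω [k])

theorem measurable_approxTime (n : ℕ) : Measurable (approxTime n) := by
  induction n with
  | zero => exact measurable_const
  | succ n ih =>
    exact (measurable_chi_prod ih).comp
      (show Measurable fun ω : Env => (ω [], fun k => subtree ω [k]) by fun_prop)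

theorem DecreasingPathsShort.succ {n : ℕ} {x : ℝ} {ω : Env} (h : DecreasingPathsShort n x ω) :
    DecreasingPathsShort (n + 1) x ω := by
  induction n generalizing x ω with
  | zero => exact h.elim
  | succ n ih => exact fun k hk => ih (h k hk)

/-- Comparing with `y` explores only decreasing paths that start below `y`. They are shorter than
`n`, so the arbitrary value `0` at depth `n` is never consulted. -/
theorem Regular.ofReal_lt_approxTime_iff {ω : Env} (h : Regular ω) {n : ℕ} {x : ℝ}
    (hs : DecreasingPathsShort n x ω) {y : ℝ} (hy : y ≤ x) :
    ENNReal.ofReal y < approxTime n ω ↔ ENNReal.ofReal y < phantomTime ω [] := by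
  induction n generalizing x ω y with
  | zero => exact hs.elim
  | succ n ih =>
    obtain ⟨m, hm⟩ : ∃ m, (ω []).2 = m + 1 := ⟨(ω []).2 - 1, by have := h.two_le []; omega⟩
    rw [h.phantomTime_eq, approxTime, hm, lt_chi_succ_iff (h.strictMono []).monotone _ _
      ENNReal.ofReal_lt_top, lt_chi_succ_iff (h.strictMono []).monotone _ _ ENNReal.ofReal_lt_top]
    have : (fun k => ENNReal.ofReal ((ω []).1 k) < approxTime n (RDCP.subtree ω [k]) ∧
        ENNReal.ofReal ((ω []).1 k) ≤ ENNReal.ofReal y) =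
        fun k => ENNReal.ofReal ((ω []).1 k) < phantomTime ω [k] ∧
          ENNReal.ofReal ((ω []).1 k) ≤ ENNReal.ofReal y := by
      ext k
      refine and_congr_left fun hk => ?_
      have hpos : 0 < (ω []).1 k := h.label_pos (e := [k]) (by simp)
      have hky : (ω []).1 k ≤ y := by
        rcases ENNReal.ofReal_le_ofReal_iff'.1 hk with h1 | h1
        · exact h1
        · exact absurd h1 (not_le.2 hpos)
      rw [ih (h.subtree [k]) (hs k (hky.trans hy)) le_rfl, phantomTime_subtree, List.nil_append]
    rw [this]

/-- For each threshold the comparison is eventually constant in `n`. The phantom time is defined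
through a chosen solution, and this limit is the source of its almost everywhere measurability. -/
theorem Regular.tendsto_approxTime {ω : Env} (h : Regular ω) :
    Filter.Tendsto (fun n => approxTime n ω) Filter.atTop (nhds (phantomTime ω [])) := by
  have key : ∀ y : ℝ, ∀ᶠ n in Filter.atTop,
      (ENNReal.ofReal y < approxTime n ω ↔ ENNReal.ofReal y < phantomTime ω []) := by
    intro y
    obtain ⟨n, hn⟩ := h.short [] y
    rw [subtree_nil] at hn
    filter_upwards [Filter.eventually_ge_atTop n] with m hm
    refine h.ofReal_lt_approxTime_iff (x := y) ?_ le_rfl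
    induction m, hm using Nat.le_induction with
    | base => exact hn
    | succ m _ ih => exact ih.succ
  refine tendsto_order.2 ⟨fun a ha => ?_, fun b hb => ?_⟩
  · obtain ⟨y, -, h1, h2⟩ := ENNReal.lt_iff_exists_real_btwn.1 ha
    filter_upwards [key y] with n hn
    exact h1.trans (hn.2 h2)
  · obtain ⟨y, -, h1, h2⟩ := ENNReal.lt_iff_exists_real_btwn.1 hb
    filter_upwards [key y] with n hn
    exact (not_lt.1 fun hc => absurd (hn.1 hc) (not_lt.2 h1.le)).trans_lt h2

section Law

variable {p : PMF ℕ}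

theorem aemeasurable_phantomTime_nil (hp0 : p 0 = 0) (hp1 : p 1 = 0) :
    AEMeasurable (fun ω => phantomTime ω []) (pwitLaw p) :=
  aemeasurable_of_tendsto_metrizable_ae Filter.atTop
    (fun n => (measurable_approxTime n).aemeasurable)
    ((ae_regular hp0 hp1).mono fun _ h => h.tendsto_approxTime)

theorem phantomTime_eq_comp (i : List ℕ) : (fun ω => phantomTime ω i) =
    (fun ω => phantomTime ω []) ∘ fun ω => subtree ω i := by
  ext ω
  simp [phantomTime_subtree]

theorem aemeasurable_phantomTime (hp0 : p 0 = 0) (hp1 : p 1 = 0) (i : List ℕ) :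
    AEMeasurable (fun ω => phantomTime ω i) (pwitLaw p) := by
  rw [phantomTime_eq_comp]
  exact (aemeasurable_phantomTime_nil hp0 hp1).comp_quasiMeasurePreserving
    (measurePreserving_subtree p i).quasiMeasurePreserving

theorem map_phantomTime (hp0 : p 0 = 0) (hp1 : p 1 = 0) (i : List ℕ) :
    (pwitLaw p).map (fun ω => phantomTime ω i) = (pwitLaw p).map fun ω => phantomTime ω [] := by
  have h := measurePreserving_subtree p i
  conv_rhs => rw [← h.map_eq]
  rw [phantomTime_eq_comp, AEMeasurable.map_map_of_aemeasurable _ h.measurable.aemeasurable]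
  rw [h.map_eq]
  exact aemeasurable_phantomTime_nil hp0 hp1

/-- A measurable version of the phantom saturation time of the root. -/
def measTime (hp0 : p 0 = 0) (hp1 : p 1 = 0) : Env → ℝ≥0∞ :=
  (aemeasurable_phantomTime_nil hp0 hp1).mk _

@[fun_prop]
theorem measurable_measTime (hp0 : p 0 = 0) (hp1 : p 1 = 0) : Measurable (measTime hp0 hp1) :=
  AEMeasurable.measurable_mk _

theorem ae_measTime_eq (hp0 : p 0 = 0) (hp1 : p 1 = 0) :
    ∀ᵐ ω ∂pwitLaw p, ∀ i, measTime hp0 hp1 (subtree ω i) = phantomTime ω i := by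
  filter_upwards [ae_forall_subtree (aemeasurable_phantomTime_nil hp0 hp1).ae_eq_mk] with ω hω i
  rw [measTime, ← hω i, phantomTime_subtree, List.nil_append]

theorem map_measTime (hp0 : p 0 = 0) (hp1 : p 1 = 0) :
    (pwitLaw p).map (measTime hp0 hp1) = (pwitLaw p).map fun ω => phantomTime ω [] :=
  (Measure.map_congr (aemeasurable_phantomTime_nil hp0 hp1).ae_eq_mk).symm

/-- The law of the phantom saturation times solves the recursive distributional equation. -/
theorem solvesRDE_phantomTime (hp0 : p 0 = 0) (hp1 : p 1 = 0) :
    SolvesRDE p ((pwitLaw p).map fun ω => phantomTime ω []) := by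
  have hT := measurable_measTime hp0 hp1
  rw [← map_measTime hp0 hp1]
  refine ⟨Measure.isProbabilityMeasure_map hT.aemeasurable, ?_⟩
  rw [← Measure.infinitePi_map_pi (fun _ : ℕ => pwitLaw p) (f := fun _ => measTime hp0 hp1)
    fun _ => hT]
  have h1 := Measure.map_prod_map (pppLaw.prod p.toMeasure)
    (Measure.infinitePi fun _ : ℕ => pwitLaw p) (f := id) (g := fun x i => measTime hp0 hp1 (x i))
    measurable_id (by fun_prop)
  rw [Measure.map_id] at h1
  have hchi := measurable_chi_prod (E := ℝ≥0∞) (T := id) measurable_id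
  simp only [id] at hchi
  rw [h1, Measure.map_map hchi (by fun_prop), ← map_root_subtree, Measure.map_map
    (hchi.comp (by fun_prop)) (by fun_prop)]
  refine Measure.map_congr ?_
  filter_upwards [ae_regular hp0 hp1, ae_measTime_eq hp0 hp1] with ω h1 h2
  have h3 := h2 []
  rw [subtree_nil] at h3
  rw [h3, h1.phantomTime_eq]
  simp only [Function.comp_apply, Prod.map_fst, Prod.map_snd, id, h2]

theorem hasEarlyLaw_phantomTime {Δ : ℕ} (hp0 : p 0 = 0) (hp1 : p 1 = 0)
    (hΔ : ∀ k, Δ < k → p k = 0) :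
    HasEarlyLaw p Δ ((pwitLaw p).map fun ω => phantomTime ω []) :=
  (solvesRDE_phantomTime hp0 hp1).hasEarlyLaw hp0 hΔ

theorem isProbabilityMeasure_phantomTime (hp0 : p 0 = 0) (hp1 : p 1 = 0) :
    IsProbabilityMeasure ((pwitLaw p).map fun ω => phantomTime ω []) :=
  (solvesRDE_phantomTime hp0 hp1).1

theorem ae_phantomTime_lt_top {Δ : ℕ} (hp0 : p 0 = 0) (hp1 : p 1 = 0)
    (hΔ : ∀ k, Δ < k → p k = 0) : ∀ᵐ ω ∂pwitLaw p, ∀ i, phantomTime ω i < ∞ := by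
  have := isProbabilityMeasure_phantomTime hp0 hp1
  have h := (hasEarlyLaw_phantomTime hp0 hp1 hΔ).measure_top hp0 hΔ
  have h1 : ∀ᵐ ω ∂pwitLaw p, phantomTime ω [] < ∞ := by
    rw [Measure.map_apply_of_aemeasurable (aemeasurable_phantomTime_nil hp0 hp1)
      (measurableSet_singleton _)] at h
    rw [ae_iff]
    simp only [not_lt, top_le_iff]
    exact h
  filter_upwards [ae_forall_subtree h1] with ω hω i
  have := hω i
  rwa [phantomTime_subtree, List.nil_append] at this

end Law

/-! ### The recursive structure of the component of the root -/

/-- The tree with root mark `o` and the trees `c 0, c 1, …` attached to the root. -/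
def join (o : Option Mark) (c : ℕ → DecoratedTree) : DecoratedTree := fun l =>
  if h : l = [] then o else c (l.getLast h) l.dropLast

@[simp] theorem join_nil (o : Option Mark) (c : ℕ → DecoratedTree) : join o c [] = o := by
  simp [join]

@[simp] theorem join_append (o : Option Mark) (c : ℕ → DecoratedTree) (l : List ℕ) (j : ℕ) :
    join o c (l ++ [j]) = c j l := by
  simp [join]

theorem eq_join_iff {x : DecoratedTree} {o : Option Mark} {c : ℕ → DecoratedTree} :
    x = join o c ↔ x [] = o ∧ ∀ j l, x (l ++ [j]) = c j l := by
  constructor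
  · rintro rfl
    simp
  · rintro ⟨h1, h2⟩
    ext1 l
    rcases List.eq_nil_or_concat l with rfl | ⟨l, j, rfl⟩
    · simp [h1]
    · simp [h2]

theorem join_none : join none (fun _ _ => none) = fun _ => none := by
  rw [eq_comm, eq_join_iff]; simp

theorem measurable_join :
    Measurable fun y : Option Mark × (ℕ → DecoratedTree) => join y.1 y.2 := by
  refine measurable_pi_lambda _ fun l => ?_
  rcases List.eq_nil_or_concat l with rfl | ⟨l, j, rfl⟩
  · simpa using measurable_fst
  · simp only [List.concat_eq_append, join_append]
    fun_prop

/-- The part of a tree up to generation `n`. -/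
def trunc (n : ℕ) (x : DecoratedTree) : DecoratedTree := fun l =>
  if l.length ≤ n then x l else none

theorem measurable_trunc (n : ℕ) : Measurable (trunc n) := by
  refine measurable_pi_lambda _ fun l => ?_
  unfold trunc
  split_ifs
  · exact measurable_pi_apply l
  · exact measurable_const

theorem trunc_zero (x : DecoratedTree) : trunc 0 x = join (x []) fun _ _ => none := by
  rw [eq_join_iff]
  simp [trunc]

theorem trunc_join (n : ℕ) (o : Option Mark) (c : ℕ → DecoratedTree) :
    trunc (n + 1) (join o c) = join o fun j => trunc n (c j) := by
  rw [eq_join_iff]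
  simp [trunc]

theorem trunc_none (n : ℕ) : trunc n (fun _ => none) = fun _ => none := by
  ext1 l; simp [trunc]

open Classical in
/-- The vertex of the environment that gets the new name `i` in the component of the root, if the
degree constraint of the root is diminished by `b`. -/
def vertexName (b : ℕ) (ω : Env) : List ℕ → Option (List ℕ)
  | [] => some []
  | k :: i => (vertexName b ω i).bind fun v =>
      if k < (ω v).2 - (if v = [] then b else 1) then some (Nat.nth (Available ω v) k :: v) else none

/-- The decorated component of the root, if the degree constraint of the root is diminished
by `b` and the label of the edge above the root is `x`. -/
def componentTree (b : ℕ) (x : ℝ) (ω : Env) : DecoratedTree := fun i =>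
  (vertexName b ω i).map fun v =>
    (if v = [] then x else label ω v, (phantomTime ω v).toReal, constraint ω v)

theorem available_subtree (ω : Env) (i v : List ℕ) :
    Available (subtree ω i) v = Available ω (v ++ i) := by
  ext k
  rw [Available, Available, phantomTime_subtree]
  rfl

/-- Removing the last entry is the first step away from the root. In the subtree reached, the root
has spent one unit on the edge above it, whence the parameter `1`. -/
theorem vertexName_append (b : ℕ) (ω : Env) (l : List ℕ) (j : ℕ) :
    vertexName b ω (l ++ [j]) = if j < (ω []).2 - b then
      (vertexName 1 (subtree ω [Nat.nth (Available ω []) j]) l).map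
        (· ++ [Nat.nth (Available ω []) j]) else none := by
  induction l with
  | nil => simp [vertexName]
  | cons k i ih =>
    rw [List.cons_append, vertexName, ih]
    split_ifs with hj
    · rw [vertexName, Option.bind_map, Option.map_bind]
      congr 1
      ext1 v
      simp only [Function.comp_apply, List.append_eq_nil_iff, List.cons_ne_self, and_false,
        if_false, ite_self, available_subtree, subtree]
      split_ifs <;> simp_all
    · rfl

theorem componentTree_eq_join (b : ℕ) (x : ℝ) (ω : Env) :
    componentTree b x ω = join (some (x, (phantomTime ω []).toReal, (ω []).2)) fun j =>
      if j < (ω []).2 - b then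
        componentTree 1 ((ω []).1 (Nat.nth (Available ω []) j))
          (subtree ω [Nat.nth (Available ω []) j])
      else fun _ => none := by
  rw [eq_join_iff]
  refine ⟨rfl, fun j l => ?_⟩
  rw [componentTree, vertexName_append]
  split_ifs with hj
  · rw [componentTree, Option.map_map]
    congr 1
    ext1 v
    simp only [Function.comp_apply, List.append_eq_nil_iff, List.cons_ne_self, and_false, if_false,
      phantomTime_subtree]
    rcases eq_or_ne v [] with rfl | hv
    · simp [label, constraint, subtree]
    · rw [label_append ω hv, if_neg hv]
      rfl
  · rfl

theorem Regular.hasNth_available {ω : Env} (h : Regular ω) (hT : ∀ i, phantomTime ω i < ∞)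
    (i : List ℕ) : HasNth (Available ω i) ((ω i).2 - 1) := by
  classical
  by_contra hN
  have h1 := h.phantomTime_eq i
  have hd : (ω i).2 = (ω i).2 - 1 + 1 := by have := h.two_le i; omega
  rw [hd, chi_succ] at h1
  have h2 : phantomTime ω i = ∞ := by
    rw [h1, if_neg]
    exact hN
  exact (hT i).ne h2

theorem inComponent_top_iff (ω : Env) (k : ℕ) (v : List ℕ) :
    InComponent ω ∞ (k :: v) ↔ InComponent ω ∞ v ∧ k :: v ∈ rdcp ω := by
  simp [InComponent]

/-- The children in the component are the available ones up to a cutoff on their number. Finite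
phantom times guarantee enough available children to reach the cutoff, so the degrees are exact. -/
theorem Regular.oldName_top {ω : Env} (h : Regular ω) (hT : ∀ i, phantomTime ω i < ∞)
    (i : List ℕ) : oldName (InComponent ω ∞) i = vertexName 0 ω i ∧
      ∀ v ∈ vertexName 0 ω i, InComponent ω ∞ v := by
  classical
  induction i with
  | nil =>
    refine ⟨rfl, fun v hv => ?_⟩
    obtain rfl : [] = v := by simpa [vertexName] using hv
    trivial
  | cons k i ih =>
    rw [oldName, vertexName, ih.1]
    rcases hv : vertexName 0 ω i with _ | v
    · simp
    · have hin : InComponent ω ∞ v := ih.2 v (by rw [hv]; rfl)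
      simp only [Option.bind_some]
      set d := (ω v).2 - (if v = [] then 0 else 1) with hd
      have hA : (fun j => InComponent ω ∞ (j :: v)) =
          fun j => Available ω v j ∧ Nat.count (Available ω v) j < d := by
        ext j
        rw [inComponent_top_iff, and_iff_right hin]
        cases v with
        | nil => simpa [hd] using h.mem_rdcp_root_iff j
        | cons m u => simpa [hd] using h.mem_rdcp_child_iff ((inComponent_top_iff ω m u).1 hin).2 j
      have hr : ∀ i j, i ≤ j → Nat.count (Available ω v) j < d →
          Nat.count (Available ω v) i < d := fun i j hij hj =>
        (Nat.count_monotone _ hij).trans_lt hj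
      have hk : (k : ℕ∞) < {j | InComponent ω ∞ (j :: v)}.encard ↔ k < d := by
        rw [← hasNth_iff_encard, hA, hasNth_and_iff hr]
        constructor
        · rintro ⟨h1, h2⟩
          rwa [h1.count_nth] at h2
        · intro hkd
          have h1 : HasNth (Available ω v) k := (h.hasNth_available hT v).mono (by omega)
          exact ⟨h1, by rwa [h1.count_nth]⟩
      have hite : (if (k : ℕ∞) < {j | InComponent ω ∞ (j :: v)}.encard then
            some (Nat.nth (fun j => InComponent ω ∞ (j :: v)) k :: v) else none) =
          if k < d then some (Nat.nth (Available ω v) k :: v) else none := by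
        by_cases hkd : k < d
        · have h2 := hasNth_iff_encard.2 (hk.2 hkd)
          rw [if_pos hkd, if_pos (hk.2 hkd)]
          rw [hA] at h2 ⊢
          rw [nth_and_eq hr h2]
        · rw [if_neg hkd, if_neg (fun hc => hkd (hk.1 hc))]
      refine ⟨hite, fun u hu => ?_⟩
      rw [← hite] at hu
      split_ifs at hu with hc
      · have hu' : Nat.nth (fun j => InComponent ω ∞ (j :: v)) k :: v = u := by simpa using hu
        rw [← hu']
        exact (hasNth_iff_encard.2 hc).nth_mem
      · simp at hu

theorem Regular.pwitTree_top {ω : Env} (h : Regular ω) (hT : ∀ i, phantomTime ω i < ∞) :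
    pwitTree ∞ ω = componentTree 0 0 ω := by
  ext1 i
  rw [pwitTree, componentTree, (h.oldName_top hT i).1]
  congr 1
  ext1 v
  cases v <;> simp [label]

/-- The component at time `t` arises by cutting the final component. -/
theorem Regular.pwitTree_eq_cut {ω : Env} (h : Regular ω) {t : ℝ≥0∞}
    (ht : ∀ i k, (ω i).1 k ≠ t.toReal) : pwitTree t ω = cut t (pwitTree ∞ ω) := by
  classical
  -- No label equals `t`; this reconciles the weak inequality in `InComponent` with the strict one
  -- in `cut`.
  have hlt : ∀ i k, ENNReal.ofReal ((ω i).1 k) ≤ t ↔ ENNReal.ofReal ((ω i).1 k) < t := by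
    refine fun i k => ⟨fun hle => lt_of_le_of_ne hle fun hc => ht i k ?_, le_of_lt⟩
    have hpos : 0 < (ω i).1 k := h.label_pos (e := k :: i) (by simp)
    rw [← hc, ENNReal.toReal_ofReal hpos.le]
  -- Siblings kept at time `t` form an initial segment, so a vertex that survives has the same new
  -- name at time `t` as at time `∞`.
  have key : ∀ i, (oldName (InComponent ω t) i = none ∧ cut t (pwitTree ∞ ω) i = none) ∨
      ∃ v, oldName (InComponent ω t) i = some v ∧ oldName (InComponent ω ∞) i = some v ∧
        InComponent ω t v ∧ InComponent ω ∞ v ∧ cut t (pwitTree ∞ ω) i =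
          some (label ω v, (phantomTime ω v).toReal, constraint ω v) := by
    intro i
    induction i with
    | nil => exact Or.inr ⟨[], rfl, rfl, trivial, trivial, rfl⟩
    | cons k i ih =>
      rcases ih with ⟨h1, h2⟩ | ⟨v, h1, h2, h3, h4, h5⟩
      · refine Or.inl ⟨?_, ?_⟩
        · rw [oldName, h1]; rfl
        · rw [cut, h2]; rfl
      · have hA : (fun j => InComponent ω t (j :: v)) = fun j => InComponent ω ∞ (j :: v) ∧
            ENNReal.ofReal ((ω v).1 j) ≤ t := by
          ext j
          rw [inComponent_top_iff, and_iff_right h4]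
          simp only [InComponent, h3, true_and]
          rfl
        have hr : ∀ i j, i ≤ j → ENNReal.ofReal ((ω v).1 j) ≤ t →
            ENNReal.ofReal ((ω v).1 i) ≤ t := fun i j hij hj =>
          (ENNReal.ofReal_le_ofReal ((h.strictMono v).monotone hij)).trans hj
        have hN : HasNth (fun j => InComponent ω t (j :: v)) k ↔
            HasNth (fun j => InComponent ω ∞ (j :: v)) k ∧
              ENNReal.ofReal ((ω v).1 (Nat.nth (fun j => InComponent ω ∞ (j :: v)) k)) ≤ t := by
          rw [hA, hasNth_and_iff hr]
        have ho : ∀ s, oldName (InComponent ω s) i = some v → oldName (InComponent ω s) (k :: i) =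
            if HasNth (fun j => InComponent ω s (j :: v)) k then
              some (Nat.nth (fun j => InComponent ω s (j :: v)) k :: v) else none := by
          intro s hs
          rw [oldName, hs, Option.bind_some]
          exact if_congr hasNth_iff_encard.symm rfl rfl
        have hot := ho t h1
        have hoi := ho ∞ h2
        have hcut : cut t (pwitTree ∞ ω) (k :: i) = (pwitTree ∞ ω (k :: i)).bind fun m =>
            if ENNReal.ofReal m.1 < t then some m else none := by
          rw [cut, h5]; rfl
        by_cases hi : HasNth (fun j => InComponent ω ∞ (j :: v)) k
        · rw [if_pos hi] at hoi
          have htree : pwitTree ∞ ω (k :: i) = some (label ω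
              (Nat.nth (fun j => InComponent ω ∞ (j :: v)) k :: v),
              (phantomTime ω (Nat.nth (fun j => InComponent ω ∞ (j :: v)) k :: v)).toReal,
              constraint ω (Nat.nth (fun j => InComponent ω ∞ (j :: v)) k :: v)) := by
            rw [pwitTree, hoi]; rfl
          rw [htree, Option.bind_some] at hcut
          by_cases hle : ENNReal.ofReal
              ((ω v).1 (Nat.nth (fun j => InComponent ω ∞ (j :: v)) k)) ≤ t
          · have hNt := hN.2 ⟨hi, hle⟩
            have hnth : Nat.nth (fun j => InComponent ω t (j :: v)) k =
                Nat.nth (fun j => InComponent ω ∞ (j :: v)) k := by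
              have hNt' := hNt
              rw [hA] at hNt' ⊢
              exact nth_and_eq hr hNt'
            rw [if_pos hNt] at hot
            refine Or.inr ⟨_, hot, ?_, hNt.nth_mem, ?_, ?_⟩
            · rw [hnth, hoi]
            · rw [hnth]; exact hi.nth_mem
            · rw [hcut, hnth]
              exact if_pos ((hlt _ _).1 hle)
          · rw [if_neg fun hc => hle (hN.1 hc).2] at hot
            refine Or.inl ⟨hot, ?_⟩
            rw [hcut]
            exact if_neg fun hc => hle (le_of_lt hc)
        · rw [if_neg hi] at hoi
          rw [if_neg fun hc => hi (hN.1 hc).1] at hot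
          refine Or.inl ⟨hot, ?_⟩
          rw [hcut, pwitTree, hoi]
          rfl
  ext1 i
  rcases key i with ⟨h1, h2⟩ | ⟨v, h1, -, -, -, h5⟩
  · rw [h2, pwitTree, h1]; rfl
  · rw [h5, pwitTree, h1]; rfl

theorem measurable_cut (t : ℝ≥0∞) : Measurable (cut t) := by
  refine measurable_pi_lambda _ fun l => ?_
  induction l with
  | nil => exact measurable_pi_apply []
  | cons j i ih =>
    have hbind : Measurable fun y : Option Mark × Option Mark => y.1.bind fun _ => y.2.bind fun m =>
        open Classical in if ENNReal.ofReal m.1 < t then some m else none := by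
      classical
      have h1 : MeasurableSet {o : Option Mark | ∃ m, o = some m} :=
        show MeasurableSet (some ⁻¹' {o : Option Mark | ∃ m, o = some m}) by
          rw [eq_univ_of_forall (s := some ⁻¹' {o : Option Mark | ∃ m, o = some m})
            fun m => ⟨m, rfl⟩]
          exact MeasurableSet.univ
      have h2 : MeasurableSet {o : Option Mark | ∃ m, o = some m ∧ ENNReal.ofReal m.1 < t} := by
        change MeasurableSet (some ⁻¹' {o : Option Mark | ∃ m, o = some m ∧ ENNReal.ofReal m.1 < t})
        have : some ⁻¹' {o : Option Mark | ∃ m, o = some m ∧ ENNReal.ofReal m.1 < t} =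
            {m : Mark | ENNReal.ofReal m.1 < t} :=
          Set.ext fun m => ⟨fun ⟨m', h, h'⟩ => by obtain rfl := Option.some.inj h; exact h',
            fun h => ⟨m, rfl, h⟩⟩
        rw [this]
        exact measurableSet_lt (by fun_prop) measurable_const
      have : (fun y : Option Mark × Option Mark => y.1.bind fun _ => y.2.bind fun m =>
          if ENNReal.ofReal m.1 < t then some m else none) = fun y =>
          if (∃ m, y.1 = some m) ∧ ∃ m, y.2 = some m ∧ ENNReal.ofReal m.1 < t then y.2
          else none := by
        ext1 ⟨y1, y2⟩
        cases y1 <;> cases y2 <;> simp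
      refine this ▸ Measurable.ite ?_ measurable_snd measurable_const
      exact (measurable_fst h1).inter (measurable_snd h2)
    exact hbind.comp (ih.prodMk (measurable_pi_apply (j :: i)))

/-! ### A measurable version of the component of the root -/

section MeasTree

variable {p : PMF ℕ} (hp0 : p 0 = 0) (hp1 : p 1 = 0)

/-- The almost sure properties of the environment under which the measurable versions agree with
the original objects. -/
structure Typical (ω : Env) : Prop where
  regular : Regular ω
  measTime_eq : ∀ i, measTime hp0 hp1 (subtree ω i) = phantomTime ω i
  lt_top : ∀ i, phantomTime ω i < ∞

theorem ae_typical {Δ : ℕ} (hΔ : ∀ k, Δ < k → p k = 0) :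
    ∀ᵐ ω ∂pwitLaw p, Typical hp0 hp1 ω := by
  filter_upwards [ae_regular hp0 hp1, ae_measTime_eq hp0 hp1, ae_phantomTime_lt_top hp0 hp1 hΔ]
    with ω h1 h2 h3
  exact ⟨h1, h2, h3⟩

variable {hp0 hp1}

theorem Typical.subtree {ω : Env} (h : Typical hp0 hp1 ω) (i : List ℕ) :
    Typical hp0 hp1 (subtree ω i) where
  regular := h.regular.subtree i
  measTime_eq j := by rw [subtree_subtree, h.measTime_eq, phantomTime_subtree]
  lt_top j := by rw [phantomTime_subtree]; exact h.lt_top _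

theorem Typical.measTime_root {ω : Env} (h : Typical hp0 hp1 ω) :
    measTime hp0 hp1 ω = phantomTime ω [] := by
  have := h.measTime_eq []
  rwa [subtree_nil] at this

variable (hp0 hp1)

/-- The measurable version of `Available` for the children of the root. -/
def Early (ω : Env) (j : ℕ) : Prop :=
  ((ω []).1 j, RDCP.subtree ω [j]) ∈ early (measTime hp0 hp1)

theorem measurableSet_Early (j : ℕ) : MeasurableSet {ω | Early hp0 hp1 ω j} :=
  (show Measurable fun ω : Env => ((ω []).1 j, RDCP.subtree ω [j]) by fun_prop)
    (measurableSet_early (measurable_measTime hp0 hp1))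

variable {hp0 hp1} in
theorem Typical.early_eq {ω : Env} (h : Typical hp0 hp1 ω) :
    Early hp0 hp1 ω = Available ω [] := by
  ext j
  change ENNReal.ofReal ((ω []).1 j) < measTime hp0 hp1 (RDCP.subtree ω [j]) ↔ _
  rw [h.measTime_eq]
  rfl

/-- The measurable version of the first `n` generations of the component of the root. -/
def measTree : ℕ → ℕ → ℝ → Env → DecoratedTree
  | 0, _, x, ω => join (some (x, (measTime hp0 hp1 ω).toReal, (ω []).2)) fun _ _ => none
  | n + 1, b, x, ω => join (some (x, (measTime hp0 hp1 ω).toReal, (ω []).2)) fun k =>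
      if k < (ω []).2 - b then
        measTree n 1 ((ω []).1 (Nat.nth (Early hp0 hp1 ω) k))
          (RDCP.subtree ω [Nat.nth (Early hp0 hp1 ω) k])
      else fun _ => none

theorem measTree_nil (n b : ℕ) (x : ℝ) (ω : Env) :
    measTree hp0 hp1 n b x ω [] = some (x, (measTime hp0 hp1 ω).toReal, (ω []).2) := by
  cases n <;> simp [measTree]

variable {hp0 hp1} in
theorem Typical.measTree_eq {ω : Env} (h : Typical hp0 hp1 ω) (n b : ℕ) (x : ℝ) :
    measTree hp0 hp1 n b x ω = trunc n (componentTree b x ω) := by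
  induction n generalizing ω b x with
  | zero =>
    rw [trunc_zero, measTree, h.measTime_root]
    rfl
  | succ n ih =>
    rw [componentTree_eq_join, trunc_join, measTree, h.measTime_root, h.early_eq]
    congr 1
    ext1 k
    split_ifs
    · exact ih (h.subtree _) _ _
    · exact (trunc_none n).symm

theorem measurable_measTree (n b : ℕ) :
    Measurable fun y : ℝ × Env => measTree hp0 hp1 n b y.1 y.2 := by
  induction n generalizing b with
  | zero =>
    exact measurable_join.comp (Measurable.prodMk (measurable_some.comp (by fun_prop))
      measurable_const)
  | succ n ih =>
    refine measurable_join.comp (Measurable.prodMk (measurable_some.comp (by fun_prop)) ?_)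
    refine measurable_pi_lambda _ fun k => Measurable.ite ?_ ?_ measurable_const
    · exact measurableSet_lt measurable_const
        ((measurable_of_countable fun d : ℕ => d - b).comp (by fun_prop))
    · exact measurable_comp_nth (p := fun (y : ℝ × Env) j => Early hp0 hp1 y.2 j)
        (fun j => measurable_snd (measurableSet_Early hp0 hp1 j)) k
        (g := fun y j => measTree hp0 hp1 n 1 ((y.2 []).1 j) (RDCP.subtree y.2 [j]))
        fun j => (ih 1).comp (show Measurable fun y : ℝ × Env =>
          ((y.2 []).1 j, RDCP.subtree y.2 [j]) by fun_prop)

end MeasTree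

/-! ### The family tree of the branching process -/

section TreeKernel

variable (p : PMF ℕ) (lam : ℝ → ℝ)

theorem measurable_join_const : Measurable fun o : Option Mark => join o fun _ _ => none :=
  measurable_join.comp (measurable_id.prodMk (measurable_const (a := fun _ _ => none)))

/-- The law of the first `n` generations of the family tree of the descendants of the string `i`,
given its mark. -/
def treeKernelAux : ℕ → List ℕ → {κ : Kernel (Option Mark) DecoratedTree // IsMarkovKernel κ}
  | 0, _ => ⟨Kernel.deterministic (fun o => join o fun _ _ => none) measurable_join_const,
      inferInstance⟩
  | n + 1, i =>
    -- The Markov property travels with the kernel in a subtype, since `coordKernel` needs it inside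
    -- the recursion.
    have (j : ℕ) : IsMarkovKernel (treeKernelAux n (j :: i)).1 := (treeKernelAux n (j :: i)).2
    ⟨(Kernel.id ×ₖ (coordKernel (fun j : ℕ => (treeKernelAux n (j :: i)).1) ∘ₖ
      reproduction p lam i)).map fun y => join y.1 y.2, Kernel.IsMarkovKernel.map _ measurable_join⟩

/-- The law of the first `n` generations of the family tree of the descendants of the string `i`,
given its mark. -/
def treeKernel (n : ℕ) (i : List ℕ) : Kernel (Option Mark) DecoratedTree :=
  (treeKernelAux p lam n i).1

instance (n : ℕ) (i : List ℕ) : IsMarkovKernel (treeKernel p lam n i) :=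
  (treeKernelAux p lam n i).2

theorem treeKernel_zero (i : List ℕ) (o : Option Mark) :
    treeKernel p lam 0 i o = Measure.dirac (join o fun _ _ => none) :=
  Kernel.deterministic_apply measurable_join_const o

theorem measurable_join_left (o : Option Mark) : Measurable (join o) :=
  measurable_join.comp (measurable_const.prodMk measurable_id)

theorem treeKernel_succ (n : ℕ) (i : List ℕ) (o : Option Mark) :
    treeKernel p lam (n + 1) i o =
      ((reproduction p lam i o).bind (coordKernel fun j => treeKernel p lam n (j :: i))).map
        (join o) := by
  have h : treeKernel p lam (n + 1) i =
      (Kernel.id ×ₖ (coordKernel (fun j : ℕ => treeKernel p lam n (j :: i)) ∘ₖ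
        reproduction p lam i)).map fun y => join y.1 y.2 := rfl
  rw [h, Kernel.map_apply _ measurable_join, Kernel.prod_apply, Kernel.id_apply,
    Measure.dirac_prod, Measure.map_map measurable_join (by fun_prop), Kernel.comp_apply]
  rfl

theorem lintegral_treeKernel_succ (n : ℕ) (i : List ℕ) (o : Option Mark)
    {φ : DecoratedTree → ℝ≥0∞} (hφ : Measurable φ) :
    ∫⁻ x, φ x ∂treeKernel p lam (n + 1) i o = ∫⁻ c, ∫⁻ w, φ (join o w)
      ∂(Measure.infinitePi fun j => treeKernel p lam n (j :: i) (c j)) ∂reproduction p lam i o := by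
  rw [treeKernel_succ, lintegral_map hφ (measurable_join_left o),
    Measure.lintegral_bind (Kernel.aemeasurable _)
      (show AEMeasurable (fun w => φ (join o w)) _ from
        (hφ.comp (measurable_join_left o)).aemeasurable)]
  rfl

instance : MeasurableSingletonClass (Option Mark) := by
  refine ⟨fun o => ?_⟩
  change MeasurableSet (some ⁻¹' {o})
  cases o with
  | none =>
    rw [show some ⁻¹' {(none : Option Mark)} = ∅ by ext; simp]
    exact MeasurableSet.empty
  | some m =>
    rw [show some ⁻¹' {some m} = {m} by
      ext x; exact ⟨fun h => Option.some.inj h, fun h => congrArg some h⟩]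
    exact measurableSet_singleton m

theorem ae_treeKernel_nil (n : ℕ) (i : List ℕ) (o : Option Mark) :
    ∀ᵐ x ∂treeKernel p lam n i o, x [] = o := by
  have hset : MeasurableSet {x : DecoratedTree | x [] = o} :=
    (show Measurable fun x : DecoratedTree => x [] from measurable_pi_apply [])
      (measurableSet_singleton o)
  cases n with
  | zero =>
    rw [treeKernel_zero, ae_dirac_iff hset, join_nil]
  | succ n =>
    rw [treeKernel_succ, ae_map_iff (measurable_join_left o).aemeasurable hset]
    exact Filter.Eventually.of_forall fun w => join_nil o w

/-- One generation of a family of independent trees. -/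
theorem lintegral_infinitePi_treeKernel_succ (n : ℕ) (x : DecoratedTree)
    {Φ : (List ℕ → DecoratedTree) → ℝ≥0∞} (hΦ : Measurable Φ) :
    ∫⁻ S, Φ S ∂(Measure.infinitePi fun i => treeKernel p lam (n + 1) i (x i)) =
      ∫⁻ y, ∫⁻ S, Φ (fun i => join (x i) fun j => S (j :: i))
        ∂(Measure.infinitePi fun i => treeKernel p lam n i (y i)) ∂stepKernel p lam x := by
  have hj : Measurable fun (w : List ℕ → ℕ → DecoratedTree) i => join (x i) (w i) :=
    measurable_pi_lambda _ fun i => (measurable_join_left (x i)).comp (measurable_pi_apply i)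
  have hc : Measurable fun (S : List ℕ → DecoratedTree) (i : List ℕ) (j : ℕ) => S (j :: i) := by
    fun_prop
  -- The nonempty strings `j :: i` are reindexed by pairs `(i, j)`; the empty string is not a vertex
  -- of a next generation and is dropped.
  have h1 : ∀ y : List ℕ → ℕ → Option Mark,
      (Measure.infinitePi fun l => treeKernel p lam n l (nextGeneration y l)).map
        (fun S i j => S (j :: i)) =
      coordKernel (fun i => coordKernel fun j => treeKernel p lam n (j :: i)) y := by
    intro y
    let f : List ℕ × ℕ → List ℕ := fun q => q.2 :: q.1
    have hf : Function.Injective f := by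
      rintro ⟨a, b⟩ ⟨c, d⟩ h
      simp only [f, List.cons.injEq] at h
      rw [h.1, h.2]
    have h2 := Measure.map_infinitePi_infinitePi_of_inj
      (P := fun l => treeKernel p lam n l (nextGeneration y l)) hf
    have h3 := Measure.infinitePi_map_curry
      (fun (i : List ℕ) (j : ℕ) => treeKernel p lam n (j :: i) (y i j))
    rw [show (Measure.infinitePi fun q : List ℕ × ℕ => treeKernel p lam n (q.2 :: q.1) (y q.1 q.2))
      = _ from h2.symm, Measure.map_map (by fun_prop) (by fun_prop)] at h3
    exact h3
  have hm1 : Measurable (nextGeneration : (List ℕ → ℕ → Option Mark) → DecoratedTree) := by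
    refine measurable_pi_lambda _ fun l => ?_
    cases l with
    | nil => exact measurable_const
    | cons j i => exact (measurable_pi_apply j).comp (measurable_pi_apply i)
  have hm2 : Measurable fun y : DecoratedTree => ∫⁻ S, Φ (fun i => join (x i) fun j => S (j :: i))
      ∂(Measure.infinitePi fun i => treeKernel p lam n i (y i)) :=
    Measurable.lintegral_kernel (κ := coordKernel fun i => treeKernel p lam n i)
      (hΦ.comp (hj.comp hc))
  simp_rw [treeKernel_succ]
  have h4 : ∀ i : List ℕ, IsProbabilityMeasure ((reproduction p lam i (x i)).bind
      (coordKernel fun j => treeKernel p lam n (j :: i))) := fun i => inferInstance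
  rw [← Measure.infinitePi_map_pi _ fun i => measurable_join_left (x i), lintegral_map hΦ hj,
    ← infinitePi_bind (fun i => reproduction p lam i (x i))
      (fun i => coordKernel fun j => treeKernel p lam n (j :: i)),
    Measure.lintegral_bind (Kernel.aemeasurable _)
      (show AEMeasurable (fun w : List ℕ → ℕ → DecoratedTree => Φ fun i => join (x i) (w i)) _ from
        (hΦ.comp hj).aemeasurable), stepKernel,
    Kernel.map_apply _ hm1, lintegral_map hm2 hm1]
  refine lintegral_congr fun y => ?_
  rw [← h1, lintegral_map (f := fun w : List ℕ → ℕ → DecoratedTree => Φ fun i => join (x i) (w i))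
    (hΦ.comp hj) hc]

/-- The tree with generations `g 0, …, g (m - 1)` and the trees `S i` attached to the strings of
length `m`. -/
def assemble (m : ℕ) (g : ℕ → DecoratedTree) (S : List ℕ → DecoratedTree) : DecoratedTree :=
  fun l => if l.length < m then g l.length l else
    S (l.drop (l.length - m)) (l.take (l.length - m))

theorem measurable_assemble (m : ℕ) :
    Measurable fun y : (ℕ → DecoratedTree) × (List ℕ → DecoratedTree) => assemble m y.1 y.2 := by
  refine measurable_pi_lambda _ fun l => ?_
  unfold assemble
  split_ifs <;> fun_prop

theorem assemble_join (m : ℕ) (g : ℕ → DecoratedTree) (S : List ℕ → DecoratedTree) :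
    assemble m g (fun i => join (g m i) fun j => S (j :: i)) = assemble (m + 1) g S := by
  ext1 l
  unfold assemble
  rcases lt_trichotomy l.length m with h | h | h
  · rw [if_pos h, if_pos (by omega)]
  · rw [if_neg (by omega), if_pos (by omega), h]
    simp
  · rw [if_neg (by omega), if_neg (by omega)]
    obtain ⟨k, hk⟩ : ∃ k, l.length - m = k + 1 := ⟨l.length - m - 1, by omega⟩
    have hk' : l.length - (m + 1) = k := by omega
    have hlt : k < l.length := by omega
    rw [hk, hk', List.take_add_one, List.getElem?_eq_getElem hlt, Option.toList_some,
      List.drop_eq_getElem_cons hlt]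
    exact join_append _ _ _ _

theorem assemble_congr {m : ℕ} {g g' : ℕ → DecoratedTree} (h : ∀ k < m, g k = g' k)
    (S : List ℕ → DecoratedTree) : assemble m g S = assemble m g' S := by
  ext1 l
  unfold assemble
  split_ifs with hl
  · rw [h _ hl]
  · rfl

instance (n : ℕ) : IsMarkovKernel ((fun n => (stepKernel p lam).comap
      (fun x : (_ : Finset.Iic n) → DecoratedTree => x ⟨n, Finset.mem_Iic.2 le_rfl⟩)
      (measurable_pi_apply _)) n) := inferInstance

theorem map_generationsLaw_zero :
    (generationsLaw p lam).map (fun g => g 0) = rootLaw p lam := by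
  have h : (fun g : ℕ → DecoratedTree => g 0) =
      (MeasurableEquiv.piUnique fun _ : Finset.Iic 0 => DecoratedTree) ∘ Preorder.frestrictLe 0 :=
    rfl
  rw [h, ← Measure.map_map (by fun_prop) (by fun_prop), generationsLaw, Kernel.trajMeasure,
    Measure.map_comp _ _ (by fun_prop), Kernel.traj_map_frestrictLe, Kernel.partialTraj_self,
    Measure.id_comp, Measure.map_map (by fun_prop) (by fun_prop)]
  exact Measure.map_id

variable [IsProbabilityMeasure (rootLaw p lam)]

instance : IsProbabilityMeasure (generationsLaw p lam) := by
  unfold generationsLaw; infer_instance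

/-- The Markov property of the chain of generations, with the whole past kept in the test function.
-/
theorem lintegral_generationsLaw_succ (m : ℕ)
    {F : ((_ : Finset.Iic m) → DecoratedTree) × DecoratedTree → ℝ≥0∞} (hF : Measurable F) :
    ∫⁻ g, F (Preorder.frestrictLe m g, g (m + 1)) ∂generationsLaw p lam =
      ∫⁻ g, ∫⁻ y, F (Preorder.frestrictLe m g, y) ∂stepKernel p lam (g m) ∂generationsLaw p lam := by
  have h := Kernel.map_frestrictLe_trajMeasure_compProd_eq_map_trajMeasure
    (X := fun _ => DecoratedTree) (μ₀ := rootLaw p lam) (κ := fun n => (stepKernel p lam).comap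
      (fun x : (_ : Finset.Iic n) → DecoratedTree => x ⟨n, Finset.mem_Iic.2 le_rfl⟩)
      (measurable_pi_apply _)) (a := m)
  have h1 := congrArg (fun μ => ∫⁻ z, F z ∂μ) h
  rw [Measure.lintegral_compProd hF, lintegral_map (Measurable.lintegral_kernel_prod_right' hF)
    (by fun_prop), lintegral_map hF (by fun_prop)] at h1
  exact h1.symm

/-- One generation is exchanged between the two descriptions: it may be the first level of the
independent trees or the next step of the chain. -/
theorem lintegral_assemble_succ (m n : ℕ) {φ : DecoratedTree → ℝ≥0∞} (hφ : Measurable φ) :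
    ∫⁻ g, ∫⁻ S, φ (assemble m g S) ∂(Measure.infinitePi fun i => treeKernel p lam (n + 1) i (g m i))
      ∂generationsLaw p lam =
    ∫⁻ g, ∫⁻ S, φ (assemble (m + 1) g S)
      ∂(Measure.infinitePi fun i => treeKernel p lam n i (g (m + 1) i)) ∂generationsLaw p lam := by
  -- The past is padded with empty generations to fit `assemble`, which never reads the padding.
  let ext' : ((_ : Finset.Iic m) → DecoratedTree) → ℕ → DecoratedTree := fun g k =>
    if h : k ≤ m then g ⟨k, Finset.mem_Iic.2 h⟩ else fun _ => none
  have hext : Measurable ext' := by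
    refine measurable_pi_lambda _ fun k => ?_
    simp only [ext']
    split_ifs
    · exact measurable_pi_apply _
    · exact measurable_const
  have hext' : ∀ (g : ℕ → DecoratedTree) S,
      assemble (m + 1) (ext' (Preorder.frestrictLe m g)) S = assemble (m + 1) g S := by
    intro g S
    refine assemble_congr (fun k hk => ?_) S
    simp only [ext', dif_pos (Nat.lt_succ_iff.1 hk)]
    rfl
  have hF := lintegral_generationsLaw_succ p lam m
    (F := fun z => ∫⁻ S, φ (assemble (m + 1) (ext' z.1) S)
      ∂(Measure.infinitePi fun i => treeKernel p lam n i (z.2 i))) ?_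
  · simp only [hext'] at hF
    rw [hF]
    refine lintegral_congr fun g => ?_
    rw [lintegral_infinitePi_treeKernel_succ p lam n (g m) (Φ := fun S => φ (assemble m g S))
      (hφ.comp ((measurable_assemble m).comp (measurable_const.prodMk measurable_id)))]
    simp only [assemble_join]
  · exact Measurable.lintegral_kernel_prod_right'
      (κ := (coordKernel fun i => treeKernel p lam n i).comap
        (fun z : ((_ : Finset.Iic m) → DecoratedTree) × DecoratedTree => z.2) measurable_snd)
      (f := fun y => φ (assemble (m + 1) (ext' y.1.1) y.2))
      (hφ.comp ((measurable_assemble (m + 1)).comp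
        ((hext.comp (measurable_fst.comp measurable_fst)).prodMk measurable_snd)))

/-- The law of the first `n` generations of the branching process. -/
theorem lintegral_trunc_mtbpLaw (n : ℕ) {φ : DecoratedTree → ℝ≥0∞} (hφ : Measurable φ) :
    ∫⁻ x, φ (trunc n x) ∂mtbpLaw p lam =
      ∫⁻ m, ∫⁻ x, φ x ∂treeKernel p lam n [] (some (0, m)) ∂typeConstraintLaw p lam := by
  -- The integral is constant along `m + k = n`. At `m = n` all generations come from the chain, at
  -- `m = 0` from the tree kernel of the root.
  have h1 : ∀ m k, m + k = n → ∫⁻ g, ∫⁻ S, φ (assemble m g S)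
      ∂(Measure.infinitePi fun i => treeKernel p lam k i (g m i)) ∂generationsLaw p lam =
      ∫⁻ x, φ (trunc n x) ∂mtbpLaw p lam := by
    intro m k hmk
    induction k generalizing m with
    | zero =>
      obtain rfl : m = n := by omega
      simp_rw [treeKernel_zero, Measure.infinitePi_dirac]
      have hgen : Measurable fun (g : ℕ → DecoratedTree) (l : List ℕ) => g l.length l := by fun_prop
      rw [mtbpLaw, lintegral_map (f := fun x => φ (trunc m x)) (hφ.comp (measurable_trunc m)) hgen]
      refine lintegral_congr fun g => ?_
      rw [lintegral_dirac' (f := fun S => φ (assemble m g S)) _ (hφ.comp ((measurable_assemble m).comp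
        (measurable_const.prodMk measurable_id)))]
      congr 1
      rw [assemble_join m g fun _ _ => none]
      ext1 l
      simp [assemble, trunc]
    | succ k ih => rw [lintegral_assemble_succ p lam m k hφ, ih (m + 1) (by omega)]
  rw [← h1 0 n (by omega)]
  have h2 : ∀ (g : ℕ → DecoratedTree) S, assemble 0 g S = S [] := by
    intro g S; ext1 l; simp [assemble]
  simp_rw [h2]
  have h3 : ∀ x : DecoratedTree, ∫⁻ S, φ (S [])
      ∂(Measure.infinitePi fun i => treeKernel p lam n i (x i)) =
      ∫⁻ y, φ y ∂treeKernel p lam n [] (x []) := fun x =>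
    (measurePreserving_eval_infinitePi (fun i => treeKernel p lam n i (x i)) []).lintegral_comp hφ
  have h4 : Measurable fun o => ∫⁻ y, φ y ∂treeKernel p lam n [] o := hφ.lintegral_kernel
  simp_rw [h3]
  have h5 : Measurable fun (y : ℝ × ℕ) (l : List ℕ) => if l = [] then some ((0 : ℝ), y.1, y.2)
      else none := by
    refine measurable_pi_lambda _ fun l => ?_
    split_ifs
    · exact measurable_some.comp (by fun_prop)
    · exact measurable_const
  rw [← lintegral_map (f := fun x : DecoratedTree => ∫⁻ y, φ y ∂treeKernel p lam n [] (x []))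
    (h4.comp (measurable_pi_apply [])) (measurable_pi_apply 0), map_generationsLaw_zero, rootLaw,
    lintegral_map (f := fun x : DecoratedTree => ∫⁻ y, φ y ∂treeKernel p lam n [] (x []))
      (h4.comp (measurable_pi_apply [])) h5]
  rfl

end TreeKernel

/-! ### The offspring of a vertex as an arrangement of independent trees -/

/-- The mark of the root of a tree. -/
def rootMark (x : DecoratedTree) : Mark := (x []).getD (0, 0, 0)

theorem measurable_rootMark : Measurable rootMark := by
  have h : Measurable fun o : Option Mark => o.getD (0, 0, 0) := fun s hs =>
    show MeasurableSet (some ⁻¹' ((fun o : Option Mark => o.getD (0, 0, 0)) ⁻¹' s)) from hs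
  exact h.comp (measurable_pi_apply [])

/-- The sequence of trees `w 0, …, w (n - 1)`, followed by `v` if `b = 0`. -/
def place (b n : ℕ) (w : Fin n → DecoratedTree) (v : DecoratedTree) (k : ℕ) : DecoratedTree :=
  if h : k < n then w ⟨k, h⟩ else if k = n ∧ b = 0 then v else fun _ => none

theorem measurable_place (b n : ℕ) :
    Measurable fun y : (Fin n → DecoratedTree) × DecoratedTree => place b n y.1 y.2 := by
  refine measurable_pi_lambda _ fun k => ?_
  unfold place
  split_ifs
  · fun_prop
  · exact measurable_snd
  · exact measurable_const

/-- The trees in increasing order of the labels of their roots. -/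
def sortTrees (n : ℕ) (w : Fin n → DecoratedTree) (k : Fin n) : DecoratedTree :=
  w (Tuple.sort (fun j => (rootMark (w j)).1) k)

theorem measurable_sortTrees (n : ℕ) : Measurable (sortTrees n) :=
  measurable_comp_sort (ℓ := fun x => (rootMark x).1) (measurable_fst.comp measurable_rootMark) n

/-- Replacing one factor of an infinite product. -/
theorem infinitePi_update {X : Type*} [MeasurableSpace X] (μ : ℕ → Measure X)
    [∀ i, IsProbabilityMeasure (μ i)] (ρ : Measure X) [IsProbabilityMeasure ρ] (n : ℕ)
    (μ' : ℕ → Measure X) [∀ i, IsProbabilityMeasure (μ' i)] (hn : μ' n = ρ)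
    (hne : ∀ i, i ≠ n → μ' i = μ i) :
    ((Measure.infinitePi μ).prod ρ).map (fun y k => if k = n then y.2 else y.1 k) =
      Measure.infinitePi μ' := by
  have hm : Measurable fun (y : (ℕ → X) × X) k => if k = n then y.2 else y.1 k := by
    refine measurable_pi_lambda _ fun k => ?_
    split_ifs
    · exact measurable_snd
    · exact (measurable_pi_apply k).comp measurable_fst
  refine Measure.eq_infinitePi _ fun s t ht => ?_
  rw [Measure.map_apply hm (MeasurableSet.pi s.countable_toSet fun i _ => ht i)]
  have hpre : (fun (y : (ℕ → X) × X) k => if k = n then y.2 else y.1 k) ⁻¹' (Set.pi s t) =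
      (Set.pi (s.erase n) t) ×ˢ (if n ∈ s then t n else univ) := by
    ext ⟨w, v⟩
    simp only [mem_preimage, mem_pi, mem_prod, Finset.mem_coe, Finset.mem_erase]
    constructor
    · refine fun h => ⟨fun i hi => by simpa [hi.1] using h i hi.2, ?_⟩
      split_ifs with hns
      · simpa using h n hns
      · trivial
    · rintro ⟨h1, h2⟩ i hi
      by_cases hin : i = n
      · subst hin
        simpa [hi] using h2
      · simpa [hin] using h1 i ⟨hin, hi⟩
  rw [hpre, Measure.prod_prod, Measure.infinitePi_pi _ fun i _ => ht _]
  have h2 : ∏ i ∈ s.erase n, μ i (t i) = ∏ i ∈ s.erase n, μ' i (t i) :=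
    Finset.prod_congr rfl fun i hi => by rw [hne i (Finset.ne_of_mem_erase hi)]
  rw [h2]
  split_ifs with hns
  · rw [← Finset.prod_erase_mul s _ hns, hn]
  · rw [measure_univ, mul_one, Finset.erase_eq_of_notMem hns]

section Arrange

variable (p : PMF ℕ) (lam : ℝ → ℝ)

theorem treeKernel_none (n : ℕ) (i : List ℕ) :
    treeKernel p lam n i none = Measure.dirac fun _ => none := by
  induction n generalizing i with
  | zero => rw [treeKernel_zero, join_none]
  | succ n ih =>
    have h : reproduction p lam i none = Measure.dirac fun _ => none := rfl
    rw [treeKernel_succ, h, Measure.dirac_bind (Kernel.measurable _), coordKernel_apply]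
    simp_rw [ih]
    rw [Measure.infinitePi_dirac, Measure.map_dirac' (measurable_join_left none), join_none]

theorem treeKernel_eq (n : ℕ) {i j : List ℕ} (hi : i ≠ []) (hj : j ≠ []) :
    treeKernel p lam n i = treeKernel p lam n j := by
  induction n generalizing i j with
  | zero => ext1 o; rw [treeKernel_zero, treeKernel_zero]
  | succ n ih =>
    have hr : reproduction p lam i = reproduction p lam j := by
      rw [reproduction, reproduction, if_neg hi, if_neg hj]
    ext o s hs
    rw [← lintegral_indicator_one hs, ← lintegral_indicator_one hs,
      lintegral_treeKernel_succ _ _ _ _ _ (measurable_one.indicator hs),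
      lintegral_treeKernel_succ _ _ _ _ _ (measurable_one.indicator hs), hr]
    simp_rw [fun k => ih (List.cons_ne_nil k i) (List.cons_ne_nil k j)]

/-- The law of the first `n` generations of the descendants of a vertex other than the root,
given its mark. -/
def branch (n : ℕ) : Kernel Mark DecoratedTree :=
  (treeKernel p lam n [0]).comap some measurable_some

instance (n : ℕ) : IsMarkovKernel (branch p lam n) := by unfold branch; infer_instance

theorem treeKernel_cons_some (n k : ℕ) (i : List ℕ) (m : Mark) :
    treeKernel p lam n (k :: i) (some m) = branch p lam n m := by
  rw [treeKernel_eq p lam n (List.cons_ne_nil k i) (List.cons_ne_nil 0 [])]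
  rfl

theorem ae_branch (n : ℕ) (m : Mark) : ∀ᵐ x ∂branch p lam n m, rootMark x = m := by
  filter_upwards [ae_treeKernel_nil p lam n [0] (some m)] with x hx
  rw [rootMark, hx]
  rfl

/-- Independent trees with the marks of their roots sampled from `childKernel`. -/
def childTrees (n : ℕ) : Kernel ℝ (ℕ → DecoratedTree) :=
  piKernel fun _ => branch p lam n ∘ₖ childKernel p lam

instance (n : ℕ) : IsMarkovKernel (childTrees p lam n) := by unfold childTrees; infer_instance

/-- The tree of the last child of the root. -/
def lastTree (n : ℕ) : Kernel ℝ DecoratedTree := branch p lam n ∘ₖ lastChildKernel p lam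

instance (n : ℕ) : IsMarkovKernel (lastTree p lam n) := by unfold lastTree; infer_instance

variable {p lam}

/-- Sorting the marks and attaching trees to them is the same as attaching trees to the marks and
sorting the trees. -/
theorem infinitePi_treeKernel_sorted (n N : ℕ) (i : List ℕ) (y : ℕ → Mark) :
    Measure.infinitePi (fun k => treeKernel p lam n (k :: i) (sorted N y k)) =
      (Measure.infinitePi fun k => branch p lam n (y k)).map fun w =>
        place 1 N (sortTrees N fun j => w j) fun _ => none := by
  let σ := Tuple.sort fun j : Fin N => (y j).1
  -- Continuing by the identity keeps `s` injective, so that it preserves independence; the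
  -- coordinates from `N` on are erased anyway.
  let s : ℕ → ℕ := fun k => if h : k < N then σ ⟨k, h⟩ else k
  have hs : Function.Injective s := by
    intro a b hab
    simp only [s] at hab
    split_ifs at hab with h1 h2 h2
    · have := σ.injective (Fin.ext hab)
      simpa using this
    · exact absurd hab (by have := (σ ⟨a, h1⟩).2; omega)
    · exact absurd hab (by have := (σ ⟨b, h2⟩).2; omega)
    · exact hab
  have hf : ∀ k, Measurable fun x : DecoratedTree => if k < N then x else fun _ => none := by
    intro k
    split_ifs
    · exact measurable_id
    · exact measurable_const
  have h1 : (Measure.infinitePi fun k => branch p lam n (y k)).map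
      (fun w k => if k < N then w (s k) else fun _ => none) =
      Measure.infinitePi fun k => treeKernel p lam n (k :: i) (sorted N y k) := by
    have h2 := Measure.map_infinitePi_infinitePi_of_inj
      (P := fun k => branch p lam n (y k)) hs
    have h3 := Measure.infinitePi_map_pi (fun k => branch p lam n (y (s k))) hf
    rw [← h2, Measure.map_map
      (show Measurable fun (x : ℕ → DecoratedTree) k => if k < N then x k else fun _ => none from
        measurable_pi_lambda _ fun k => (hf k).comp (measurable_pi_apply k)) (by fun_prop)] at h3
    refine Eq.trans h3 (congrArg _ (funext fun k => ?_))
    by_cases hk : k < N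
    · simp only [hk, if_true, Measure.map_id', sorted, dif_pos, s]
      rw [treeKernel_cons_some]
    · simp only [hk, if_false, Measure.map_const, measure_univ, one_smul, sorted, dif_neg,
        not_false_eq_true]
      rw [treeKernel_none]
  rw [← h1]
  refine Measure.map_congr ?_
  -- Almost surely the roots carry the marks `y`, so sorting the trees by their root labels is the
  -- permutation `σ`.
  have h4 : ∀ᵐ w ∂Measure.infinitePi fun k => branch p lam n (y k), ∀ k, rootMark (w k) = y k :=
    ae_all_iff.2 fun k => (measurePreserving_eval_infinitePi
      (fun k => branch p lam n (y k)) k).quasiMeasurePreserving.ae (ae_branch p lam n (y k))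
  filter_upwards [h4] with w hw
  ext1 k
  simp only [place, sortTrees, hw, s]
  by_cases hk : k < N <;> simp [hk, σ]

theorem lintegral_childTrees_eq (n : ℕ) (t : ℝ) {Φ : (ℕ → DecoratedTree) → ℝ≥0∞}
    (hΦ : Measurable Φ) : ∫⁻ w, Φ w ∂childTrees p lam n t =
      ∫⁻ y, ∫⁻ w, Φ w ∂(Measure.infinitePi fun k => branch p lam n (y k))
        ∂Measure.infinitePi fun _ : ℕ => childKernel p lam t := by
  have h : childTrees p lam n t = (Measure.infinitePi fun _ : ℕ => childKernel p lam t).bind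
      (coordKernel fun _ => branch p lam n) := by
    rw [infinitePi_bind, childTrees, piKernel_apply]
    rfl
  rw [h, Measure.lintegral_bind (Kernel.aemeasurable _) hΦ.aemeasurable]
  rfl

theorem lintegral_reproduction_cons (a t : ℝ) (N k : ℕ) (i : List ℕ)
    {Φ : (ℕ → Option Mark) → ℝ≥0∞} (hΦ : Measurable Φ) :
    ∫⁻ c, Φ c ∂reproduction p lam (k :: i) (some (a, t, N + 1)) =
      ∫⁻ y, Φ (sorted N y) ∂Measure.infinitePi fun _ : ℕ => childKernel p lam t := by
  have h : reproduction p lam (k :: i) (some (a, t, N + 1)) = offspring p lam (a, t, N + 1) := rfl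
  have hm : Measurable fun y : Mark × (ℕ → Mark) => sorted (y.1.2.2 - 1) y.2 :=
    measurable_sorted_uncurry (by fun_prop) (by fun_prop)
  rw [h, offspring, Kernel.map_apply _ hm, lintegral_map hΦ hm, Kernel.prod_apply, Kernel.id_apply,
    Measure.dirac_prod, lintegral_map (f := fun z : Mark × (ℕ → Mark) => Φ (sorted (z.1.2.2 - 1) z.2))
      (hΦ.comp hm) (by fun_prop)]
  rfl

theorem lintegral_reproduction_nil (a t : ℝ) (N : ℕ)
    {Φ : (ℕ → Option Mark) → ℝ≥0∞} (hΦ : Measurable Φ) :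
    ∫⁻ c, Φ c ∂reproduction p lam [] (some (a, t, N + 1)) =
      ∫⁻ m, ∫⁻ y, Φ (fun k => if k = N then some m else sorted N y k)
        ∂(Measure.infinitePi fun _ : ℕ => childKernel p lam t) ∂lastChildKernel p lam t := by
  have h : reproduction p lam [] (some (a, t, N + 1)) = rootOffspring p lam (a, t, N + 1) := rfl
  have hm : Measurable fun (y : Mark × (ℕ → Option Mark) × Mark) (k : ℕ) =>
      if k = y.1.2.2 - 1 then some y.2.2 else y.2.1 k := by
    refine measurable_pi_lambda _ fun k => ?_
    refine Measurable.ite ?_ (measurable_some.comp (by fun_prop)) (by fun_prop)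
    exact measurableSet_eq_fun measurable_const
      ((measurable_of_countable fun d : ℕ => d - 1).comp (by fun_prop))
  have hm2 : Measurable fun (y : (ℕ → Option Mark) × Mark) (k : ℕ) =>
      if k = N then some y.2 else y.1 k := by
    refine measurable_pi_lambda _ fun k => ?_
    split_ifs
    · exact measurable_some.comp measurable_snd
    · exact (measurable_pi_apply k).comp measurable_fst
  rw [h, rootOffspring, Kernel.map_apply _ hm, lintegral_map hΦ hm, Kernel.prod_apply,
    Kernel.id_apply, Measure.dirac_prod,
    lintegral_map (f := fun z : Mark × (ℕ → Option Mark) × Mark =>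
      Φ fun k => if k = z.1.2.2 - 1 then some z.2.2 else z.2.1 k) (hΦ.comp hm) (by fun_prop),
    Kernel.prod_apply]
  refine (lintegral_prod_symm _ (hΦ.comp hm2).aemeasurable).trans ?_
  refine lintegral_congr fun m => ?_
  exact lintegral_reproduction_cons (p := p) (lam := lam) a t N 0 []
    (Φ := fun c => Φ fun k => if k = N then some m else c k)
    (hΦ.comp (hm2.comp (measurable_id.prodMk measurable_const)))

theorem place_one_update (N : ℕ) (w : Fin N → DecoratedTree) (v : DecoratedTree) :
    (fun k => if k = N then v else place 1 N w (fun _ => none) k) = place 0 N w v := by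
  ext1 k
  unfold place
  rcases lt_trichotomy k N with h | h | h
  · simp [h, h.ne]
  · simp [h]
  · simp [h.ne', h.not_gt]

/-- The first generations of the descendants of a vertex in terms of independent trees. -/
theorem lintegral_treeKernel_succ_some {b : ℕ} {i : List ℕ}
    (hb : (b = 0 ∧ i = []) ∨ (b = 1 ∧ i ≠ [])) (n N : ℕ) (a t : ℝ) {φ : DecoratedTree → ℝ≥0∞}
    (hφ : Measurable φ) :
    ∫⁻ x, φ x ∂treeKernel p lam (n + 1) i (some (a, t, N + 1)) =
      ∫⁻ v, ∫⁻ w, φ (join (some (a, t, N + 1)) (place b N (sortTrees N fun j => w j) v))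
        ∂childTrees p lam n t ∂lastTree p lam n t := by
  have hres : Measurable fun (w : ℕ → DecoratedTree) => sortTrees N fun j : Fin N => w j :=
    (measurable_sortTrees N).comp (by fun_prop)
  have hpl : ∀ b, Measurable fun z : (ℕ → DecoratedTree) × DecoratedTree =>
      φ (join (some (a, t, N + 1)) (place b N (sortTrees N fun j => z.1 j) z.2)) := fun b =>
    hφ.comp ((measurable_join_left _).comp ((measurable_place b N).comp
      ((hres.comp measurable_fst).prodMk measurable_snd)))
  have hpl1 : ∀ b v, Measurable fun w : ℕ → DecoratedTree =>
      φ (join (some (a, t, N + 1)) (place b N (sortTrees N fun j => w j) v)) := fun b v =>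
    (hpl b).comp (measurable_id.prodMk measurable_const)
  have hp1 : Measurable fun w : ℕ → DecoratedTree =>
      place 1 N (sortTrees N fun j => w j) fun _ => none :=
    (measurable_place 1 N).comp (hres.prodMk measurable_const)
  have hΦ : Measurable fun c : ℕ → Option Mark => ∫⁻ w, φ (join (some (a, t, N + 1)) w)
      ∂(Measure.infinitePi fun j => treeKernel p lam n (j :: i) (c j)) :=
    Measurable.lintegral_kernel (κ := coordKernel fun j => treeKernel p lam n (j :: i))
      (hφ.comp (measurable_join_left _))
  rw [lintegral_treeKernel_succ _ _ _ _ _ hφ]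
  rcases hb with ⟨rfl, rfl⟩ | ⟨rfl, hi⟩
  · rw [lintegral_reproduction_nil _ _ _ hΦ, lastTree, Kernel.lintegral_comp _ _ _
      (Measurable.lintegral_prod_left' (hpl 0))]
    refine lintegral_congr fun m => ?_
    have hup : ∀ y : ℕ → Mark, ∫⁻ w, φ (join (some (a, t, N + 1)) w)
        ∂(Measure.infinitePi fun k => treeKernel p lam n [k]
          (if k = N then some m else sorted N y k)) =
        ∫⁻ v, ∫⁻ w, φ (join (some (a, t, N + 1)) (place 0 N (sortTrees N fun j => w j) v))
          ∂(Measure.infinitePi fun k => branch p lam n (y k)) ∂branch p lam n m := by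
      intro y
      have hm : Measurable fun (z : (ℕ → DecoratedTree) × DecoratedTree) (k : ℕ) =>
          if k = N then z.2 else z.1 k := by
        refine measurable_pi_lambda _ fun k => ?_
        split_ifs
        · exact measurable_snd
        · exact (measurable_pi_apply k).comp measurable_fst
      have hm2 : Measurable fun z : (ℕ → DecoratedTree) × DecoratedTree =>
          φ (join (some (a, t, N + 1)) fun k => if k = N then z.2 else z.1 k) :=
        hφ.comp ((measurable_join_left _).comp hm)
      rw [← infinitePi_update (fun k => treeKernel p lam n [k] (sorted N y k)) (branch p lam n m) N
        (fun k => treeKernel p lam n [k] (if k = N then some m else sorted N y k))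
        (by simp [treeKernel_cons_some]) (fun k hk => by simp [hk]),
        lintegral_map (f := fun w => φ (join (some (a, t, N + 1)) w))
          (hφ.comp (measurable_join_left _)) hm,
        lintegral_prod_symm _ hm2.aemeasurable]
      refine lintegral_congr fun v => ?_
      rw [infinitePi_treeKernel_sorted, lintegral_map
        (f := fun x => φ (join (some (a, t, N + 1)) fun k => if k = N then v else x k))
        (hm2.comp (measurable_id.prodMk measurable_const)) hp1]
      simp_rw [place_one_update]
    simp_rw [hup, fun v => lintegral_childTrees_eq (p := p) (lam := lam) n t (hpl1 0 v)]
    rw [lintegral_lintegral_swap]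
    refine Measurable.aemeasurable ?_
    exact Measurable.lintegral_kernel_prod_right'
      (κ := (coordKernel fun _ : ℕ => branch p lam n).comap
        (fun z : (ℕ → Mark) × DecoratedTree => z.1) measurable_fst)
      (f := fun z => φ (join (some (a, t, N + 1)) (place 0 N (sortTrees N fun j => z.2 j) z.1.2)))
      ((hpl 0).comp (measurable_snd.prodMk (measurable_snd.comp measurable_fst)))
  · obtain ⟨k, i, rfl⟩ := List.exists_cons_of_ne_nil hi
    -- Without a last child the outer integral is over a constant and drops out.
    have hv : ∀ (w : Fin N → DecoratedTree) v, place 1 N w v = place 1 N w fun _ => none := by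
      intro w v
      ext1 k
      simp [place]
    rw [lintegral_reproduction_cons _ _ _ _ _ hΦ]
    simp_rw [hv, lintegral_const, measure_univ, mul_one]
    rw [lintegral_childTrees_eq n t (hpl1 1 fun _ => none)]
    refine lintegral_congr fun y => ?_
    rw [infinitePi_treeKernel_sorted, lintegral_map (f := fun w => φ (join (some (a, t, N + 1)) w))
      (hφ.comp (measurable_join_left _)) hp1]

end Arrange

/-! ### The environment seen from the root -/

section Accepted

variable {p : PMF ℕ} (hp0 : p 0 = 0) (hp1 : p 1 = 0)

/-- The label and the environment of a child of the root. -/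
def childEnv (ω : Env) (j : ℕ) : ℝ × Env := ((ω []).1 j, subtree ω [j])

/-- The intensity of the available children of the root. -/
def accepted : Measure (ℝ × Env) := intensity (pwitLaw p) (early (measTime hp0 hp1))

/-- The rate at which available children of the root appear. -/
def acceptRate (t : ℝ) : ℝ := rate (pwitLaw p) (early (measTime hp0 hp1)) t

instance : SigmaFinite (accepted hp0 hp1) := by unfold accepted; infer_instance

theorem measurableSet_early_measTime : MeasurableSet (early (measTime hp0 hp1)) :=
  measurableSet_early (measurable_measTime hp0 hp1)

theorem antitone_acceptRate : Antitone (acceptRate hp0 hp1) := antitone_rate_early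

theorem acceptRate_nonneg (t : ℝ) : 0 ≤ acceptRate hp0 hp1 t := rate_nonneg t

variable {hp0 hp1} {Δ : ℕ} {lam : ℝ → ℝ} in
-- A child with label `t` is available exactly if its phantom time exceeds `t`, and `λ'` is the tail
-- of the phantom times.
theorem IsLambda.acceptRate_eq (hΔ : ∀ k, Δ < k → p k = 0) (h : IsLambda p Δ lam) {t : ℝ}
    (ht : 0 ≤ t) : acceptRate hp0 hp1 t = lamDeriv lam t := by
  have := isProbabilityMeasure_phantomTime hp0 hp1
  rw [h.lamDeriv_eq_rate hp0 hΔ (hasEarlyLaw_phantomTime hp0 hp1 hΔ) ht, ← map_measTime hp0 hp1,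
    rate_early_id, map_measureReal_apply (measurable_measTime hp0 hp1) measurableSet_Ioi]
  rfl

variable {hp0 hp1} {Δ : ℕ} {lam : ℝ → ℝ} in
theorem IsLambda.integral_acceptRate (hΔ : ∀ k, Δ < k → p k = 0) (h : IsLambda p Δ lam) {t : ℝ}
    (ht : 0 ≤ t) : ∫ u in 0..t, acceptRate hp0 hp1 u = lam t := by
  have := isProbabilityMeasure_phantomTime hp0 hp1
  have hν := hasEarlyLaw_phantomTime hp0 hp1 hΔ
  rw [h.eq_cumTail hp0 hΔ hν ht, cumTail]
  refine intervalIntegral.integral_congr fun u hu => ?_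
  rw [uIcc_of_le ht] at hu
  rw [h.acceptRate_eq hΔ hu.1, h.lamDeriv_eq_rate hp0 hΔ hν hu.1]

theorem continuous_integral_acceptRate : Continuous fun t => ∫ u in 0..t, acceptRate hp0 hp1 u :=
  continuous_integral_rate (antitone_acceptRate hp0 hp1) 0

variable {hp0 hp1}

theorem Typical.hasNth_early {ω : Env} (h : Typical hp0 hp1 ω) :
    HasNth (Early hp0 hp1 ω) ((ω []).2 - 1) := by
  rw [h.early_eq]
  exact h.regular.hasNth_available h.lt_top []

/-- The saturation time of the root is the label of the last edge at the root. -/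
theorem Typical.toReal_measTime {ω : Env} (h : Typical hp0 hp1 ω) :
    (measTime hp0 hp1 ω).toReal =
      (childEnv ω (Nat.nth (Early hp0 hp1 ω) ((ω []).2 - 1))).1 := by
  classical
  have h1 := h.regular.phantomTime_eq []
  have hd : (ω []).2 = (ω []).2 - 1 + 1 := by have := h.regular.two_le []; omega
  have h2 := h.regular.hasNth_available h.lt_top []
  rw [hd, chi_succ] at h1
  replace h1 := h1.trans (if_pos h2)
  rw [h.measTime_root, h1, h.early_eq, ENNReal.toReal_ofReal]
  · rfl
  · exact (h.regular.pos []).le.trans ((h.regular.strictMono []).monotone (Nat.zero_le _))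

/-- The joint law of the degree constraint and the children of the root in terms of independent
points. -/
theorem lintegral_pwitLaw_first {Δ : ℕ} (hΔ : ∀ k, Δ < k → p k = 0) {G : Env → ℝ≥0∞}
    {F : ∀ n : ℕ, (Fin n → ℝ × Env) × (ℝ × Env) → ℝ≥0∞} (hF : ∀ n, Measurable (F n))
    (hG : ∀ ω n, Typical hp0 hp1 ω → (ω []).2 = n + 1 → G ω =
      F n (fun k => childEnv ω (Nat.nth (Early hp0 hp1 ω) k),
        childEnv ω (Nat.nth (Early hp0 hp1 ω) n))) :
    ∫⁻ ω, G ω ∂pwitLaw p = ∑ n ∈ Finset.range Δ, p (n + 1) * ∫⁻ x, (if 0 < x.1 then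
        ENNReal.ofReal (Real.exp (-∫ u in 0..x.1, acceptRate hp0 hp1 u) / n.factorial) *
          ∫⁻ y, F n (fun k => y (Tuple.sort (fun j => (y j).1) k), x)
            ∂Measure.pi fun _ : Fin n => (accepted hp0 hp1).restrict (before Env x.1)
        else 0) ∂accepted hp0 hp1 := by
  classical
  let A := early (measTime hp0 hp1)
  have hA : MeasurableSet A := measurableSet_early_measTime hp0 hp1
  let pt : (ℕ → ℝ) × (ℕ → Env) → ℕ → ℝ × Env := fun z j => (z.1 j, z.2 j)
  let K : ℕ → (ℕ → ℝ) × (ℕ → Env) → ℝ≥0∞ := fun n z => if HasNth (fun j => pt z j ∈ A) n then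
    F n (fun k => pt z (Nat.nth (fun j => pt z j ∈ A) k), pt z (Nat.nth (fun j => pt z j ∈ A) n))
    else 0
  let H : ((ℕ → ℝ) × ℕ) × (ℕ → Env) → ℝ≥0∞ := fun y => K (y.1.2 - 1) (y.1.1, y.2)
  have hset : ∀ j, MeasurableSet {z | pt z j ∈ A} := fun j =>
    (show Measurable fun z : (ℕ → ℝ) × (ℕ → Env) => (z.1 j, z.2 j) by fun_prop) hA
  have hnth : ∀ k, Measurable fun z => pt z (Nat.nth (fun j => pt z j ∈ A) k) :=
    fun k => measurable_comp_nth hset k fun j => by fun_prop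
  have hK : ∀ n, Measurable (K n) := fun n => Measurable.ite (measurableSet_hasNth hset n)
    ((hF n).comp ((measurable_pi_lambda _ fun k : Fin n => hnth k).prodMk (hnth n))) measurable_const
  have hHd : ∀ d, Measurable fun z : (ℕ → ℝ) × (ℕ → Env) => H ((z.1, d), z.2) := fun d => hK (d - 1)
  have hH : Measurable H :=
    (measurable_from_prod_countable_left
      (f := fun z : ((ℕ → ℝ) × (ℕ → Env)) × ℕ => H ((z.1.1, z.2), z.1.2)) hHd).comp
      (f := fun y : ((ℕ → ℝ) × ℕ) × (ℕ → Env) => ((y.1.1, y.2), y.1.2)) (by fun_prop)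
  have h1 : ∫⁻ ω, G ω ∂pwitLaw p = ∫⁻ ω, H (ω [], fun j => subtree ω [j]) ∂pwitLaw p := by
    refine lintegral_congr_ae ?_
    filter_upwards [ae_typical hp0 hp1 hΔ] with ω hω
    obtain ⟨n, hn⟩ : ∃ n, (ω []).2 = n + 1 :=
      ⟨(ω []).2 - 1, by have := hω.regular.two_le []; omega⟩
    have h2 := hω.hasNth_early
    rw [hn, Nat.add_sub_cancel] at h2
    rw [hG ω n hω hn]
    simp only [H, hn, Nat.add_sub_cancel]
    exact (if_pos (α := ℝ≥0∞) h2).symm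
  rw [h1, lintegral_pwitLaw p hH, lintegral_prod_prod_comm hH, lintegral_toMeasure_eq_sum hp0 hΔ]
  refine Finset.sum_congr rfl fun n _ => ?_
  rw [lintegral_pppLaw_prod (pwitLaw p) (hHd (n + 1)), accepted]
  exact congrArg _ (lintegral_first_points_sort hA antitone_rate_early n (hF n))

theorem lintegral_accepted_fst {φ : ℝ → ℝ≥0∞} (hφ : Measurable φ) :
    ∫⁻ x, φ x.1 ∂accepted hp0 hp1 = ∫⁻ t, ENNReal.ofReal (acceptRate hp0 hp1 t) * φ t :=
  lintegral_rate (measurableSet_early_measTime hp0 hp1) hφ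

theorem accepted_before {t : ℝ} (ht : 0 ≤ t) : accepted hp0 hp1 (before Env t) =
    ENNReal.ofReal (∫ u in 0..t, acceptRate hp0 hp1 u) :=
  intensity_before (measurableSet_early_measTime hp0 hp1) (antitone_acceptRate hp0 hp1) ht

/-- The joint law of the phantom saturation time and the degree constraint of the root. -/
theorem lintegral_time_constraint {Δ : ℕ} {lam : ℝ → ℝ} (hΔ : ∀ k, Δ < k → p k = 0)
    (h : IsLambda p Δ lam) {φ : ℝ × ℕ → ℝ≥0∞} (hφ : Measurable φ) :
    ∫⁻ ω, φ ((measTime hp0 hp1 ω).toReal, (ω []).2) ∂pwitLaw p =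
      ∫⁻ m, φ m ∂typeConstraintLaw p lam := by
  have := isProbabilityMeasure_phantomTime hp0 hp1
  have hν := hasEarlyLaw_phantomTime hp0 hp1 hΔ
  have hc := continuous_integral_acceptRate hp0 hp1
  rw [lintegral_pwitLaw_first (hp0 := hp0) (hp1 := hp1) hΔ (F := fun n z => φ (z.2.1, n + 1))
    (fun n => by fun_prop) fun ω n hω hn => by rw [hω.toReal_measTime, hn]; rfl,
    h.lintegral_typeConstraintLaw_eq_sum hp0 hp1 hΔ hν hφ]
  refine Finset.sum_congr rfl fun n _ => ?_
  congr 1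
  simp only [lintegral_const, Measure.pi_univ, Measure.restrict_apply_univ, Finset.prod_const,
    Finset.card_univ, Fintype.card_fin]
  rw [lintegral_congr (g := fun x : ℝ × Env => (Ioi (0 : ℝ)).indicator (fun t =>
    ENNReal.ofReal (Real.exp (-∫ x in 0..t, acceptRate hp0 hp1 x) *
      ((∫ x in 0..t, acceptRate hp0 hp1 x) ^ n / n.factorial)) * φ (t, n + 1)) x.1)]
  · rw [lintegral_accepted_fst (Measurable.indicator (by fun_prop) measurableSet_Ioi),
      ← lintegral_indicator measurableSet_Ioi]
    refine lintegral_congr fun u => ?_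
    by_cases hu : u ∈ Ioi (0 : ℝ)
    · have hu0 : 0 ≤ u := le_of_lt hu
      rw [indicator_of_mem hu, indicator_of_mem hu, h.acceptRate_eq hΔ hu0,
        h.integral_acceptRate hΔ hu0, ENNReal.ofReal_mul' (h.lamDeriv_pos hp0 hΔ hν hu0).le]
      ring
    · rw [indicator_of_notMem hu, indicator_of_notMem hu, mul_zero]
  · intro x
    by_cases hx : 0 < x.1
    · have h0 : 0 ≤ ∫ u in 0..x.1, acceptRate hp0 hp1 u :=
        intervalIntegral.integral_nonneg hx.le fun u _ => acceptRate_nonneg hp0 hp1 u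
      rw [if_pos hx, indicator_of_mem (by exact hx), accepted_before hx.le,
        ← ENNReal.ofReal_pow h0, mul_comm (φ _), ← mul_assoc, ← ENNReal.ofReal_mul (by positivity)]
      congr 2
      ring
    · rw [if_neg hx, indicator_of_notMem (by exact hx)]

end Accepted

/-! ### The generations of the component of the root -/

section Generations

variable {p : PMF ℕ} {hp0 : p 0 = 0} {hp1 : p 1 = 0} {Δ : ℕ} {lam : ℝ → ℝ}

variable (hp0 hp1 lam) in
/-- The first `n` generations of the component of the root without its last child have the law of
the descendants of a vertex of the branching process. -/
def BranchLaw (n : ℕ) : Prop := ∀ (x : ℝ) (φ : DecoratedTree → ℝ≥0∞), Measurable φ →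
  ∫⁻ ω, φ (measTree hp0 hp1 n 1 x ω) ∂pwitLaw p =
    ∫⁻ m, ∫⁻ v, φ v ∂branch p lam n (x, m) ∂typeConstraintLaw p lam

/-- The phantom time is recorded in the root mark of the tree, so the availability condition can be
absorbed into the test function. -/
theorem BranchLaw.lintegral_lt {n : ℕ} (hb : BranchLaw hp0 hp1 lam n)
    (hΔ : ∀ k, Δ < k → p k = 0) {t : ℝ} (ht : 0 ≤ t) {φ : DecoratedTree → ℝ≥0∞}
    (hφ : Measurable φ) :
    ∫⁻ ω, (if ENNReal.ofReal t < measTime hp0 hp1 ω then φ (measTree hp0 hp1 n 1 t ω) else 0)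
        ∂pwitLaw p =
      ∫⁻ m, (if t < m.1 then ∫⁻ v, φ v ∂branch p lam n (t, m) else 0)
        ∂typeConstraintLaw p lam := by
  have h1 : ∀ᵐ ω ∂pwitLaw p,
      (if ENNReal.ofReal t < measTime hp0 hp1 ω then φ (measTree hp0 hp1 n 1 t ω) else 0) =
        if t < (rootMark (measTree hp0 hp1 n 1 t ω)).2.1 then φ (measTree hp0 hp1 n 1 t ω)
        else 0 := by
    filter_upwards [ae_typical hp0 hp1 hΔ] with ω hω
    have h2 : measTime hp0 hp1 ω ≠ ∞ := by rw [hω.measTime_root]; exact (hω.lt_top []).ne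
    rw [rootMark, measTree_nil]
    simp only [Option.getD_some, ENNReal.ofReal_lt_iff_lt_toReal ht h2]
  have hset : MeasurableSet {x : DecoratedTree | t < (rootMark x).2.1} :=
    measurableSet_lt measurable_const
      (measurable_fst.comp (measurable_snd.comp measurable_rootMark))
  rw [lintegral_congr_ae h1, hb t (fun x => if t < (rootMark x).2.1 then φ x else 0)
    (Measurable.ite hset hφ measurable_const)]
  refine lintegral_congr fun m => ?_
  rw [lintegral_congr_ae (g := fun v => if t < m.1 then φ v else 0)]
  · split_ifs <;> simp
  · filter_upwards [ae_branch p lam n (t, m)] with v hv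
    rw [hv]

theorem BranchLaw.lintegral_accepted {n : ℕ} (hb : BranchLaw hp0 hp1 lam n)
    (hΔ : ∀ k, Δ < k → p k = 0) {S : Set ℝ} (hS : MeasurableSet S) (hS0 : S ⊆ Ici 0)
    {Ψ : ℝ × DecoratedTree → ℝ≥0∞} (hΨ : Measurable Ψ) :
    ∫⁻ x, S.indicator (fun t => Ψ (t, measTree hp0 hp1 n 1 x.1 x.2)) x.1 ∂accepted hp0 hp1 =
      ∫⁻ t in S, ∫⁻ m, (if t < m.1 then ∫⁻ v, Ψ (t, v) ∂branch p lam n (t, m) else 0)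
        ∂typeConstraintLaw p lam := by
  have hm : Measurable fun x : ℝ × Env => Ψ (x.1, measTree hp0 hp1 n 1 x.1 x.2) :=
    hΨ.comp (measurable_fst.prodMk (measurable_measTree hp0 hp1 n 1))
  have hi : (fun x : ℝ × Env => S.indicator (fun t => Ψ (t, measTree hp0 hp1 n 1 x.1 x.2)) x.1) =
      (Prod.fst ⁻¹' S).indicator fun x => Ψ (x.1, measTree hp0 hp1 n 1 x.1 x.2) := by
    ext x
    by_cases hx : x.1 ∈ S <;> simp [indicator, hx]
  rw [accepted, lintegral_intensity (measurableSet_early_measTime hp0 hp1)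
    (hi ▸ hm.indicator (measurable_fst hS)), ← lintegral_indicator hS]
  refine lintegral_congr fun t => ?_
  by_cases ht : t ∈ S
  · rw [indicator_of_mem ht, ← hb.lintegral_lt hΔ (hS0 ht)
      (φ := fun v => Ψ (t, v)) (hΨ.comp (measurable_const.prodMk measurable_id))]
    refine lintegral_congr fun ω => ?_
    simp only [indicator, early, mem_ofPred_eq, ht, if_true]
  · rw [indicator_of_notMem ht]
    simp [indicator, ht]

/-- The tree at a point of the intensity measure which lies before time `t`. -/
theorem BranchLaw.map_before {n : ℕ} (hb : BranchLaw hp0 hp1 lam n)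
    (hΔ : ∀ k, Δ < k → p k = 0) (h : IsLambda p Δ lam) {t : ℝ} (ht : 0 < t) :
    ((accepted hp0 hp1).restrict (before Env t)).map (fun y => measTree hp0 hp1 n 1 y.1 y.2) =
      ENNReal.ofReal (lam t) • (branch p lam n ∘ₖ childKernel p lam) t := by
  have := isProbabilityMeasure_phantomTime hp0 hp1
  have hν := hasEarlyLaw_phantomTime hp0 hp1 hΔ
  refine Measure.ext_of_lintegral _ fun φ hφ => ?_
  rw [lintegral_map hφ (measurable_measTree hp0 hp1 n 1), lintegral_smul_measure,
    Kernel.lintegral_comp _ _ _ hφ, smul_eq_mul,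
    h.lintegral_childKernel hp0 hΔ hν ht hφ.lintegral_kernel,
    ← hb.lintegral_accepted hΔ measurableSet_Ioo (fun u hu => le_of_lt hu.1)
      (Ψ := fun y => φ y.2) (hφ.comp measurable_snd),
    ← lintegral_indicator (measurableSet_before t)]
  rfl

/-- The tree at a point of the intensity measure. -/
theorem BranchLaw.lintegral_last {n : ℕ} (hb : BranchLaw hp0 hp1 lam n)
    (hΔ : ∀ k, Δ < k → p k = 0) (h : IsLambda p Δ lam) {Ψ : ℝ × DecoratedTree → ℝ≥0∞}
    (hΨ : Measurable Ψ) :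
    ∫⁻ x, (if 0 < x.1 then Ψ (x.1, measTree hp0 hp1 n 1 x.1 x.2) else 0) ∂accepted hp0 hp1 =
      ∫⁻ t in Ioi 0, ENNReal.ofReal (lamDeriv lam t) * ∫⁻ v, Ψ (t, v) ∂lastTree p lam n t := by
  have := isProbabilityMeasure_phantomTime hp0 hp1
  have hν := hasEarlyLaw_phantomTime hp0 hp1 hΔ
  refine (hb.lintegral_accepted hΔ measurableSet_Ioi Ioi_subset_Ici_self hΨ).trans ?_
  refine setLIntegral_congr_fun measurableSet_Ioi fun t ht => ?_
  have hΨt : Measurable fun v => Ψ (t, v) := hΨ.comp (measurable_const.prodMk measurable_id)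
  rw [lastTree, Kernel.lintegral_comp _ _ _ hΨt,
    h.lintegral_lastChildKernel hp0 hΔ hν ht hΨt.lintegral_kernel]

theorem lintegral_childTrees_fin (n N : ℕ) (t : ℝ) {Φ : (Fin N → DecoratedTree) → ℝ≥0∞}
    (hΦ : Measurable Φ) : ∫⁻ w, Φ (fun j => w j) ∂childTrees p lam n t =
      ∫⁻ w, Φ w ∂Measure.pi fun _ : Fin N => (branch p lam n ∘ₖ childKernel p lam) t := by
  have h1 := Measure.map_infinitePi_infinitePi_of_inj
    (P := fun _ : ℕ => (branch p lam n ∘ₖ childKernel p lam) t) (Fin.val_injective (n := N))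
  rw [← Measure.infinitePi_eq_pi, ← h1, lintegral_map hΦ (by fun_prop)]
  rfl

theorem pi_smul {ι X : Type*} [Fintype ι] [MeasurableSpace X] (c : ℝ≥0∞) (hc : c ≠ ∞)
    (Q : Measure X) [SigmaFinite Q] :
    Measure.pi (fun _ : ι => c • Q) = c ^ Fintype.card ι • Measure.pi fun _ : ι => Q := by
  have : SigmaFinite (c • Q) := by
    lift c to NNReal using hc
    exact inferInstanceAs (SigmaFinite (c • Q))
  refine Measure.pi_eq fun s _ => ?_
  simp [Measure.pi_pi, Finset.prod_mul_distrib, Finset.card_univ]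

/-- Independent trees before time `t`. -/
theorem BranchLaw.lintegral_pi {n : ℕ} (hb : BranchLaw hp0 hp1 lam n)
    (hΔ : ∀ k, Δ < k → p k = 0) (h : IsLambda p Δ lam) {t : ℝ} (ht : 0 < t) (N : ℕ)
    {Φ : (Fin N → DecoratedTree) → ℝ≥0∞} (hΦ : Measurable Φ) :
    ∫⁻ y, Φ (fun k => measTree hp0 hp1 n 1 (y k).1 (y k).2)
        ∂(Measure.pi fun _ : Fin N => (accepted hp0 hp1).restrict (before Env t)) =
      ENNReal.ofReal (lam t) ^ N * ∫⁻ w, Φ (fun j => w j) ∂childTrees p lam n t := by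
  have hmap := hb.map_before hΔ h ht
  have hsf : SigmaFinite (((accepted hp0 hp1).restrict (before Env t)).map
      fun y => measTree hp0 hp1 n 1 y.1 y.2) := by
    rw [hmap, ENNReal.ofReal]
    exact inferInstanceAs (SigmaFinite
      ((lam t).toNNReal • (branch p lam n ∘ₖ childKernel p lam) t))
  have h1 := Measure.pi_map_pi (μ := fun _ : Fin N => (accepted hp0 hp1).restrict (before Env t))
    (f := fun _ y => measTree hp0 hp1 n 1 y.1 y.2) fun _ => (measurable_measTree hp0 hp1 n 1).aemeasurable
  have h2 : Measurable fun (y : Fin N → ℝ × Env) k => measTree hp0 hp1 n 1 (y k).1 (y k).2 :=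
    measurable_pi_lambda _ fun k => (measurable_measTree hp0 hp1 n 1).comp (measurable_pi_apply k)
  rw [lintegral_childTrees_fin n N t hΦ, ← lintegral_map hΦ h2, h1]
  simp_rw [hmap]
  rw [pi_smul _ ENNReal.ofReal_ne_top, lintegral_smul_measure, Fintype.card_fin, smul_eq_mul]

/-- The first generations of the component of the root. -/
theorem BranchLaw.lintegral_measTree_succ {n : ℕ} (hb : BranchLaw hp0 hp1 lam n)
    (hΔ : ∀ k, Δ < k → p k = 0) (h : IsLambda p Δ lam) {b : ℕ} {i : List ℕ}
    (hbi : (b = 0 ∧ i = []) ∨ (b = 1 ∧ i ≠ [])) (x : ℝ) {φ : DecoratedTree → ℝ≥0∞}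
    (hφ : Measurable φ) :
    ∫⁻ ω, φ (measTree hp0 hp1 (n + 1) b x ω) ∂pwitLaw p =
      ∫⁻ m, ∫⁻ v, φ v ∂treeKernel p lam (n + 1) i (some (x, m)) ∂typeConstraintLaw p lam := by
  have := isProbabilityMeasure_phantomTime hp0 hp1
  have hν := hasEarlyLaw_phantomTime hp0 hp1 hΔ
  have hc := continuous_integral_acceptRate hp0 hp1
  have hK : ∀ N, Measurable fun z : ℝ × DecoratedTree => ∫⁻ w, φ (join (some (x, z.1, N + 1))
      (place b N (sortTrees N fun j => w j) z.2)) ∂childTrees p lam n z.1 := by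
    intro N
    have h1 : Measurable fun y : (ℝ × DecoratedTree) × (ℕ → DecoratedTree) =>
        sortTrees N fun j : Fin N => y.2 j := (measurable_sortTrees N).comp (by fun_prop)
    have h2 : Measurable fun y : (ℝ × DecoratedTree) × (ℕ → DecoratedTree) =>
        (some (x, y.1.1, N + 1) : Option Mark) := measurable_some.comp (by fun_prop)
    exact Measurable.lintegral_kernel_prod_right'
      (κ := (childTrees p lam n).comap (fun z : ℝ × DecoratedTree => z.1) measurable_fst)
      (f := fun y => φ (join (some (x, y.1.1, N + 1))
        (place b N (sortTrees N fun j => y.2 j) y.1.2)))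
      (hφ.comp (measurable_join.comp (h2.prodMk ((measurable_place b N).comp
        (h1.prodMk (measurable_snd.comp measurable_fst))))))
  have hg := measurable_measTree hp0 hp1 n 1
  rw [lintegral_pwitLaw_first (hp0 := hp0) (hp1 := hp1) hΔ (F := fun N z =>
    φ (join (some (x, z.2.1, N + 1)) (place b N
      (fun k => measTree hp0 hp1 n 1 (z.1 k).1 (z.1 k).2) (measTree hp0 hp1 n 1 z.2.1 z.2.2)))),
    h.lintegral_typeConstraintLaw_eq_sum hp0 hp1 hΔ hν (φ := fun m =>
      ∫⁻ v, φ v ∂treeKernel p lam (n + 1) i (some (x, m)))]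
  · refine Finset.sum_congr rfl fun N _ => ?_
    congr 1
    have h1 := hb.lintegral_last hΔ h (Ψ := fun z : ℝ × DecoratedTree =>
      ENNReal.ofReal (Real.exp (-∫ u in 0..z.1, acceptRate hp0 hp1 u) / N.factorial) *
        (ENNReal.ofReal (∫ u in 0..z.1, acceptRate hp0 hp1 u) ^ N *
          ∫⁻ w, φ (join (some (x, z.1, N + 1)) (place b N (sortTrees N fun j => w j) z.2))
            ∂childTrees p lam n z.1))
      (Measurable.mul (by fun_prop) (Measurable.mul (by fun_prop) (hK N)))
    refine Eq.trans (lintegral_congr fun z => ?_) (h1.trans ?_)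
    · split_ifs with hz
      · have hΦ : Measurable fun w : Fin N → DecoratedTree =>
            φ (join (some (x, z.1, N + 1)) (place b N (sortTrees N w)
              (measTree hp0 hp1 n 1 z.1 z.2))) :=
          hφ.comp ((measurable_join_left _).comp ((measurable_place b N).comp
            ((measurable_sortTrees N).prodMk measurable_const)))
        rw [h.integral_acceptRate hΔ hz.le, ← hb.lintegral_pi hΔ h hz N hΦ]
        congr 1
        refine lintegral_congr fun y => ?_
        -- Each tree has its label at its root, so sorting the points and sorting the trees amount
        -- to the same.
        have hsort : (sortTrees N fun k => measTree hp0 hp1 n 1 (y k).1 (y k).2) = fun k =>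
            measTree hp0 hp1 n 1 (y (Tuple.sort (fun j => (y j).1) k)).1
              (y (Tuple.sort (fun j => (y j).1) k)).2 := by
          ext1 k
          simp only [sortTrees, rootMark, measTree_nil, Option.getD_some]
        rw [hsort]
      · rfl
    -- With the kernels normalised by `λ(t)` and `λ'(t)`, both sides are left with the weight `exp
    -- (-λ) λ^N / N! · λ'` of the saturation time.
    · refine setLIntegral_congr_fun measurableSet_Ioi fun t ht => ?_
      have ht0 : 0 ≤ t := le_of_lt ht
      have hl := h.nonneg hp0 hΔ hν ht0
      simp only [h.integral_acceptRate hΔ ht0]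
      rw [lintegral_treeKernel_succ_some hbi n N x t hφ,
        lintegral_const_mul' _ _ ENNReal.ofReal_ne_top,
        lintegral_const_mul' _ _ (ENNReal.pow_ne_top ENNReal.ofReal_ne_top),
        ← ENNReal.ofReal_pow hl, ← mul_assoc, ← mul_assoc, ← ENNReal.ofReal_mul
          (h.lamDeriv_pos hp0 hΔ hν ht0).le, ← ENNReal.ofReal_mul (mul_nonneg
          (h.lamDeriv_pos hp0 hΔ hν ht0).le (by positivity))]
      congr 2
      ring
  · exact hφ.lintegral_kernel.comp (measurable_some.comp (measurable_const.prodMk measurable_id))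
  · intro N
    refine hφ.comp (measurable_join.comp ((measurable_some.comp (by fun_prop)).prodMk
      ((measurable_place b N).comp (Measurable.prodMk (measurable_pi_lambda _ fun k =>
        hg.comp ((measurable_pi_apply k).comp measurable_fst)) (hg.comp measurable_snd)))))
  · intro ω N hω hN
    have h1 := hω.toReal_measTime
    rw [hN, Nat.add_sub_cancel] at h1
    rw [measTree, h1, hN]
    congr 2
    ext1 k
    simp only [place]
    -- The constraint is `N + 1`, so the vertex has `N + 1 - b` children: the child with index `N`
    -- is present only if `b = 0`.
    rcases lt_trichotomy k N with hk | rfl | hk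
    · rw [if_pos (by rcases hbi with h | h <;> omega), dif_pos hk]
      rfl
    · rcases hbi with ⟨rfl, -⟩ | ⟨rfl, -⟩ <;> simp [childEnv]
    · rw [if_neg (by omega), dif_neg (by omega), if_neg (by omega)]

/-- The base case is the joint law of phantom time and constraint; the inductive step is
`BranchLaw.lintegral_measTree_succ` at a nonempty string. -/
theorem branchLaw (hΔ : ∀ k, Δ < k → p k = 0) (h : IsLambda p Δ lam) (n : ℕ) :
    BranchLaw hp0 hp1 lam n := by
  induction n with
  | zero =>
    intro x φ hφ
    have h1 : ∀ m : ℝ × ℕ, ∫⁻ v, φ v ∂branch p lam 0 (x, m) =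
        φ (join (some (x, m)) fun _ _ => none) := by
      intro m
      rw [← treeKernel_cons_some p lam 0 0 [], treeKernel_zero, lintegral_dirac' _ hφ]
    simp_rw [h1]
    rw [← lintegral_time_constraint (hp0 := hp0) (hp1 := hp1) hΔ h
      (φ := fun m => φ (join (some (x, m)) fun _ _ => none))
      (hφ.comp (measurable_join_const.comp (measurable_some.comp
        (measurable_const.prodMk measurable_id))))]
    rfl
  | succ n ih =>
    intro x φ hφ
    rw [ih.lintegral_measTree_succ hΔ h (Or.inr ⟨rfl, List.cons_ne_nil 0 []⟩) x hφ]
    rfl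

end Generations

/-! ### The law of the component of the root -/

/-- The law of a decorated tree is determined by the laws of its first generations. -/
theorem ext_of_lintegral_trunc {μ ν : Measure DecoratedTree} [IsFiniteMeasure μ]
    (h : ∀ (n : ℕ) (φ : DecoratedTree → ℝ≥0∞), Measurable φ →
      ∫⁻ x, φ (trunc n x) ∂μ = ∫⁻ x, φ (trunc n x) ∂ν) : μ = ν := by
  have hμ : IsProjectiveLimit μ fun I => μ.map I.restrict := fun I => rfl
  refine hμ.unique fun I => Eq.symm ?_
  have hI : ∀ x : DecoratedTree, I.restrict x = I.restrict (trunc (I.sup List.length) x) := by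
    intro x
    ext1 l
    have hl : (l : List ℕ).length ≤ I.sup List.length := Finset.le_sup (f := List.length) l.2
    exact (if_pos hl).symm
  refine Measure.ext_of_lintegral _ fun φ hφ => ?_
  rw [lintegral_map hφ (by fun_prop), lintegral_map hφ (by fun_prop)]
  rw [lintegral_congr fun x => congrArg φ (hI x), lintegral_congr fun x => congrArg φ (hI x)]
  exact h _ (fun x => φ (I.restrict x)) (hφ.comp (by fun_prop))

section Component

variable {p : PMF ℕ} {Δ : ℕ} {lam : ℝ → ℝ}

theorem aemeasurable_pwitTree_top (hp0 : p 0 = 0) (hp1 : p 1 = 0) (hΔ : ∀ k, Δ < k → p k = 0) :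
    AEMeasurable (pwitTree ∞) (pwitLaw p) := by
  refine ⟨fun ω l => measTree hp0 hp1 l.length 0 0 ω l, measurable_pi_lambda _ fun l => ?_, ?_⟩
  · exact (measurable_pi_apply l).comp
      ((measurable_measTree hp0 hp1 l.length 0).comp (measurable_const.prodMk measurable_id))
  · filter_upwards [ae_typical hp0 hp1 hΔ] with ω hω
    ext1 l
    rw [hω.measTree_eq, hω.regular.pwitTree_top hω.lt_top, trunc, if_pos le_rfl]

theorem isProbabilityMeasure_rootLaw (hp0 : p 0 = 0) (hp1 : p 1 = 0) (hΔ : ∀ k, Δ < k → p k = 0)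
    (h : IsLambda p Δ lam) : IsProbabilityMeasure (rootLaw p lam) := by
  have := isProbabilityMeasure_phantomTime hp0 hp1
  have := h.isProbabilityMeasure_typeLaw hp0 hΔ (hasEarlyLaw_phantomTime hp0 hp1 hΔ)
  refine Measure.isProbabilityMeasure_map (measurable_pi_lambda _ fun l => ?_).aemeasurable
  split_ifs
  · exact measurable_some.comp (by fun_prop)
  · exact measurable_const

theorem isProbabilityMeasure_mtbpLaw [IsProbabilityMeasure (rootLaw p lam)] :
    IsProbabilityMeasure (mtbpLaw p lam) :=
  Measure.isProbabilityMeasure_map (show Measurable fun (g : ℕ → DecoratedTree) (l : List ℕ) =>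
    g l.length l by fun_prop).aemeasurable

/-- The same inductive step, taken at the empty string with `b = 0`, adds the root with its last
child on top of the branches; the truncations determine the law. -/
theorem map_pwitTree_top (hp0 : p 0 = 0) (hp1 : p 1 = 0) (hΔ : ∀ k, Δ < k → p k = 0)
    (h : IsLambda p Δ lam) : (pwitLaw p).map (pwitTree ∞) = mtbpLaw p lam := by
  have := isProbabilityMeasure_rootLaw hp0 hp1 hΔ h
  have hm := aemeasurable_pwitTree_top hp0 hp1 hΔ
  have := Measure.isProbabilityMeasure_map hm
  refine ext_of_lintegral_trunc fun n φ hφ => ?_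
  have hae : ∀ᵐ ω ∂pwitLaw p, φ (trunc n (pwitTree ∞ ω)) = φ (measTree hp0 hp1 n 0 0 ω) := by
    filter_upwards [ae_typical hp0 hp1 hΔ] with ω hω
    rw [hω.measTree_eq, hω.regular.pwitTree_top hω.lt_top]
  rw [lintegral_map' (f := fun x => φ (trunc n x)) (hφ.comp (measurable_trunc n)).aemeasurable hm,
    lintegral_congr_ae hae, lintegral_trunc_mtbpLaw p lam n hφ]
  cases n with
  | zero =>
    simp_rw [treeKernel_zero, lintegral_dirac' _ hφ]
    rw [← lintegral_time_constraint (hp0 := hp0) (hp1 := hp1) hΔ h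
      (φ := fun m => φ (join (some (0, m)) fun _ _ => none))
      (hφ.comp (measurable_join_const.comp (measurable_some.comp
        (measurable_const.prodMk measurable_id))))]
    rfl
  | succ n => exact (branchLaw hΔ h n).lintegral_measTree_succ hΔ h (Or.inl ⟨rfl, rfl⟩) 0 hφ

theorem ae_pwitTree_eq_cut (hp0 : p 0 = 0) (hp1 : p 1 = 0) (t : ℝ≥0∞) :
    pwitTree t =ᵐ[pwitLaw p] fun ω => cut t (pwitTree ∞ ω) := by
  filter_upwards [ae_regular hp0 hp1, ae_label_ne t.toReal] with ω h1 h2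
  exact h1.pwitTree_eq_cut h2

theorem aemeasurable_pwitTree (hp0 : p 0 = 0) (hp1 : p 1 = 0) (hΔ : ∀ k, Δ < k → p k = 0)
    (t : ℝ≥0∞) : AEMeasurable (pwitTree t) (pwitLaw p) :=
  ((measurable_cut t).comp_aemeasurable (aemeasurable_pwitTree_top hp0 hp1 hΔ)).congr
    (ae_pwitTree_eq_cut hp0 hp1 t).symm

/-- The component of the root has the law of the branching process. -/
theorem map_pwitTree (hp0 : p 0 = 0) (hp1 : p 1 = 0) (hΔ : ∀ k, Δ < k → p k = 0)
    (h : IsLambda p Δ lam) (t : ℝ≥0∞) :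
    (pwitLaw p).map (pwitTree t) = (mtbpLaw p lam).map (cut t) := by
  rw [Measure.map_congr (ae_pwitTree_eq_cut hp0 hp1 t), ← map_pwitTree_top hp0 hp1 hΔ h,
    AEMeasurable.map_map_of_aemeasurable (measurable_cut t).aemeasurable
      (aemeasurable_pwitTree_top hp0 hp1 hΔ)]
  rfl

end Component

end RDCP

end

/-! ### The theorem -/

theorem mainTheorem4 (p : PMF ℕ) (hp0 : p 0 = 0) (hp1 : p 1 = 0)
    (Δ : ℕ) (hΔ : ∀ k, Δ < k → p k = 0) :
    -- the initial value problem has exactly one solution on `[0, ∞)`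
    (∃ lam, RDCP.IsLambda p Δ lam) ∧
    (∀ lam₁ lam₂, RDCP.IsLambda p Δ lam₁ → RDCP.IsLambda p Δ lam₂ → EqOn lam₁ lam₂ (Ici 0)) ∧
    -- almost surely, the process on the PWIT and on all of its subtrees is well defined, and
    -- all phantom saturation times are finite
    (∀ᵐ ω ∂(RDCP.pwitLaw p), ∀ i, (∃! G, RDCP.IsRDCP (RDCP.subtree ω i) G) ∧
      RDCP.phantomTime ω i < ∞) ∧
    ∀ lam, RDCP.IsLambda p Δ lam →
      -- `f = -λ''`, and the densities which define the branching process are densities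
      ((∀ t, 0 ≤ t →
          HasDerivWithinAt lam (RDCP.lamDeriv lam t) (Ici 0) t ∧
          HasDerivWithinAt (RDCP.lamDeriv lam) (-RDCP.typeDensity lam t) (Ici 0) t ∧
          RDCP.typeDensity lam t = RDCP.lamDeriv lam t * ∑' k, RDCP.z p lam t k ∧
          0 ≤ RDCP.typeDensity lam t) ∧
        IsProbabilityMeasure (RDCP.typeLaw lam) ∧
        ∀ t₀, 0 < t₀ →
          IsProbabilityMeasure (RDCP.constraintKernel p lam t₀) ∧
          IsProbabilityMeasure (RDCP.lastTypeKernel lam t₀) ∧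
          IsProbabilityMeasure (RDCP.pairKernel lam t₀)) ∧
      -- the decorated component of the root has the law of the branching process
      (∀ t : ℝ≥0∞,
        AEMeasurable (RDCP.pwitTree t) (RDCP.pwitLaw p) ∧
        IsProbabilityMeasure ((RDCP.mtbpLaw p lam).map (RDCP.cut t)) ∧
        (RDCP.pwitLaw p).map (RDCP.pwitTree t) = (RDCP.mtbpLaw p lam).map (RDCP.cut t)) ∧
      -- the phantom saturation times solve the recursive distributional equation, whose
      -- solution is unique
      (∀ i, AEMeasurable (fun ω => RDCP.phantomTime ω i) (RDCP.pwitLaw p) ∧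
        RDCP.SolvesRDE p ((RDCP.pwitLaw p).map fun ω => RDCP.phantomTime ω i) ∧
        (RDCP.pwitLaw p).map (fun ω => RDCP.phantomTime ω i) =
          (RDCP.typeLaw lam).map ENNReal.ofReal) ∧
      ∀ ν, RDCP.SolvesRDE p ν → ν = (RDCP.typeLaw lam).map ENNReal.ofReal := by
  have hν := RDCP.hasEarlyLaw_phantomTime hp0 hp1 hΔ
  have hprob := RDCP.isProbabilityMeasure_phantomTime hp0 hp1
  -- The solution `λ` is obtained as the integrated tail of the law of the phantom saturation time.
  refine ⟨⟨_, hν.isLambda hp0 hΔ⟩, fun _ _ h₁ h₂ => h₁.eqOn hp0 hΔ h₂, ?_, fun lam h => ⟨⟨?_,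
    h.isProbabilityMeasure_typeLaw hp0 hΔ hν, fun t₀ ht => ?_⟩, fun t => ?_, fun i => ?_,
    fun ν hs => ?_⟩⟩
  · filter_upwards [RDCP.ae_regular hp0 hp1, RDCP.ae_phantomTime_lt_top hp0 hp1 hΔ] with ω h1 h2 i
    exact ⟨(h1.subtree i).existsUnique_isRDCP, h2 i⟩
  · intro t ht
    have hd := h.hasDerivWithinAt_lamDeriv hp0 hΔ ht
    rw [← h.typeDensity_eq hp0 hΔ ht] at hd
    exact ⟨h.hasDerivWithinAt ht, hd,
      by rw [h.typeDensity_eq hp0 hΔ ht, RDCP.tsum_z hΔ, mul_comm],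
      h.typeDensity_nonneg hp0 hΔ hν t⟩
  · exact ⟨h.isProbabilityMeasure_constraintKernel hp0 hp1 hΔ hν ht,
      h.isProbabilityMeasure_lastTypeKernel hp0 hΔ hν ht,
      h.isProbabilityMeasure_pairKernel hp0 hΔ hν ht⟩
  · have := RDCP.isProbabilityMeasure_rootLaw hp0 hp1 hΔ h
    have := RDCP.isProbabilityMeasure_mtbpLaw (p := p) (lam := lam)
    exact ⟨RDCP.aemeasurable_pwitTree hp0 hp1 hΔ t,
      Measure.isProbabilityMeasure_map (RDCP.measurable_cut t).aemeasurable,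
      RDCP.map_pwitTree hp0 hp1 hΔ h t⟩
  · rw [RDCP.map_phantomTime hp0 hp1 i]
    exact ⟨RDCP.aemeasurable_phantomTime hp0 hp1 i, RDCP.solvesRDE_phantomTime hp0 hp1,
      (h.map_typeLaw hp0 hΔ hν).symm⟩
  · have := hs.1
    exact (h.map_typeLaw hp0 hΔ (hs.hasEarlyLaw hp0 hΔ)).symm
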